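/- Let $(M,g)$ be a compact smooth Riemannian manifold without boundary, of dimension $n\ge 1$ (Hausdorff, not necessarily connected or orientable), with scalar curvature $R$. Suppose that $g$ is a gradient Yamabe soliton, i.e. there are a smooth function $f:M\to\mathbb R$ and a constant $\rho\in\mathbb R$ such that $$(R-\rho)\,g=\nabla^2 f \quad\text{on } M,$$ where $\nabla^2 f$ is the Hessian of $f$ with respect to the Levi-Civita connection of $g$. Then $R\equiv\rho$ on $M$; in particular $g$ has constant scalar curvature. No assumption is made on the sign of the curvature, and $g$ is not assumed to be locally conformally flat. -/

import Mathlib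

open Bundle
open scoped Manifold ContDiff Topology

noncomputable section

namespace RiemannianGeometry

section Sharp

variable {E : Type*} [NormedAddCommGroup E] [NormedSpace ℝ E] [FiniteDimensional ℝ E]
  {H : Type*} [TopologicalSpace H] {I : ModelWithCorners ℝ E H}
  {M : Type*} [TopologicalSpace M] [ChartedSpace H M]
  [RiemannianBundle (fun x : M ↦ TangentSpace I x)]

/-- Raising an index: the vector at `x` whose inner product with every `w` is `α w`. -/
def sharp (x : M) (α : TangentSpace I x →L[ℝ] ℝ) : TangentSpace I x :=
  haveI : FiniteDimensional ℝ (TangentSpace I x) := inferInstanceAs (FiniteDimensional ℝ E)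
  haveI : CompleteSpace (TangentSpace I x) := FiniteDimensional.complete ℝ (TangentSpace I x)
  (InnerProductSpace.toDual ℝ (TangentSpace I x)).symm α

lemma inner_sharp (x : M) (α : TangentSpace I x →L[ℝ] ℝ) (w : TangentSpace I x) :
    inner ℝ (sharp x α) w = α w := by
  have : FiniteDimensional ℝ (TangentSpace I x) := inferInstanceAs (FiniteDimensional ℝ E)
  have : CompleteSpace (TangentSpace I x) := FiniteDimensional.complete ℝ (TangentSpace I x)
  exact InnerProductSpace.toDual_symm_apply

lemma sharp_add (x : M) (α β : TangentSpace I x →L[ℝ] ℝ) :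
    sharp x (α + β) = sharp x α + sharp x β := by
  refine ext_inner_right ℝ fun w ↦ ?_
  rw [inner_add_left, inner_sharp, inner_sharp, inner_sharp, add_apply]

lemma sharp_smul (x : M) (c : ℝ) (α : TangentSpace I x →L[ℝ] ℝ) :
    sharp x (c • α) = c • sharp x α := by
  refine ext_inner_right ℝ fun w ↦ ?_
  rw [real_inner_smul_left, inner_sharp, inner_sharp, smul_apply, smul_eq_mul]

end Sharp

section Koszul

variable {E : Type*} [NormedAddCommGroup E] [NormedSpace ℝ E]
  {H : Type*} [TopologicalSpace H] {I : ModelWithCorners ℝ E H}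
  {M : Type*} [TopologicalSpace M] [ChartedSpace H M]
  [RiemannianBundle (fun x : M ↦ TangentSpace I x)]

/-- The right-hand side of the Koszul formula, i.e. the value at `x` of
`(X⟨Y,Z⟩ + Y⟨X,Z⟩ - Z⟨X,Y⟩ + ⟨[X,Y],Z⟩ - ⟨[X,Z],Y⟩ - ⟨[Y,Z],X⟩) / 2`. -/
def koszul (X Y Z : Π x : M, TangentSpace I x) (x : M) : ℝ :=
  (mvfderiv I (fun y ↦ (inner ℝ (Y y) (Z y) : ℝ)) x (X x)
    + mvfderiv I (fun y ↦ (inner ℝ (X y) (Z y) : ℝ)) x (Y x)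
    - mvfderiv I (fun y ↦ (inner ℝ (X y) (Y y) : ℝ)) x (Z x)
    + inner ℝ (VectorField.mlieBracket I X Y x) (Z x)
    - inner ℝ (VectorField.mlieBracket I X Z x) (Y x)
    - inner ℝ (VectorField.mlieBracket I Y Z x) (X x)) / 2

lemma inner_fun_comm (X Y : Π x : M, TangentSpace I x) :
    (fun y ↦ (inner ℝ (X y) (Y y) : ℝ)) = fun y ↦ (inner ℝ (Y y) (X y) : ℝ) := by
  funext y
  exact real_inner_comm _ _

lemma koszul_sub_swap (X Y Z : Π x : M, TangentSpace I x) (x : M) :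
    koszul X Y Z x - koszul Y X Z x = inner ℝ (VectorField.mlieBracket I X Y x) (Z x) := by
  simp only [koszul, VectorField.mlieBracket_swap_apply (V := Y) (W := X), inner_neg_left,
    inner_fun_comm Y X]
  ring

lemma koszul_add_swap (X Y Z : Π x : M, TangentSpace I x) (x : M) :
    koszul X Y Z x + koszul X Z Y x
      = mvfderiv I (fun y ↦ (inner ℝ (Y y) (Z y) : ℝ)) x (X x) := by
  simp only [koszul, VectorField.mlieBracket_swap_apply (V := Z) (W := Y), inner_neg_left,
    inner_fun_comm Z Y]
  ring

variable [IsManifold I ∞ M]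
  [IsContMDiffRiemannianBundle I ∞ E (fun x : M ↦ TangentSpace I x)]
  {X X' Y Y' Z Z' : Π x : M, TangentSpace I x} {x : M} {f : M → ℝ}

lemma mdifferentiableAt_inner (hX : MDiffAt (T% X) x) (hY : MDiffAt (T% Y) x) :
    MDiffAt (fun y ↦ (inner ℝ (X y) (Y y) : ℝ)) x :=
  MDifferentiableAt.inner_bundle (IB := I) (IM := I) (F := E)
    (E := fun x : M ↦ TangentSpace I x) (v := X) (w := Y) (b := fun x ↦ x) hX hY

lemma mvfderiv_inner_smul
    (hf : MDiffAt f x) (hX : MDiffAt (T% X) x) (hY : MDiffAt (T% Y) x) :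
    mvfderiv I (fun y ↦ (inner ℝ ((f • X) y) (Y y) : ℝ)) x
      = f x • mvfderiv I (fun y ↦ (inner ℝ (X y) (Y y) : ℝ)) x
        + (inner ℝ (X x) (Y x) : ℝ) • mvfderiv I f x := by
  have h : (fun y ↦ (inner ℝ ((f • X) y) (Y y) : ℝ))
      = fun y ↦ f y * (inner ℝ (X y) (Y y) : ℝ) := by
    funext y
    exact real_inner_smul_left _ _ _
  rw [h]
  exact mvfderiv_fun_mul hf (mdifferentiableAt_inner hX hY)

lemma mvfderiv_inner_add
    (hX : MDiffAt (T% X) x) (hX' : MDiffAt (T% X') x) (hY : MDiffAt (T% Y) x) :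
    mvfderiv I (fun y ↦ (inner ℝ ((X + X') y) (Y y) : ℝ)) x
      = mvfderiv I (fun y ↦ (inner ℝ (X y) (Y y) : ℝ)) x
        + mvfderiv I (fun y ↦ (inner ℝ (X' y) (Y y) : ℝ)) x := by
  have h : (fun y ↦ (inner ℝ ((X + X') y) (Y y) : ℝ))
      = fun y ↦ (inner ℝ (X y) (Y y) : ℝ) + (inner ℝ (X' y) (Y y) : ℝ) := by
    funext y
    exact inner_add_left _ _ _
  rw [h]
  exact mvfderiv_fun_add (mdifferentiableAt_inner hX hY) (mdifferentiableAt_inner hX' hY)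

variable [FiniteDimensional ℝ E]

lemma koszul_smul_fst (hf : MDiffAt f x) (hX : MDiffAt (T% X) x) (hY : MDiffAt (T% Y) x)
    (hZ : MDiffAt (T% Z) x) : koszul (f • X) Y Z x = f x * koszul X Y Z x := by
  have e : (f • X) x = f x • X x := rfl
  simp only [koszul, mvfderiv_inner_smul hf hX hZ, mvfderiv_inner_smul hf hX hY,
    VectorField.mlieBracket_smul_left hf hX, e, map_smul, add_apply, smul_apply,
    smul_eq_mul, inner_add_left, real_inner_smul_left, real_inner_smul_right]
  ring

lemma koszul_add_fst (hX : MDiffAt (T% X) x) (hX' : MDiffAt (T% X') x)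
    (hY : MDiffAt (T% Y) x) (hZ : MDiffAt (T% Z) x) :
    koszul (X + X') Y Z x = koszul X Y Z x + koszul X' Y Z x := by
  have e : (X + X') x = X x + X' x := rfl
  simp only [koszul, mvfderiv_inner_add hX hX' hZ, mvfderiv_inner_add hX hX' hY,
    VectorField.mlieBracket_add_left hX hX', e, map_add, add_apply,
    inner_add_left, inner_add_right]
  ring

lemma koszul_smul_snd (hf : MDiffAt f x) (hX : MDiffAt (T% X) x) (hY : MDiffAt (T% Y) x)
    (hZ : MDiffAt (T% Z) x) : koszul X (f • Y) Z x
      = f x * koszul X Y Z x + mvfderiv I f x (X x) * inner ℝ (Y x) (Z x) := by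
  have h1 := koszul_sub_swap X (f • Y) Z x
  have h2 := koszul_sub_swap X Y Z x
  rw [koszul_smul_fst hf hY hX hZ, VectorField.mlieBracket_smul_right hf hY,
    inner_add_left, real_inner_smul_left, real_inner_smul_left] at h1
  linear_combination h1 - f x * h2

lemma koszul_add_snd (hX : MDiffAt (T% X) x) (hY : MDiffAt (T% Y) x)
    (hY' : MDiffAt (T% Y') x) (hZ : MDiffAt (T% Z) x) :
    koszul X (Y + Y') Z x = koszul X Y Z x + koszul X Y' Z x := by
  have h1 := koszul_sub_swap X (Y + Y') Z x
  have h2 := koszul_sub_swap X Y Z x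
  have h3 := koszul_sub_swap X Y' Z x
  rw [koszul_add_fst hY hY' hX hZ, VectorField.mlieBracket_add_right hY hY',
    inner_add_left] at h1
  linear_combination h1 - h2 - h3

lemma koszul_smul_trd (hf : MDiffAt f x) (hX : MDiffAt (T% X) x) (hY : MDiffAt (T% Y) x)
    (hZ : MDiffAt (T% Z) x) : koszul X Y (f • Z) x = f x * koszul X Y Z x := by
  have h1 := koszul_add_swap X Y (f • Z) x
  have h2 := koszul_add_swap X Y Z x
  rw [koszul_smul_snd hf hX hZ hY, inner_fun_comm, mvfderiv_inner_smul hf hZ hY,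
    inner_fun_comm] at h1
  simp only [add_apply, smul_apply, smul_eq_mul] at h1
  linear_combination h1 - f x * h2

lemma koszul_add_trd (hX : MDiffAt (T% X) x) (hY : MDiffAt (T% Y) x)
    (hZ : MDiffAt (T% Z) x) (hZ' : MDiffAt (T% Z') x) :
    koszul X Y (Z + Z') x = koszul X Y Z x + koszul X Y Z' x := by
  have h1 := koszul_add_swap X Y (Z + Z') x
  have h2 := koszul_add_swap X Y Z x
  have h3 := koszul_add_swap X Y Z' x
  rw [koszul_add_snd hX hZ hZ' hY, inner_fun_comm, mvfderiv_inner_add hZ hZ' hY,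
    inner_fun_comm Z, inner_fun_comm Z'] at h1
  simp only [add_apply] at h1
  linear_combination h1 - h2 - h3

/-- For `Y` differentiable at `x`, the Koszul expression is tensorial in `X` and `Z`, so it is
a bilinear form on the tangent space at `x`. -/
def koszulForm (Y : Π x : M, TangentSpace I x) (x : M) (hY : MDiffAt (T% Y) x) :
    TangentSpace I x →L[ℝ] TangentSpace I x →L[ℝ] ℝ :=
  TensorialAt.mkHom₂ (I := I) (F := E) (F' := E) (fun X Z ↦ koszul X Y Z x) x
    (fun _ hZ ↦ ⟨fun hf hX ↦ koszul_smul_fst hf hX hY hZ,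
      fun hX hX' ↦ koszul_add_fst hX hX' hY hZ⟩)
    (fun _ hX ↦ ⟨fun hf hZ ↦ koszul_smul_trd hf hX hY hZ,
      fun hZ hZ' ↦ koszul_add_trd hX hY hZ hZ'⟩)

lemma koszulForm_apply (hX : MDiffAt (T% X) x) (hY : MDiffAt (T% Y) x)
    (hZ : MDiffAt (T% Z) x) : koszulForm Y x hY (X x) (Z x) = koszul X Y Z x :=
  TensorialAt.mkHom₂_apply (I := I) (F := E) (F' := E) (Φ := fun X Z ↦ koszul X Y Z x)
    (fun _ hZ ↦ ⟨fun hf hX ↦ koszul_smul_fst hf hX hY hZ,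
      fun hX hX' ↦ koszul_add_fst hX hX' hY hZ⟩)
    (fun _ hX ↦ ⟨fun hf hZ ↦ koszul_smul_trd hf hX hY hZ,
      fun hZ hZ' ↦ koszul_add_trd hX hY hZ hZ'⟩) hX hZ

open Classical in
/-- `∇ Y` at `x` as a linear map `v ↦ ∇_v Y`, determined by the Koszul formula
`⟨∇_X Y, Z⟩ = koszul X Y Z`; as usual it is set to zero where `Y` is not differentiable. -/
def leviCivitaFun (Y : Π x : M, TangentSpace I x) (x : M) :
    TangentSpace I x →L[ℝ] TangentSpace I x :=
  haveI : FiniteDimensional ℝ (TangentSpace I x) := inferInstanceAs (FiniteDimensional ℝ E)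
  if hY : MDiffAt (T% Y) x then
    LinearMap.toContinuousLinearMap
      { toFun := fun v ↦ sharp x (koszulForm Y x hY v)
        map_add' := fun v w ↦ by rw [map_add, sharp_add]
        map_smul' := fun c v ↦ by rw [map_smul, sharp_smul, RingHom.id_apply] }
  else 0

/-- The Koszul formula. -/
lemma inner_leviCivitaFun (hX : MDiffAt (T% X) x) (hY : MDiffAt (T% Y) x)
    (hZ : MDiffAt (T% Z) x) :
    inner ℝ (leviCivitaFun Y x (X x)) (Z x) = koszul X Y Z x := by
  rw [leviCivitaFun, dif_pos hY, ← koszulForm_apply hX hY hZ]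
  exact inner_sharp x _ _

lemma leviCivitaFun_ext {A B : TangentSpace I x →L[ℝ] TangentSpace I x}
    (h : ∀ X Z : Π x : M, TangentSpace I x, MDiffAt (T% X) x → MDiffAt (T% Z) x →
      inner ℝ (A (X x)) (Z x) = (inner ℝ (B (X x)) (Z x) : ℝ)) : A = B := by
  ext1 v
  refine ext_inner_right ℝ fun w ↦ ?_
  simpa using h (FiberBundle.extend E v) (FiberBundle.extend E w)
    (FiberBundle.mdifferentiableAt_extend ..) (FiberBundle.mdifferentiableAt_extend ..)

variable (I M) in
/-- The Levi-Civita connection of a Riemannian manifold. -/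
def leviCivita : CovariantDerivative I E (TangentSpace I : M → Type _) where
  toFun := leviCivitaFun
  isCovariantDerivativeOnUniv :=
    { add := fun {Y Y' x} hY hY' _ ↦ by
        refine leviCivitaFun_ext fun X Z hX hZ ↦ ?_
        rw [inner_leviCivitaFun hX (mdifferentiableAt_add_section hY hY') hZ, add_apply,
          inner_add_left, inner_leviCivitaFun hX hY hZ, inner_leviCivitaFun hX hY' hZ,
          koszul_add_snd hX hY hY' hZ]
      leibniz := fun {Y f x} hY hf _ ↦ by
        refine leviCivitaFun_ext fun X Z hX hZ ↦ ?_
        rw [inner_leviCivitaFun hX (hf.smul_section hY) hZ, add_apply, smul_apply,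
          ContinuousLinearMap.smulRight_apply, inner_add_left, real_inner_smul_left,
          real_inner_smul_left, inner_leviCivitaFun hX hY hZ, koszul_smul_snd hf hX hY hZ] }

/-- The Levi-Civita connection is torsion-free. -/
lemma leviCivita_torsion : (leviCivita I M).torsion = 0 := by
  rw [CovariantDerivative.torsion_eq_zero_iff]
  intro X Y x hX hY
  refine ext_inner_right ℝ fun w ↦ ?_
  have hZ : MDiffAt (T% (FiberBundle.extend E w : Π x : M, TangentSpace I x)) x :=
    FiberBundle.mdifferentiableAt_extend ..
  have h1 := inner_leviCivitaFun hX hY hZ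
  have h2 := inner_leviCivitaFun hY hX hZ
  have h3 := koszul_sub_swap X Y (FiberBundle.extend E w) x
  rw [← h1, ← h2] at h3
  simpa [inner_sub_left] using! h3

/-- The Levi-Civita connection is compatible with the metric. -/
lemma leviCivita_metric (hX : MDiffAt (T% X) x) (hY : MDiffAt (T% Y) x)
    (hZ : MDiffAt (T% Z) x) :
    mvfderiv I (fun y ↦ (inner ℝ (Y y) (Z y) : ℝ)) x (X x)
      = inner ℝ (leviCivita I M Y x (X x)) (Z x) + inner ℝ (Y x) (leviCivita I M Z x (X x)) := by
  have h1 := inner_leviCivitaFun hX hY hZ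
  have h2 := inner_leviCivitaFun hX hZ hY
  rw [← koszul_add_swap, ← h1, ← h2, real_inner_comm (Y x)]
  rfl

end Koszul

section Curvature

variable {E : Type*} [NormedAddCommGroup E] [NormedSpace ℝ E] [FiniteDimensional ℝ E]
  {H : Type*} [TopologicalSpace H] {I : ModelWithCorners ℝ E H}
  {M : Type*} [TopologicalSpace M] [ChartedSpace H M] [IsManifold I ∞ M]
  [RiemannianBundle (fun x : M ↦ TangentSpace I x)]
  [IsContMDiffRiemannianBundle I ∞ E (fun x : M ↦ TangentSpace I x)]

/-- `R(X,Y)Z = ∇_X ∇_Y Z - ∇_Y ∇_X Z - ∇_[X,Y] Z` for vector fields `X`, `Y`, `Z`. -/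
def curvature (X Y Z : Π x : M, TangentSpace I x) (x : M) : TangentSpace I x :=
  leviCivita I M (fun y ↦ leviCivita I M Z y (Y y)) x (X x)
    - leviCivita I M (fun y ↦ leviCivita I M Z y (X y)) x (Y x)
    - leviCivita I M Z x (VectorField.mlieBracket I X Y x)

/-- The curvature tensor `R(u,v)w` on the tangent space at `x`, computed with the vector fields
extending `u`, `v`, `w` that are constant in the trivialization of the tangent bundle at `x`. -/
def curvatureTensor (x : M) (u v w : TangentSpace I x) : TangentSpace I x :=
  curvature (FiberBundle.extend E u) (FiberBundle.extend E v) (FiberBundle.extend E w) x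

/-- The Ricci tensor `Ric(v,w) = tr (u ↦ R(u,v)w)`, computed in an orthonormal basis. -/
def ricci (x : M) (v w : TangentSpace I x) : ℝ :=
  haveI : FiniteDimensional ℝ (TangentSpace I x) := inferInstanceAs (FiniteDimensional ℝ E)
  ∑ i, inner ℝ (curvatureTensor x (stdOrthonormalBasis ℝ (TangentSpace I x) i) v w)
    (stdOrthonormalBasis ℝ (TangentSpace I x) i)

variable (I) in
/-- The scalar curvature, the metric trace of the Ricci tensor. -/
def scalarCurvature (x : M) : ℝ :=
  haveI : FiniteDimensional ℝ (TangentSpace I x) := inferInstanceAs (FiniteDimensional ℝ E)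
  ∑ i, ricci x (stdOrthonormalBasis ℝ (TangentSpace I x) i)
    (stdOrthonormalBasis ℝ (TangentSpace I x) i)

variable (I) in
/-- The gradient vector field of a function. -/
def riemannianGradient (f : M → ℝ) (x : M) : TangentSpace I x :=
  sharp x (mvfderiv I f x)

/-- The Hessian `∇²f(v,w) = ⟨∇_v ∇f, w⟩`. -/
def hessian (f : M → ℝ) (x : M) (v w : TangentSpace I x) : ℝ :=
  inner ℝ (leviCivita I M (riemannianGradient I f) x v) w

variable (I) in
/-- The Riemannian metric on `M` (given by the instances), together with the potential `f`, is a
gradient Yamabe soliton with constant `ρ`: `f` is smooth and `(R - ρ) g = ∇²f`. -/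
def IsGradientYamabeSoliton (f : M → ℝ) (ρ : ℝ) : Prop :=
  ContMDiff I 𝓘(ℝ, ℝ) ∞ f ∧
    ∀ (x : M) (v w : TangentSpace I x),
      (scalarCurvature I x - ρ) * inner ℝ v w = hessian f x v w

end Curvature

end RiemannianGeometry

end

/-! Write φ = R - ρ, X = ∇f and w = |∇f|². The soliton equation says ∇_Y X = φ Y for every field Y,
so X is a conformal gradient field. Three consequences hold in every dimension: dw = 2φ df; R(Y,Z)X
= dφ(Y) Z - dφ(Z) Y; and, pairing the latter with X, dφ ∧ df = 0. It suffices to show w = 0, for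
then X = 0 and φ Y = ∇_Y X = 0. The maximum arguments share one device (`le_of_le_on_zeroSet`): a
continuous function on compact M without critical points off {w = 0} is bounded by its values on {w
= 0}. Adding ε f makes the derivative along X nonzero, because Xf = w, and then ε tends to 0.

n = 1: here R = 0, so φ = -ρ. If ρ ≠ 0, then dw = -2ρ df vanishes only where w does, and the device
gives w = 0.

n ≥ 3: where w ≠ 0 one has dφ = ψ df with ψ = Xφ / w. Differentiating the scalar curvature along X
gives Xφ = -2φR - 2(n-1)(Xψ + nψφ) (`fieldDeriv_gradient_factor`). Hence G = w^(n/2) ((n-1)ψ + φ/2 +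
ρ/n) satisfies XG = (n/2 - 1) φ² w^(n/2) ≥ 0, and G extends continuously by 0 to the critical
points. The device applied to ±(G + ε f) gives G = 0, so φ = 0 wherever w ≠ 0; then dw = 0 there,
and the device gives w = 0 (`factor_eq_zero`). Nothing is integrated.

n = 2: now XG = 0, and a global argument replaces the above. On a surface dR = -(R/2) df, so on each
component R = C exp(-f/2) and w = W(f) with W(s) = B - 4C exp(-s/2) - 2ρs and W' = 2φ
(`exists_profile`). If f is not constant on a component, W vanishes at the extreme values of f and
is positive at a value in between; so C > 0, W is strictly concave, and the only critical points are
nondegenerate extrema (`profile_shape`). A mountain pass argument shows that there is one minimum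
point p and one maximum point q (`eq_of_minimum`). The divergence theorem for u∇f, with u
concentrating at p and q, yields φ(p) = -φ(q) (`factor_eq_neg_factor`): the surface closes up
smoothly at both poles. A strictly concave W of the above form never has opposite slopes at its two
zeros (`profile_slopes_ne`), a contradiction. -/

/-! ### Calculus of functions and vector fields that are smooth on a set -/

section SmoothCalculus

set_option linter.unusedSectionVars false

namespace RiemannianGeometry

variable {E : Type*} [NormedAddCommGroup E] [NormedSpace ℝ E]
  {H : Type*} [TopologicalSpace H] {I : ModelWithCorners ℝ E H}
  {M : Type*} [TopologicalSpace M] [ChartedSpace H M]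

variable (I) in
/-- The vector field `X` is smooth at every point of `U`. -/
def SmoothField [IsManifold I ∞ M] (X : Π x : M, TangentSpace I x) (U : Set M) : Prop :=
  ∀ y ∈ U, ContMDiffAt I (I.prod 𝓘(ℝ, E)) ∞ (T% X) y

variable (I) in
/-- The function `f` is smooth at every point of `U`. -/
def SmoothFun (f : M → ℝ) (U : Set M) : Prop :=
  ∀ y ∈ U, ContMDiffAt I 𝓘(ℝ, ℝ) ∞ f y

variable (I) in
/-- The derivative of a function along a vector field. -/
noncomputable def fieldDeriv (X : Π x : M, TangentSpace I x) (f : M → ℝ) (x : M) : ℝ :=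
  mvfderiv I f x (X x)

variable {X Y Z : Π x : M, TangentSpace I x} {f g : M → ℝ} {U V : Set M} {x : M}

lemma SmoothFun.mono (h : SmoothFun I f U) (hV : V ⊆ U) : SmoothFun I f V := fun y hy ↦ h y (hV hy)

lemma SmoothFun.mdiffAt (h : SmoothFun I f U) (hx : x ∈ U) : MDiffAt f x :=
  (h x hx).mdifferentiableAt (by simp)

lemma SmoothFun.add (hf : SmoothFun I f U) (hg : SmoothFun I g U) : SmoothFun I (f + g) U :=
  fun y hy ↦ (hf y hy).add (hg y hy)

lemma SmoothFun.sub (hf : SmoothFun I f U) (hg : SmoothFun I g U) : SmoothFun I (f - g) U :=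
  fun y hy ↦ (hf y hy).sub (hg y hy)

lemma SmoothFun.mul (hf : SmoothFun I f U) (hg : SmoothFun I g U) : SmoothFun I (f * g) U :=
  fun y hy ↦ (hf y hy).mul (hg y hy)

lemma SmoothFun.const (c : ℝ) : SmoothFun I (fun _ : M ↦ c) U :=
  fun _ _ ↦ contMDiffAt_const

lemma SmoothFun.inv (hf : SmoothFun I f U) (h0 : ∀ y ∈ U, f y ≠ 0) : SmoothFun I (f⁻¹) U :=
  fun y hy ↦ by
    have h1 : ContDiffAt ℝ ∞ (fun t : ℝ ↦ t⁻¹) (f y) := contDiffAt_inv ℝ (h0 y hy)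
    exact h1.contMDiffAt.comp y (hf y hy)

lemma SmoothFun.div (hf : SmoothFun I f U) (hg : SmoothFun I g U) (h0 : ∀ y ∈ U, g y ≠ 0) :
    SmoothFun I (f / g) U := by
  rw [div_eq_mul_inv]
  exact hf.mul (hg.inv h0)

lemma SmoothFun.comp {k : ℝ → ℝ} (hf : SmoothFun I f U) (hk : ∀ y ∈ U, ContDiffAt ℝ ∞ k (f y)) :
    SmoothFun I (fun y ↦ k (f y)) U :=
  fun y hy ↦ (hk y hy).contMDiffAt.comp y (hf y hy)

lemma SmoothFun.sum {ι : Type*} {s : Finset ι} {F : ι → M → ℝ}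
    (h : ∀ i ∈ s, SmoothFun I (F i) U) : SmoothFun I (fun y ↦ ∑ i ∈ s, F i y) U :=
  fun y hy ↦ ContMDiffAt.sum fun i hi ↦ h i hi y hy

lemma SmoothFun.congr (hf : SmoothFun I f U) (hU : IsOpen U) (h : ∀ y ∈ U, g y = f y) :
    SmoothFun I g U :=
  fun y hy ↦ (hf y hy).congr_of_eventuallyEq
    (Filter.eventuallyEq_of_mem (hU.mem_nhds hy) h)

section fieldDeriv

lemma fieldDeriv_congr (hU : IsOpen U) (hx : x ∈ U) (h : ∀ y ∈ U, f y = g y) :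
    fieldDeriv I X f x = fieldDeriv I X g x := by
  have : f =ᶠ[𝓝 x] g := Filter.eventuallyEq_of_mem (hU.mem_nhds hx) h
  simp only [fieldDeriv, mvfderiv, this.mfderiv_eq]
  rfl

lemma fieldDeriv_add_fun (hf : SmoothFun I f U) (hg : SmoothFun I g U) (hx : x ∈ U) :
    fieldDeriv I X (f + g) x = fieldDeriv I X f x + fieldDeriv I X g x := by
  simp [fieldDeriv, mvfderiv_add (hf.mdiffAt hx) (hg.mdiffAt hx)]

lemma fieldDeriv_sub_fun (hf : SmoothFun I f U) (hg : SmoothFun I g U) (hx : x ∈ U) :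
    fieldDeriv I X (f - g) x = fieldDeriv I X f x - fieldDeriv I X g x := by
  simp [fieldDeriv, mvfderiv_sub (hf.mdiffAt hx) (hg.mdiffAt hx)]

lemma fieldDeriv_mul_fun (hf : SmoothFun I f U) (hg : SmoothFun I g U) (hx : x ∈ U) :
    fieldDeriv I X (f * g) x = f x * fieldDeriv I X g x + g x * fieldDeriv I X f x := by
  simp [fieldDeriv, mvfderiv_mul (hf.mdiffAt hx) (hg.mdiffAt hx)]

lemma fieldDeriv_const (c : ℝ) : fieldDeriv I X (fun _ ↦ c) x = 0 := by
  simp [fieldDeriv, mvfderiv_const]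

lemma fieldDeriv_sum {ι : Type*} {s : Finset ι} {F : ι → M → ℝ}
    (h : ∀ i ∈ s, SmoothFun I (F i) U) (hx : x ∈ U) :
    fieldDeriv I X (fun y ↦ ∑ i ∈ s, F i y) x = ∑ i ∈ s, fieldDeriv I X (F i) x := by
  classical
  induction s using Finset.induction_on with
  | empty => simpa using fieldDeriv_const 0
  | insert a s ha ih =>
    simp only [Finset.sum_insert ha]
    rw [← ih fun i hi ↦ h i (Finset.mem_insert_of_mem hi)]
    exact fieldDeriv_add_fun (h a (Finset.mem_insert_self a s))
      (SmoothFun.sum fun i hi ↦ h i (Finset.mem_insert_of_mem hi)) hx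

lemma mvfderiv_comp_real {k : ℝ → ℝ} {k' : ℝ} (hf : MDiffAt f x) (hk : HasDerivAt k k' (f x)) :
    mvfderiv I (fun y ↦ k (f y)) x = k' • mvfderiv I f x := by
  have h1 : HasMFDerivAt 𝓘(ℝ, ℝ) 𝓘(ℝ, ℝ) k (f x) (ContinuousLinearMap.toSpanSingleton ℝ k') :=
    hk.hasFDerivAt.hasMFDerivAt
  have h2 := (h1.comp x hf.hasMFDerivAt).mfderiv
  have h3 : mfderiv I 𝓘(ℝ, ℝ) (fun y ↦ k (f y)) x
    = (ContinuousLinearMap.toSpanSingleton ℝ k').comp (mfderiv I 𝓘(ℝ, ℝ) f x) := h2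
  ext v
  simp only [mvfderiv]
  have h4 : ∀ a : ℝ, a * k' = k' * a := fun a ↦ mul_comm a k'
  rw [h3]
  exact h4 _

lemma fieldDeriv_comp_real {k : ℝ → ℝ} {k' : ℝ} (hf : SmoothFun I f U) (hx : x ∈ U)
    (hk : HasDerivAt k k' (f x)) :
    fieldDeriv I X (fun y ↦ k (f y)) x = k' * fieldDeriv I X f x := by
  simp [fieldDeriv, mvfderiv_comp_real (hf.mdiffAt hx) hk]

end fieldDeriv

variable [IsManifold I ∞ M]

lemma SmoothField.mono (h : SmoothField I X U) (hV : V ⊆ U) : SmoothField I X V :=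
  fun y hy ↦ h y (hV hy)

lemma SmoothField.mdiffAt (h : SmoothField I X U) (hx : x ∈ U) : MDiffAt (T% X) x :=
  (h x hx).mdifferentiableAt (by simp)

lemma SmoothField.add (hX : SmoothField I X U) (hY : SmoothField I Y U) :
    SmoothField I (X + Y) U := fun y hy ↦ (hX y hy).add_section (hY y hy)

lemma SmoothField.sub (hX : SmoothField I X U) (hY : SmoothField I Y U) :
    SmoothField I (X - Y) U := fun y hy ↦ (hX y hy).sub_section (hY y hy)

lemma SmoothFun.smul (hf : SmoothFun I f U) (hX : SmoothField I X U) :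
    SmoothField I (f • X) U := fun y hy ↦ (hf y hy).smul_section (hX y hy)

lemma SmoothField.sum {ι : Type*} {s : Finset ι} {F : ι → Π x : M, TangentSpace I x}
    (h : ∀ i ∈ s, SmoothField I (F i) U) : SmoothField I (fun y ↦ ∑ i ∈ s, F i y) U :=
  fun y hy ↦ ContMDiffAt.sum_section fun i hi ↦ h i hi y hy

lemma SmoothField.congr (hX : SmoothField I X U) (hU : IsOpen U) (h : ∀ y ∈ U, Y y = X y) :
    SmoothField I Y U := fun y hy ↦ (hX y hy).congr_of_eventuallyEq <| by
  filter_upwards [hU.mem_nhds hy] with z hz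
  rw [h z hz]

lemma SmoothField.bracket [CompleteSpace E] (hX : SmoothField I X U) (hY : SmoothField I Y U) :
    SmoothField I (VectorField.mlieBracket I X Y) U := by
  intro y hy
  -- The bracket costs one derivative, which is harmless since ∞ + 1 = ∞.
  have : IsManifold I (((⊤ : ℕ∞) : ℕ∞ω) + 1) M := by
    simpa using! (inferInstance : IsManifold I ∞ M)
  have : IsManifold I (minSmoothness ℝ 2) M := by
    simpa using! (inferInstance : IsManifold I 2 M)
  exact ContMDiffAt.mlieBracket_vectorField (m := ⊤) (n := ⊤) (hX y hy) (hY y hy) (by simp)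

lemma mlieBracket_congr {X' Y' : Π x : M, TangentSpace I x} (hU : IsOpen U) (hx : x ∈ U)
    (hX : ∀ y ∈ U, X' y = X y)
    (hY : ∀ y ∈ U, Y' y = Y y) :
    VectorField.mlieBracket I X' Y' x = VectorField.mlieBracket I X Y x :=
  Filter.EventuallyEq.mlieBracket_vectorField_eq
    (Filter.eventuallyEq_of_mem (hU.mem_nhds hx) hX)
    (Filter.eventuallyEq_of_mem (hU.mem_nhds hx) hY)

lemma SmoothField.extend (x : M) (v : TangentSpace I x) :
    ∃ U : Set M, IsOpen U ∧ x ∈ U ∧ SmoothField I (FiberBundle.extend E v) U := by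
  obtain ⟨U, hU, h⟩ := FiberBundle.exists_contMDiffOn_extend (I := I) (F := E) (k := ∞) v
  obtain ⟨V, hVU, hV, hx⟩ := mem_nhds_iff.mp hU
  exact ⟨V, hV, hx, fun y hy ↦ (h y (hVU hy)).contMDiffAt
    (Filter.mem_of_superset (hV.mem_nhds hy) hVU)⟩

end RiemannianGeometry

end SmoothCalculus

/-! ### Orthonormal frames; vector fields as derivations -/

section Frames

set_option linter.unusedSectionVars false

namespace RiemannianGeometry

variable {E : Type*} [NormedAddCommGroup E] [NormedSpace ℝ E] [FiniteDimensional ℝ E]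
  {H : Type*} [TopologicalSpace H] {I : ModelWithCorners ℝ E H}
  {M : Type*} [TopologicalSpace M] [ChartedSpace H M] [IsManifold I ∞ M]
  [RiemannianBundle (fun x : M ↦ TangentSpace I x)]
  [IsContMDiffRiemannianBundle I ∞ E (fun x : M ↦ TangentSpace I x)]
  {X Y Z : Π x : M, TangentSpace I x} {f g : M → ℝ} {U V : Set M} {x : M}

lemma SmoothField.innerFun (hX : SmoothField I X U) (hY : SmoothField I Y U) :
    SmoothFun I (fun y ↦ (inner ℝ (X y) (Y y) : ℝ)) U := fun y hy ↦
  ContMDiffAt.inner_bundle (IB := I) (IM := I) (F := E)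
    (E := fun x : M ↦ TangentSpace I x) (v := X) (w := Y) (b := fun x ↦ x) (hX y hy) (hY y hy)

variable (I) in
/-- A smooth orthonormal frame of the tangent bundle on the open set `U`. -/
structure IsOrthoFrame {ι : Type*} (e : ι → Π x : M, TangentSpace I x) (U : Set M) : Prop where
  isOpen : IsOpen U
  smooth : ∀ i, SmoothField I (e i) U
  orthonormal : ∀ y ∈ U, Orthonormal ℝ (fun i ↦ e i y)

/-- The Gram-Schmidt process preserves smoothness. -/
lemma SmoothField.gramSchmidt {n : ℕ} {s : Fin n → Π x : M, TangentSpace I x}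
    (hs : ∀ i, SmoothField I (s i) U)
    (hli : ∀ y ∈ U, LinearIndependent ℝ (fun i ↦ s i y)) (i : Fin n) :
    SmoothField I (fun y ↦ InnerProductSpace.gramSchmidt ℝ (fun i ↦ s i y) i) U := by
  induction i using WellFoundedLT.induction with
  | _ i ih =>
    -- The projection coefficients are quotients of smooth functions whose denominators, the squared
    -- norms of the earlier vectors, do not vanish.
    have h1 : (fun y ↦ InnerProductSpace.gramSchmidt ℝ (fun i ↦ s i y) i) = s i -
        fun y ↦ ∑ j ∈ Finset.Iio i,
          ((fun y ↦ (inner ℝ (InnerProductSpace.gramSchmidt ℝ (fun i ↦ s i y) j) (s i y) : ℝ)) /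
          (fun y ↦ (inner ℝ (InnerProductSpace.gramSchmidt ℝ (fun i ↦ s i y) j)
            (InnerProductSpace.gramSchmidt ℝ (fun i ↦ s i y) j) : ℝ))) y •
          InnerProductSpace.gramSchmidt ℝ (fun i ↦ s i y) j := by
      funext y
      rw [InnerProductSpace.gramSchmidt_def]
      simp only [Pi.sub_apply]
      congr 1
      refine Finset.sum_congr rfl fun j _ ↦ ?_
      rw [Submodule.starProjection_singleton]
      simp
    rw [h1]
    refine (hs i).sub (SmoothField.sum fun j hj ↦ ?_)
    have hj' := ih j (Finset.mem_Iio.mp hj)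
    refine SmoothFun.smul (SmoothFun.div (hj'.innerFun (hs i)) (hj'.innerFun hj') fun y hy ↦ ?_) hj'
    rw [real_inner_self_eq_norm_sq]
    exact pow_ne_zero 2 (norm_ne_zero_iff.mpr
      (InnerProductSpace.gramSchmidt_ne_zero j (hli y hy)))

-- Gram-Schmidt with normalization, applied to the frame that a trivialization of the tangent bundle
-- induces from a basis of `E`.
variable (I) in
lemma exists_isOrthoFrame (x : M) : ∃ (U : Set M) (e : Fin (Module.finrank ℝ E) →
    Π x : M, TangentSpace I x), x ∈ U ∧ IsOrthoFrame I e U := by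
  set t := trivializationAt E (TangentSpace I : M → Type _) x
  let s := t.localFrame (Module.finBasis ℝ E)
  have hs : IsLocalFrameOn I E ∞ s t.baseSet :=
    t.isLocalFrameOn_localFrame_baseSet I ∞ (Module.finBasis ℝ E)
  have hsm : ∀ i, SmoothField I (s i) t.baseSet := fun i y hy ↦ hs.contMDiffAt t.open_baseSet hy i
  have hli : ∀ y ∈ t.baseSet, LinearIndependent ℝ (fun i ↦ s i y) :=
    fun y hy ↦ hs.linearIndependent hy
  have hgs := SmoothField.gramSchmidt hsm hli
  refine ⟨t.baseSet, fun i y ↦ InnerProductSpace.gramSchmidtNormed ℝ (fun i ↦ s i y) i,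
    FiberBundle.mem_baseSet_trivializationAt' x, t.open_baseSet, fun i ↦ ?_,
    fun y hy ↦ InnerProductSpace.gramSchmidtNormed_orthonormal (hli y hy)⟩
  have h2 : (fun y ↦ InnerProductSpace.gramSchmidtNormed ℝ (fun i ↦ s i y) i) =
      (fun y ↦ (Real.sqrt (inner ℝ (InnerProductSpace.gramSchmidt ℝ (fun i ↦ s i y) i)
        (InnerProductSpace.gramSchmidt ℝ (fun i ↦ s i y) i)))⁻¹) •
      fun y ↦ InnerProductSpace.gramSchmidt ℝ (fun i ↦ s i y) i := by
    funext y
    simp [InnerProductSpace.gramSchmidtNormed]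
  rw [h2]
  refine SmoothFun.smul (SmoothFun.inv (((hgs i).innerFun (hgs i)).comp (k := Real.sqrt)
    fun y hy ↦ ?_) fun y hy ↦ ?_) (hgs i)
  · refine Real.contDiffAt_sqrt ?_
    rw [real_inner_self_eq_norm_sq]
    exact pow_ne_zero 2 (norm_ne_zero_iff.mpr
      (InnerProductSpace.gramSchmidt_ne_zero i (hli y hy)))
  · rw [← norm_eq_sqrt_real_inner]
    exact norm_ne_zero_iff.mpr (InnerProductSpace.gramSchmidt_ne_zero i (hli y hy))

namespace IsOrthoFrame

variable {e : Fin (Module.finrank ℝ E) → Π x : M, TangentSpace I x}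

lemma mono (h : IsOrthoFrame I e U) (hV : IsOpen V) (hVU : V ⊆ U) : IsOrthoFrame I e V :=
  ⟨hV, fun i ↦ (h.smooth i).mono hVU, fun y hy ↦ h.orthonormal y (hVU hy)⟩

lemma exists_orthonormalBasis (h : IsOrthoFrame I e U) (hx : x ∈ U) :
    ∃ b : OrthonormalBasis (Fin (Module.finrank ℝ E)) ℝ (TangentSpace I x), ∀ i, b i = e i x := by
  have : FiniteDimensional ℝ (TangentSpace I x) := inferInstanceAs (FiniteDimensional ℝ E)
  have h1 : Fintype.card (Fin (Module.finrank ℝ E)) = Module.finrank ℝ (TangentSpace I x) := by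
    rw [Fintype.card_fin]; rfl
  have h2 := (h.orthonormal x hx).linearIndependent.span_eq_top_of_card_eq_finrank' h1
  exact ⟨OrthonormalBasis.mk (h.orthonormal x hx) h2.ge, fun i ↦ by simp⟩

lemma sum_inner_smul (h : IsOrthoFrame I e U) (hx : x ∈ U) (v : TangentSpace I x) :
    ∑ i, (inner ℝ (e i x) v : ℝ) • e i x = v := by
  obtain ⟨b, hb⟩ := h.exists_orthonormalBasis hx
  simpa [hb] using b.sum_repr' v

lemma inner_apply (h : IsOrthoFrame I e U) (hx : x ∈ U) (i j : Fin (Module.finrank ℝ E)) :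
    (inner ℝ (e i x) (e j x) : ℝ) = if i = j then 1 else 0 :=
  orthonormal_iff_ite.mp (h.orthonormal x hx) i j

/-- A vector field is smooth as soon as its components in an orthonormal frame are. -/
lemma smoothField_of_inner (h : IsOrthoFrame I e U)
    (hX : ∀ i, SmoothFun I (fun y ↦ (inner ℝ (X y) (e i y) : ℝ)) U) : SmoothField I X U := by
  refine SmoothField.congr (X := fun y ↦ ∑ i,
    ((fun y ↦ (inner ℝ (X y) (e i y) : ℝ)) • e i) y)
    (SmoothField.sum fun i _ ↦ SmoothFun.smul (hX i) (h.smooth i)) h.isOpen fun y hy ↦ ?_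
  refine (h.sum_inner_smul hy (X y)).symm.trans (Finset.sum_congr rfl fun i _ ↦ ?_)
  simp only [Pi.smul_apply']
  rw [real_inner_comm]

end IsOrthoFrame

section Derivative

variable [Nontrivial E]

/-- The derivative of a smooth function along a smooth vector field is smooth. -/
lemma SmoothField.fieldDeriv (hU : IsOpen U) (hX : SmoothField I X U) (hf : SmoothFun I f U) :
    SmoothFun I (fieldDeriv I X f) U := by
  intro x hx
  obtain ⟨V, e, hxV, he'⟩ := exists_isOrthoFrame I x
  have he := he'.mono (hU.inter he'.isOpen) Set.inter_subset_right
  have hX' := hX.mono (Set.inter_subset_left (t := V))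
  have hf' := hf.mono (Set.inter_subset_left (t := V))
  let i : Fin (Module.finrank ℝ E) := ⟨0, Module.finrank_pos⟩
  -- By the Leibniz rule [X, f e] - f [X, e] = (Xf) e, and e is a unit field; so Xf is an inner
  -- product of smooth fields. Nontriviality of `E` provides e.
  have key : ∀ y ∈ U ∩ V, RiemannianGeometry.fieldDeriv I X f y =
      inner ℝ ((VectorField.mlieBracket I X (f • e i) - f • VectorField.mlieBracket I X (e i)) y)
        (e i y) := by
    intro y hy
    have h1 := VectorField.mlieBracket_smul_right (I := I) (V := X) (hf'.mdiffAt hy)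
      ((he.smooth i).mdiffAt hy)
    have h2 := he.inner_apply hy i i
    simp only [Pi.sub_apply, Pi.smul_apply', h1, add_sub_cancel_right, real_inner_smul_left, h2]
    simp [RiemannianGeometry.fieldDeriv]
  refine SmoothFun.congr (U := U ∩ V) ?_ he.isOpen key x ⟨hx, hxV⟩
  exact SmoothField.innerFun ((hX'.bracket (hf'.smul (he.smooth i))).sub
    (hf'.smul (hX'.bracket (he.smooth i)))) (he.smooth i)

/-- The Lie bracket is the commutator of the derivations. -/
lemma fieldDeriv_comm (hU : IsOpen U) (hX : SmoothField I X U) (hY : SmoothField I Y U)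
    (hf : SmoothFun I f U) (hx : x ∈ U) :
    fieldDeriv I X (fieldDeriv I Y f) x - fieldDeriv I Y (fieldDeriv I X f) x =
      fieldDeriv I (VectorField.mlieBracket I X Y) f x := by
  obtain ⟨V, e, hxV, he'⟩ := exists_isOrthoFrame I x
  have he := he'.mono (hU.inter he'.isOpen) Set.inter_subset_right
  have hX' := hX.mono (Set.inter_subset_left (t := V))
  have hY' := hY.mono (Set.inter_subset_left (t := V))
  have hf' := hf.mono (Set.inter_subset_left (t := V))
  let i : Fin (Module.finrank ℝ E) := ⟨0, Module.finrank_pos⟩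
  have hZ := he.smooth i
  have hxUV : x ∈ U ∩ V := ⟨hx, hxV⟩
  have hUV := he.isOpen
  set Z := e i
  -- Expand the Jacobi identity for X, Y and f Z by the Leibniz rule. After the identity for X, Y
  -- and Z is subtracted f times, the mixed terms cancel and the coefficient of the unit field Z is
  -- the claim.
  have step : ∀ X Y : Π x : M, TangentSpace I x, SmoothField I X (U ∩ V) →
      SmoothField I Y (U ∩ V) →
      VectorField.mlieBracket I X (VectorField.mlieBracket I Y (f • Z)) x =
        RiemannianGeometry.fieldDeriv I X (RiemannianGeometry.fieldDeriv I Y f) x • Z x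
        + RiemannianGeometry.fieldDeriv I Y f x • VectorField.mlieBracket I X Z x
        + (RiemannianGeometry.fieldDeriv I X f x • VectorField.mlieBracket I Y Z x
        + f x • VectorField.mlieBracket I X (VectorField.mlieBracket I Y Z) x) := by
    intro X Y hX hY
    have h1 : ∀ y ∈ U ∩ V, VectorField.mlieBracket I Y (f • Z) y =
        (RiemannianGeometry.fieldDeriv I Y f • Z + f • VectorField.mlieBracket I Y Z) y :=
      fun y hy ↦ VectorField.mlieBracket_smul_right (hf'.mdiffAt hy) (hZ.mdiffAt hy)
    rw [mlieBracket_congr hUV hxUV (fun _ _ ↦ rfl) h1,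
      VectorField.mlieBracket_add_right
        (((hY.fieldDeriv hUV hf').smul hZ).mdiffAt hxUV)
        ((hf'.smul (hY.bracket hZ)).mdiffAt hxUV),
      VectorField.mlieBracket_smul_right ((hY.fieldDeriv hUV hf').mdiffAt hxUV)
        (hZ.mdiffAt hxUV),
      VectorField.mlieBracket_smul_right (hf'.mdiffAt hxUV) ((hY.bracket hZ).mdiffAt hxUV)]
    rfl
  have : IsManifold I (minSmoothness ℝ 3) M := by
    simpa using! (inferInstance : IsManifold I 3 M)
  have h2 : minSmoothness ℝ 2 ≤ ∞ := by
    rw [minSmoothness_of_isRCLikeNormedField]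
    exact (WithTop.coe_le_coe.2 le_top : ((2 : ℕ∞) : ℕ∞ω) ≤ ((⊤ : ℕ∞) : ℕ∞ω))
  have jac : ∀ W : Π x : M, TangentSpace I x, SmoothField I W (U ∩ V) →
      VectorField.mlieBracket I X (VectorField.mlieBracket I Y W) x =
        VectorField.mlieBracket I (VectorField.mlieBracket I X Y) W x
        + VectorField.mlieBracket I Y (VectorField.mlieBracket I X W) x := fun W hW ↦
    VectorField.leibniz_identity_mlieBracket_apply ((hX' x hxUV).of_le h2)
      ((hY' x hxUV).of_le h2) ((hW x hxUV).of_le h2)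
  have j1 := jac _ (hf'.smul hZ)
  have j2 := jac _ hZ
  rw [step X Y hX' hY', step Y X hY' hX', j2,
    VectorField.mlieBracket_smul_right (hf'.mdiffAt hxUV) (hZ.mdiffAt hxUV)] at j1
  have j3 := congrArg (fun v ↦ (inner ℝ (Z x) v : ℝ)) j1
  simp only [inner_add_right, real_inner_smul_right, he.inner_apply hxUV i i, Z, if_true] at j3
  simp only [RiemannianGeometry.fieldDeriv] at j3 ⊢
  linear_combination j3

end Derivative

end RiemannianGeometry

end Frames

/-! ### Covariant derivatives of smooth fields; the curvature is a tensor -/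

section CurvatureTensor

set_option linter.unusedSectionVars false

namespace RiemannianGeometry

variable {E : Type*} [NormedAddCommGroup E] [NormedSpace ℝ E] [FiniteDimensional ℝ E]
  {H : Type*} [TopologicalSpace H] {I : ModelWithCorners ℝ E H}
  {M : Type*} [TopologicalSpace M] [ChartedSpace H M] [IsManifold I ∞ M]
  [RiemannianBundle (fun x : M ↦ TangentSpace I x)]
  [IsContMDiffRiemannianBundle I ∞ E (fun x : M ↦ TangentSpace I x)]
  {X X' Y Y' Z Z' W : Π x : M, TangentSpace I x} {f g : M → ℝ} {U V : Set M} {x : M}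

/-- The covariant derivative of the field `Y` along the field `X`. -/
noncomputable def covD (X Y : Π x : M, TangentSpace I x) (x : M) : TangentSpace I x :=
  leviCivita I M Y x (X x)

lemma covD_congr (hU : IsOpen U) (hx : x ∈ U) (hY : SmoothField I Y U)
    (h : ∀ y ∈ U, Y' y = Y y) : covD X Y' x = covD X Y x := by
  have hY' : SmoothField I Y' U := hY.congr hU h
  have := (leviCivita I M).isCovariantDerivativeOnUniv.congr_of_eventuallyEq (hY'.mdiffAt hx)
    (hY.mdiffAt hx) Filter.univ_mem (Filter.eventuallyEq_of_mem (hU.mem_nhds hx) h)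
  simp only [covD]
  exact congrArg (fun A ↦ A (X x)) this

lemma covD_add_left : covD (X + X') Y x = covD X Y x + covD X' Y x := map_add _ _ _

lemma covD_smul_left : covD (f • X) Y x = f x • covD X Y x := map_smul _ _ _

lemma covD_add_right (hY : SmoothField I Y U) (hY' : SmoothField I Y' U) (hx : x ∈ U) :
    covD X (Y + Y') x = covD X Y x + covD X Y' x := by
  simp only [covD]
  rw [(leviCivita I M).isCovariantDerivativeOnUniv.add (hY.mdiffAt hx) (hY'.mdiffAt hx)]
  rfl

lemma covD_smul_right (hf : SmoothFun I f U) (hY : SmoothField I Y U) (hx : x ∈ U) :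
    covD X (f • Y) x = f x • covD X Y x + fieldDeriv I X f x • Y x := by
  simp only [covD]
  rw [(leviCivita I M).isCovariantDerivativeOnUniv.leibniz (hY.mdiffAt hx) (hf.mdiffAt hx)]
  rfl

lemma covD_sub_right (hY : SmoothField I Y U) (hY' : SmoothField I Y' U) (hx : x ∈ U) :
    covD X (Y - Y') x = covD X Y x - covD X Y' x := by
  have h := covD_add_right (X := X) (hY.sub hY') hY' hx
  rw [sub_add_cancel] at h
  rw [h, add_sub_cancel_right]

lemma covD_sub_swap (hX : SmoothField I X U) (hY : SmoothField I Y U) (hx : x ∈ U) :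
    covD X Y x - covD Y X x = VectorField.mlieBracket I X Y x :=
  ((leviCivita I M).torsion_eq_zero_iff).mp leviCivita_torsion (hX.mdiffAt hx) (hY.mdiffAt hx)

lemma fieldDeriv_inner (hX : SmoothField I X U) (hY : SmoothField I Y U) (hZ : SmoothField I Z U)
    (hx : x ∈ U) : fieldDeriv I X (fun y ↦ (inner ℝ (Y y) (Z y) : ℝ)) x =
      inner ℝ (covD X Y x) (Z x) + inner ℝ (Y x) (covD X Z x) :=
  leviCivita_metric (hX.mdiffAt hx) (hY.mdiffAt hx) (hZ.mdiffAt hx)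

section Curvature

variable [Nontrivial E]

lemma SmoothField.koszul (hU : IsOpen U) (hX : SmoothField I X U) (hY : SmoothField I Y U)
    (hZ : SmoothField I Z U) : SmoothFun I (koszul X Y Z) U := by
  have h1 := hX.fieldDeriv hU (hY.innerFun hZ)
  have h2 := hY.fieldDeriv hU (hX.innerFun hZ)
  have h3 := hZ.fieldDeriv hU (hX.innerFun hY)
  have h4 := (hX.bracket hY).innerFun hZ
  have h5 := (hX.bracket hZ).innerFun hY
  have h6 := (hY.bracket hZ).innerFun hX
  exact ((((((h1.add h2).sub h3).add h4).sub h5).sub h6).mul (SmoothFun.const 2⁻¹)).congr hU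
    fun y _ ↦ div_eq_mul_inv _ _

/-- The covariant derivative of smooth fields is smooth. -/
lemma SmoothField.covD (hU : IsOpen U) (hX : SmoothField I X U) (hY : SmoothField I Y U) :
    SmoothField I (covD X Y) U := by
  intro x hx
  obtain ⟨V, e, hxV, he'⟩ := exists_isOrthoFrame I x
  have he := he'.mono (hU.inter he'.isOpen) Set.inter_subset_right
  have hX' := hX.mono (Set.inter_subset_left (t := V))
  have hY' := hY.mono (Set.inter_subset_left (t := V))
  -- The components of ∇_X Y in the frame are Koszul expressions, which involve only brackets and
  -- derivatives of inner products.
  refine he.smoothField_of_inner (fun i ↦ ?_) x ⟨hx, hxV⟩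
  exact (hX'.koszul he.isOpen hY' (he.smooth i)).congr he.isOpen fun y hy ↦
    inner_leviCivitaFun (hX'.mdiffAt hy) (hY'.mdiffAt hy) ((he.smooth i).mdiffAt hy)

lemma curvature_eq : curvature X Y Z x = covD X (covD Y Z) x - covD Y (covD X Z) x
    - covD (VectorField.mlieBracket I X Y) Z x := rfl

lemma curvature_swap : curvature X Y Z x = -curvature Y X Z x := by
  have h : covD (VectorField.mlieBracket I X Y) Z x
      = -covD (VectorField.mlieBracket I Y X) Z x := by
    rw [covD, VectorField.mlieBracket_swap_apply, map_neg, covD]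
  rw [curvature_eq, curvature_eq, h]
  abel

lemma curvature_add_fst (hU : IsOpen U) (hX : SmoothField I X U) (hX' : SmoothField I X' U)
    (hZ : SmoothField I Z U) (hx : x ∈ U) :
    curvature (X + X') Y Z x = curvature X Y Z x + curvature X' Y Z x := by
  have h1 : covD (X + X') Z = covD X Z + covD X' Z := funext fun y ↦ covD_add_left
  have h2 : covD (VectorField.mlieBracket I (X + X') Y) Z x =
      covD (VectorField.mlieBracket I X Y) Z x + covD (VectorField.mlieBracket I X' Y) Z x := by
    rw [covD, VectorField.mlieBracket_add_left (hX.mdiffAt hx) (hX'.mdiffAt hx), map_add]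
    rfl
  rw [curvature_eq, curvature_eq, curvature_eq, h1, h2, covD_add_left,
    covD_add_right (hX.covD hU hZ) (hX'.covD hU hZ) hx]
  abel

lemma curvature_smul_fst (hU : IsOpen U) (hf : SmoothFun I f U) (hX : SmoothField I X U)
    (hZ : SmoothField I Z U) (hx : x ∈ U) :
    curvature (f • X) Y Z x = f x • curvature X Y Z x := by
  have h1 : covD (f • X) Z = f • covD X Z := funext fun y ↦ covD_smul_left
  have h2 : covD (VectorField.mlieBracket I (f • X) Y) Z x =
      - (fieldDeriv I Y f x • covD X Z x) + f x • covD (VectorField.mlieBracket I X Y) Z x := by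
    rw [covD, VectorField.mlieBracket_smul_left (hf.mdiffAt hx) (hX.mdiffAt hx), map_add,
      map_smul, map_smul, neg_smul]
    rfl
  rw [curvature_eq, curvature_eq, h1, h2, covD_smul_left, covD_smul_right hf (hX.covD hU hZ) hx]
  module

lemma curvature_add_trd (hU : IsOpen U) (hX : SmoothField I X U)
    (hY : SmoothField I Y U) (hZ : SmoothField I Z U) (hZ' : SmoothField I Z' U) (hx : x ∈ U) :
    curvature X Y (Z + Z') x = curvature X Y Z x + curvature X Y Z' x := by
  have h : ∀ X Y : Π x : M, TangentSpace I x, SmoothField I X U → SmoothField I Y U →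
      covD X (covD Y (Z + Z')) x = covD X (covD Y Z) x + covD X (covD Y Z') x := by
    intro X Y hX hY
    rw [covD_congr hU hx ((hY.covD hU hZ).add (hY.covD hU hZ'))
      fun y hy ↦ covD_add_right hZ hZ' hy,
      covD_add_right (hY.covD hU hZ) (hY.covD hU hZ') hx]
  rw [curvature_eq, curvature_eq, curvature_eq, h X Y hX hY, h Y X hY hX,
    covD_add_right hZ hZ' hx]
  abel

lemma covD_covD_smul (hU : IsOpen U) (hf : SmoothFun I f U)
    (hY : SmoothField I Y U) (hZ : SmoothField I Z U) (hx : x ∈ U) :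
    covD X (covD Y (f • Z)) x = f x • covD X (covD Y Z) x + fieldDeriv I X f x • covD Y Z x
      + (fieldDeriv I Y f x • covD X Z x + fieldDeriv I X (fieldDeriv I Y f) x • Z x) := by
  rw [covD_congr hU hx ((hf.smul (hY.covD hU hZ)).add ((hY.fieldDeriv hU hf).smul hZ))
      fun y hy ↦ covD_smul_right hf hZ hy,
    covD_add_right (hf.smul (hY.covD hU hZ)) ((hY.fieldDeriv hU hf).smul hZ) hx,
    covD_smul_right hf (hY.covD hU hZ) hx, covD_smul_right (hY.fieldDeriv hU hf) hZ hx]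

/-- The second derivatives of f enter as X(Yf) - Y(Xf) - [X,Y]f, which is zero by `fieldDeriv_comm`;
the first derivatives cancel in pairs. -/
lemma curvature_smul_trd (hU : IsOpen U) (hf : SmoothFun I f U) (hX : SmoothField I X U)
    (hY : SmoothField I Y U) (hZ : SmoothField I Z U) (hx : x ∈ U) :
    curvature X Y (f • Z) x = f x • curvature X Y Z x := by
  have h := fieldDeriv_comm hU hX hY hf hx
  rw [curvature_eq, curvature_eq, covD_covD_smul hU hf hY hZ hx, covD_covD_smul hU hf hX hZ hx,
    covD_smul_right hf hZ hx, ← h]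
  module

/-- A local operation on smooth fields which is linear over smooth functions is pointwise. -/
lemma eq_of_eval_eq {A : Type*} [AddCommGroup A] [Module ℝ A]
    {e : Fin (Module.finrank ℝ E) → Π x : M, TangentSpace I x} (he : IsOrthoFrame I e U)
    (Φ : (Π x : M, TangentSpace I x) → A)
    (hadd : ∀ X Y : Π x : M, TangentSpace I x, SmoothField I X U → SmoothField I Y U →
      Φ (X + Y) = Φ X + Φ Y)
    (hsmul : ∀ (f : M → ℝ) (X : Π x : M, TangentSpace I x), SmoothFun I f U →
      SmoothField I X U → Φ (f • X) = f x • Φ X)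
    (hcongr : ∀ X Y : Π x : M, TangentSpace I x, SmoothField I X U → (∀ y ∈ U, Y y = X y) →
      Φ Y = Φ X)
    (hX : SmoothField I X U) (hY : SmoothField I Y U) (h : X x = Y x) : Φ X = Φ Y := by
  -- Expand X in the frame near x; linearity over functions retains only the values of the
  -- coefficients at x.
  have key : ∀ X : Π x : M, TangentSpace I x, SmoothField I X U →
      Φ X = ∑ i, (inner ℝ (e i x) (X x) : ℝ) • Φ (e i) := by
    intro X hX
    have hc : ∀ i, SmoothFun I (fun y ↦ (inner ℝ (e i y) (X y) : ℝ)) U :=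
      fun i ↦ (he.smooth i).innerFun hX
    have hs : ∀ s : Finset (Fin (Module.finrank ℝ E)),
        Φ (fun y ↦ ∑ i ∈ s, ((fun y ↦ (inner ℝ (e i y) (X y) : ℝ)) • e i) y)
          = ∑ i ∈ s, (inner ℝ (e i x) (X x) : ℝ) • Φ (e i) := by
      intro s
      induction s using Finset.induction_on with
      | empty =>
        have h0 := hsmul (fun _ ↦ 0) X (SmoothFun.const 0) hX
        simp only [zero_smul] at h0
        simp only [Finset.sum_empty]
        rw [← h0]
        congr 1
        funext y
        simp
      | insert a s ha ih =>
        simp only [Finset.sum_insert ha]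
        rw [← ih, ← hsmul _ _ (hc a) (he.smooth a)]
        exact hadd _ _ ((hc a).smul (he.smooth a))
          (SmoothField.sum fun i _ ↦ (hc i).smul (he.smooth i))
    rw [← hs Finset.univ]
    refine hcongr _ _ (SmoothField.sum fun i _ ↦ (hc i).smul (he.smooth i)) fun y hy ↦ ?_
    exact (he.sum_inner_smul hy (X y)).symm
  rw [key X hX, key Y hY, h]

lemma curvature_congr_fst (hU : IsOpen U) (hX : SmoothField I X U) (hZ : SmoothField I Z U)
    (h : ∀ y ∈ U, X' y = X y) (hx : x ∈ U) : curvature X' Y Z x = curvature X Y Z x := by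
  have h1 : ∀ y ∈ U, covD X' Z y = covD X Z y := fun y hy ↦ by rw [covD, covD, h y hy]
  have h2 : covD (VectorField.mlieBracket I X' Y) Z x
      = covD (VectorField.mlieBracket I X Y) Z x := by
    rw [covD, covD, mlieBracket_congr hU hx h fun _ _ ↦ rfl]
  rw [curvature_eq, curvature_eq, h2, covD_congr hU hx (hX.covD hU hZ) h1, covD, covD, h x hx]
  rfl

lemma curvature_congr_trd (hU : IsOpen U) (hX : SmoothField I X U) (hY : SmoothField I Y U)
    (hZ : SmoothField I Z U)
    (h : ∀ y ∈ U, Z' y = Z y) (hx : x ∈ U) : curvature X Y Z' x = curvature X Y Z x := by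
  have h1 : ∀ W : Π x : M, TangentSpace I x, ∀ y ∈ U, covD W Z' y = covD W Z y :=
    fun W y hy ↦ covD_congr hU hy hZ h
  rw [curvature_eq, curvature_eq, h1 _ x hx, covD_congr hU hx (hX.covD hU hZ) (h1 X),
    covD_congr hU hx (hY.covD hU hZ) (h1 Y)]

/-- Tensoriality is needed only in the first and third slots; antisymmetry transfers it to the
second. -/
lemma curvature_eq_of_eval_eq (hU : IsOpen U) (hX : SmoothField I X U) (hX' : SmoothField I X' U)
    (hY : SmoothField I Y U) (hY' : SmoothField I Y' U) (hZ : SmoothField I Z U)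
    (hZ' : SmoothField I Z' U) (hx : x ∈ U) (h1 : X x = X' x) (h2 : Y x = Y' x)
    (h3 : Z x = Z' x) : curvature X Y Z x = curvature X' Y' Z' x := by
  obtain ⟨V, e, hxV, he'⟩ := exists_isOrthoFrame I x
  have he := he'.mono (hU.inter he'.isOpen) Set.inter_subset_right
  have hs : U ∩ V ⊆ U := Set.inter_subset_left
  have hxUV : x ∈ U ∩ V := ⟨hx, hxV⟩
  have hUV := he.isOpen
  have fst : ∀ {X X' Y Z : Π x : M, TangentSpace I x}, SmoothField I X (U ∩ V) →
      SmoothField I X' (U ∩ V) → SmoothField I Z (U ∩ V) →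
      X x = X' x → curvature X Y Z x = curvature X' Y Z x :=
    fun {X X' Y Z} hX hX' hZ h ↦ eq_of_eval_eq he (fun X ↦ curvature X Y Z x)
      (fun _ _ h1 h2 ↦ curvature_add_fst hUV h1 h2 hZ hxUV)
      (fun _ _ h1 h2 ↦ curvature_smul_fst hUV h1 h2 hZ hxUV)
      (fun _ _ h1 h2 ↦ curvature_congr_fst hUV h1 hZ h2 hxUV) hX hX' h
  have trd : ∀ {X Y Z Z' : Π x : M, TangentSpace I x}, SmoothField I X (U ∩ V) →
      SmoothField I Y (U ∩ V) → SmoothField I Z (U ∩ V) → SmoothField I Z' (U ∩ V) →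
      Z x = Z' x → curvature X Y Z x = curvature X Y Z' x :=
    fun {X Y Z Z'} hX hY hZ hZ' h ↦ eq_of_eval_eq he (fun Z ↦ curvature X Y Z x)
      (fun _ _ h1 h2 ↦ curvature_add_trd hUV hX hY h1 h2 hxUV)
      (fun _ _ h1 h2 ↦ curvature_smul_trd hUV h1 hX hY h2 hxUV)
      (fun _ _ h1 h2 ↦ curvature_congr_trd hUV hX hY h1 h2 hxUV) hZ hZ' h
  rw [fst (hX.mono hs) (hX'.mono hs) (hZ.mono hs) h1, curvature_swap,
    fst (hY.mono hs) (hY'.mono hs) (hZ.mono hs) h2, ← curvature_swap,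
    trd (hX'.mono hs) (hY'.mono hs) (hZ.mono hs) (hZ'.mono hs) h3]

/-- The curvature of smooth fields is computed by the curvature tensor. -/
lemma curvature_eq_curvatureTensor (hU : IsOpen U) (hX : SmoothField I X U)
    (hY : SmoothField I Y U) (hZ : SmoothField I Z U) (hx : x ∈ U) :
    curvature X Y Z x = curvatureTensor x (X x) (Y x) (Z x) := by
  obtain ⟨V₁, hV₁, hx₁, h₁⟩ := SmoothField.extend (I := I) x (X x)
  obtain ⟨V₂, hV₂, hx₂, h₂⟩ := SmoothField.extend (I := I) x (Y x)
  obtain ⟨V₃, hV₃, hx₃, h₃⟩ := SmoothField.extend (I := I) x (Z x)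
  have hN : IsOpen (U ∩ (V₁ ∩ (V₂ ∩ V₃))) := hU.inter (hV₁.inter (hV₂.inter hV₃))
  exact curvature_eq_of_eval_eq hN (hX.mono fun y hy ↦ hy.1) (h₁.mono fun y hy ↦ hy.2.1)
    (hY.mono fun y hy ↦ hy.1) (h₂.mono fun y hy ↦ hy.2.2.1) (hZ.mono fun y hy ↦ hy.1)
    (h₃.mono fun y hy ↦ hy.2.2.2) ⟨hx, hx₁, hx₂, hx₃⟩ (by simp) (by simp) (by simp)

end Curvature

end RiemannianGeometry

end CurvatureTensor

/-! ### Symmetries of the curvature tensor -/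

section CurvatureSymmetries

set_option linter.unusedSectionVars false

namespace RiemannianGeometry

variable {E : Type*} [NormedAddCommGroup E] [NormedSpace ℝ E] [FiniteDimensional ℝ E]
  {H : Type*} [TopologicalSpace H] {I : ModelWithCorners ℝ E H}
  {M : Type*} [TopologicalSpace M] [ChartedSpace H M] [IsManifold I ∞ M]
  [RiemannianBundle (fun x : M ↦ TangentSpace I x)]
  [IsContMDiffRiemannianBundle I ∞ E (fun x : M ↦ TangentSpace I x)]
  {X X' Y Y' Z Z' W : Π x : M, TangentSpace I x} {f g : M → ℝ} {U V : Set M} {x : M}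
  [Nontrivial E]

/-- Metric compatibility turns the vanishing of X(Yh) - Y(Xh) - [X,Y]h for h = |Z|² into 2⟨R(X,Y)Z,
Z⟩ = 0. -/
lemma inner_curvature_self (hU : IsOpen U) (hX : SmoothField I X U)
    (hY : SmoothField I Y U) (hZ : SmoothField I Z U) (hx : x ∈ U) :
    (inner ℝ (curvature X Y Z x) (Z x) : ℝ) = 0 := by
  have step : ∀ X Y : Π x : M, TangentSpace I x, SmoothField I X U → SmoothField I Y U →
      fieldDeriv I X (fieldDeriv I Y (fun y ↦ (inner ℝ (Z y) (Z y) : ℝ))) x =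
        2 * inner ℝ (covD X (covD Y Z) x) (Z x) + 2 * inner ℝ (covD Y Z x) (covD X Z x) := by
    intro X Y hX hY
    have h1 : ∀ y ∈ U, fieldDeriv I Y (fun y ↦ (inner ℝ (Z y) (Z y) : ℝ)) y =
        ((fun _ ↦ (2 : ℝ)) * (fun y ↦ (inner ℝ (covD Y Z y) (Z y) : ℝ)) : M → ℝ) y := by
      intro y hy
      rw [fieldDeriv_inner hY hZ hZ hy, real_inner_comm (covD Y Z y) (Z y)]
      simp only [Pi.mul_apply]
      ring
    rw [fieldDeriv_congr hU hx h1, fieldDeriv_mul_fun (SmoothFun.const 2)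
      ((hY.covD hU hZ).innerFun hZ) hx, fieldDeriv_const, fieldDeriv_inner hX (hY.covD hU hZ) hZ hx]
    ring
  have h := fieldDeriv_comm hU hX hY (hZ.innerFun hZ) hx
  rw [step X Y hX hY, step Y X hY hX, fieldDeriv_inner (hX.bracket hY) hZ hZ hx] at h
  have h1 := real_inner_comm (Z x) (covD (VectorField.mlieBracket I X Y) Z x)
  have h2 := real_inner_comm (covD X Z x) (covD Y Z x)
  rw [curvature_eq, inner_sub_left, inner_sub_left]
  linarith

/-- Absence of torsion converts the differences of second covariant derivatives into brackets; what
remains is the Jacobi identity. -/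
lemma curvature_cyclic (hU : IsOpen U) (hX : SmoothField I X U)
    (hY : SmoothField I Y U) (hZ : SmoothField I Z U) (hx : x ∈ U) :
    curvature X Y Z x + curvature Y Z X x + curvature Z X Y x = 0 := by
  have : IsManifold I (minSmoothness ℝ 3) M := by
    simpa using! (inferInstance : IsManifold I 3 M)
  have h2 : minSmoothness ℝ 2 ≤ ∞ := by
    rw [minSmoothness_of_isRCLikeNormedField]
    exact (WithTop.coe_le_coe.2 le_top : ((2 : ℕ∞) : ℕ∞ω) ≤ ((⊤ : ℕ∞) : ℕ∞ω))
  have jac := VectorField.leibniz_identity_mlieBracket_apply (I := I) ((hX x hx).of_le h2)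
    ((hY x hx).of_le h2) ((hZ x hx).of_le h2)
  have key : ∀ X Y Z : Π x : M, TangentSpace I x, SmoothField I X U → SmoothField I Y U →
      SmoothField I Z U → covD X (covD Y Z) x - covD X (covD Z Y) x =
        covD (VectorField.mlieBracket I Y Z) X x
          + VectorField.mlieBracket I X (VectorField.mlieBracket I Y Z) x := by
    intro X Y Z hX hY hZ
    rw [← covD_sub_right (hY.covD hU hZ) (hZ.covD hU hY) hx,
      ← covD_sub_swap hX (hY.bracket hZ) hx, covD_congr (Y := covD Y Z - covD Z Y) hU hx
      ((hY.covD hU hZ).sub (hZ.covD hU hY)) fun y hy ↦ (covD_sub_swap hY hZ hy).symm]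
    abel
  have k1 := key X Y Z hX hY hZ
  have k2 := key Y Z X hY hZ hX
  have k3 := key Z X Y hZ hX hY
  have s1 : VectorField.mlieBracket I Y (VectorField.mlieBracket I X Z) x =
      - VectorField.mlieBracket I Y (VectorField.mlieBracket I Z X) x := by
    rw [VectorField.mlieBracket_swap (V := X) (W := Z), VectorField.mlieBracket_swap_apply,
      VectorField.mlieBracket_swap_apply (V := Y), neg_inj]
    have := VectorField.mlieBracket_const_smul_left (I := I) (W := Y) (c := (-1 : ℝ))
      ((hZ.bracket hX).mdiffAt hx)
    simpa using this
  have s2 : VectorField.mlieBracket I (VectorField.mlieBracket I X Y) Z x =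
      - VectorField.mlieBracket I Z (VectorField.mlieBracket I X Y) x :=
    VectorField.mlieBracket_swap_apply
  rw [s1, s2] at jac
  simp only [curvature_eq]
  have : covD X (covD Y Z) x - covD Y (covD X Z) x - covD (VectorField.mlieBracket I X Y) Z x +
      (covD Y (covD Z X) x - covD Z (covD Y X) x - covD (VectorField.mlieBracket I Y Z) X x) +
      (covD Z (covD X Y) x - covD X (covD Z Y) x - covD (VectorField.mlieBracket I Z X) Y x) =
      (covD X (covD Y Z) x - covD X (covD Z Y) x) + (covD Y (covD Z X) x - covD Y (covD X Z) x)
      + (covD Z (covD X Y) x - covD Z (covD Y X) x) - covD (VectorField.mlieBracket I X Y) Z x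
      - covD (VectorField.mlieBracket I Y Z) X x - covD (VectorField.mlieBracket I Z X) Y x := by
    abel
  rw [this, k1, k2, k3, jac]
  abel

lemma exists_smoothFields (x : M) (u v w : TangentSpace I x) :
    ∃ (U : Set M) (X Y Z : Π x : M, TangentSpace I x), IsOpen U ∧ x ∈ U ∧ SmoothField I X U ∧
      SmoothField I Y U ∧ SmoothField I Z U ∧ X x = u ∧ Y x = v ∧ Z x = w := by
  obtain ⟨V₁, hV₁, hx₁, h₁⟩ := SmoothField.extend (I := I) x u
  obtain ⟨V₂, hV₂, hx₂, h₂⟩ := SmoothField.extend (I := I) x v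
  obtain ⟨V₃, hV₃, hx₃, h₃⟩ := SmoothField.extend (I := I) x w
  exact ⟨V₁ ∩ (V₂ ∩ V₃), _, _, _, hV₁.inter (hV₂.inter hV₃), ⟨hx₁, hx₂, hx₃⟩,
    h₁.mono fun y hy ↦ hy.1, h₂.mono fun y hy ↦ hy.2.1, h₃.mono fun y hy ↦ hy.2.2,
    by simp, by simp, by simp⟩

variable {u u' v v' w w' z : TangentSpace I x}

lemma curvatureTensor_swap : curvatureTensor x u v w = -curvatureTensor x v u w := curvature_swap

lemma curvatureTensor_add_fst :
    curvatureTensor x (u + u') v w = curvatureTensor x u v w + curvatureTensor x u' v w := by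
  obtain ⟨U₁, X, Y, Z, hU₁, hx₁, hX, hY, hZ, rfl, rfl, rfl⟩ := exists_smoothFields x u v w
  obtain ⟨U₂, X', -, -, hU₂, hx₂, hX', -, -, rfl, -, -⟩ := exists_smoothFields x u' u' u'
  have hU := hU₁.inter hU₂
  have hx : x ∈ U₁ ∩ U₂ := ⟨hx₁, hx₂⟩
  replace hX := hX.mono (Set.inter_subset_left (t := U₂))
  replace hY := hY.mono (Set.inter_subset_left (t := U₂))
  replace hZ := hZ.mono (Set.inter_subset_left (t := U₂))
  replace hX' := hX'.mono (Set.inter_subset_right (s := U₁))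
  rw [← curvature_eq_curvatureTensor hU hX hY hZ hx, ← curvature_eq_curvatureTensor hU hX' hY hZ hx,
    ← curvature_add_fst hU hX hX' hZ hx]
  exact (curvature_eq_curvatureTensor hU (hX.add hX') hY hZ hx).symm

lemma curvatureTensor_smul_fst (c : ℝ) :
    curvatureTensor x (c • u) v w = c • curvatureTensor x u v w := by
  obtain ⟨U, X, Y, Z, hU, hx, hX, hY, hZ, rfl, rfl, rfl⟩ := exists_smoothFields x u v w
  rw [← curvature_eq_curvatureTensor hU hX hY hZ hx,
    ← curvature_smul_fst (f := fun _ ↦ c) hU (SmoothFun.const c) hX hZ hx]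
  exact (curvature_eq_curvatureTensor hU (SmoothFun.smul (SmoothFun.const c) hX) hY hZ hx).symm

lemma curvatureTensor_add_trd :
    curvatureTensor x u v (w + w') = curvatureTensor x u v w + curvatureTensor x u v w' := by
  obtain ⟨U₁, X, Y, Z, hU₁, hx₁, hX, hY, hZ, rfl, rfl, rfl⟩ := exists_smoothFields x u v w
  obtain ⟨U₂, Z', -, -, hU₂, hx₂, hZ', -, -, rfl, -, -⟩ := exists_smoothFields x w' w' w'
  have hU := hU₁.inter hU₂
  have hx : x ∈ U₁ ∩ U₂ := ⟨hx₁, hx₂⟩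
  replace hX := hX.mono (Set.inter_subset_left (t := U₂))
  replace hY := hY.mono (Set.inter_subset_left (t := U₂))
  replace hZ := hZ.mono (Set.inter_subset_left (t := U₂))
  replace hZ' := hZ'.mono (Set.inter_subset_right (s := U₁))
  rw [← curvature_eq_curvatureTensor hU hX hY hZ hx, ← curvature_eq_curvatureTensor hU hX hY hZ' hx,
    ← curvature_add_trd hU hX hY hZ hZ' hx]
  exact (curvature_eq_curvatureTensor hU hX hY (hZ.add hZ') hx).symm

lemma curvatureTensor_smul_trd (c : ℝ) :
    curvatureTensor x u v (c • w) = c • curvatureTensor x u v w := by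
  obtain ⟨U, X, Y, Z, hU, hx, hX, hY, hZ, rfl, rfl, rfl⟩ := exists_smoothFields x u v w
  rw [← curvature_eq_curvatureTensor hU hX hY hZ hx,
    ← curvature_smul_trd (f := fun _ ↦ c) hU (SmoothFun.const c) hX hY hZ hx]
  exact (curvature_eq_curvatureTensor hU hX hY (SmoothFun.smul (SmoothFun.const c) hZ) hx).symm

lemma curvatureTensor_add_snd :
    curvatureTensor x u (v + v') w = curvatureTensor x u v w + curvatureTensor x u v' w := by
  rw [curvatureTensor_swap, curvatureTensor_add_fst, neg_add, ← curvatureTensor_swap,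
    ← curvatureTensor_swap]

lemma curvatureTensor_smul_snd (c : ℝ) :
    curvatureTensor x u (c • v) w = c • curvatureTensor x u v w := by
  rw [curvatureTensor_swap, curvatureTensor_smul_fst, ← smul_neg, ← curvatureTensor_swap]

lemma inner_curvatureTensor_self : (inner ℝ (curvatureTensor x u v w) w : ℝ) = 0 := by
  obtain ⟨U, X, Y, Z, hU, hx, hX, hY, hZ, rfl, rfl, rfl⟩ := exists_smoothFields x u v w
  rw [← curvature_eq_curvatureTensor hU hX hY hZ hx]
  exact inner_curvature_self hU hX hY hZ hx

lemma inner_curvatureTensor_swap :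
    (inner ℝ (curvatureTensor x u v w) z : ℝ) = - inner ℝ (curvatureTensor x u v z) w := by
  have h := inner_curvatureTensor_self (u := u) (v := v) (w := w + z)
  rw [curvatureTensor_add_trd, inner_add_left, inner_add_right, inner_add_right,
    inner_curvatureTensor_self, inner_curvatureTensor_self] at h
  linarith

lemma curvatureTensor_cyclic :
    curvatureTensor x u v w + curvatureTensor x v w u + curvatureTensor x w u v = 0 := by
  obtain ⟨U, X, Y, Z, hU, hx, hX, hY, hZ, rfl, rfl, rfl⟩ := exists_smoothFields x u v w
  rw [← curvature_eq_curvatureTensor hU hX hY hZ hx, ← curvature_eq_curvatureTensor hU hY hZ hX hx,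
    ← curvature_eq_curvatureTensor hU hZ hX hY hx]
  exact curvature_cyclic hU hX hY hZ hx

/-- The pair symmetry of the curvature tensor. -/
lemma inner_curvatureTensor_comm :
    (inner ℝ (curvatureTensor x u v w) z : ℝ) = inner ℝ (curvatureTensor x w z u) v := by
  have c : ∀ a b c d : TangentSpace I x, (inner ℝ (curvatureTensor x a b c) d : ℝ)
      + inner ℝ (curvatureTensor x b c a) d + inner ℝ (curvatureTensor x c a b) d = 0 := by
    intro a b c d
    rw [← inner_add_left, ← inner_add_left, curvatureTensor_cyclic, inner_zero_left]
  have s : ∀ a b c d : TangentSpace I x, (inner ℝ (curvatureTensor x a b c) d : ℝ)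
      = - inner ℝ (curvatureTensor x b a c) d := by
    intro a b c d
    rw [curvatureTensor_swap, inner_neg_left]
  have t : ∀ a b c d : TangentSpace I x, (inner ℝ (curvatureTensor x a b c) d : ℝ)
      = - inner ℝ (curvatureTensor x a b d) c := fun a b c d ↦ inner_curvatureTensor_swap
  -- The usual octahedron argument: the cyclic identities for the four cyclic shifts of (u, v, w,
  -- z), combined with the antisymmetry in each pair.
  have c1 := c u v w z
  have c2 := c v w z u
  have c3 := c w z u v
  have c4 := c z u v w
  have a1 := t v w u z
  have a2 := s w u v z
  have a3 := t u w v z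
  have a4 := t w z v u
  have a5 := s z v w u
  have a6 := t v z w u
  have a7 := t z u w v
  have a8 := s u w z v
  have a9 := t u v z w
  have a10 := s v z u w
  have a11 := t z u v w
  have a12 := t v w z u
  linarith

end RiemannianGeometry

end CurvatureSymmetries

/-! ### Traces of the curvature; pointwise consequences of the soliton equation -/

section Soliton

set_option linter.unusedSectionVars false

namespace RiemannianGeometry

variable {E : Type*} [NormedAddCommGroup E] [NormedSpace ℝ E] [FiniteDimensional ℝ E]
  {H : Type*} [TopologicalSpace H] {I : ModelWithCorners ℝ E H}
  {M : Type*} [TopologicalSpace M] [ChartedSpace H M] [IsManifold I ∞ M]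
  [RiemannianBundle (fun x : M ↦ TangentSpace I x)]
  [IsContMDiffRiemannianBundle I ∞ E (fun x : M ↦ TangentSpace I x)]
  {X X' Y Y' Z Z' W : Π x : M, TangentSpace I x} {f g : M → ℝ} {U V : Set M} {x : M}
  [Nontrivial E]

section Trace

variable {ι κ : Type*} [Fintype ι] [Fintype κ]

/-- Both sums are the trace of T. This frees `ricci` and `scalarCurvature` from the standard basis
in their definitions, so that smooth frames may be used. -/
lemma sum_inner_apply_eq {F : Type*} [NormedAddCommGroup F] [InnerProductSpace ℝ F]
    (T : F →ₗ[ℝ] F) (b : OrthonormalBasis ι ℝ F) (c : OrthonormalBasis κ ℝ F) :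
    ∑ i, (inner ℝ (T (b i)) (b i) : ℝ) = ∑ i, (inner ℝ (T (c i)) (c i) : ℝ) := by
  have h1 := LinearMap.trace_eq_sum_inner T b
  have h2 := LinearMap.trace_eq_sum_inner T c
  simp only [real_inner_comm] at h1 h2 ⊢
  rw [← h1, ← h2]

lemma ricci_eq_sum (b : OrthonormalBasis ι ℝ (TangentSpace I x)) (v w : TangentSpace I x) :
    ricci x v w = ∑ i, (inner ℝ (curvatureTensor x (b i) v w) (b i) : ℝ) :=
  sum_inner_apply_eq (F := TangentSpace I x)
    { toFun := fun u ↦ curvatureTensor x u v w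
      map_add' := fun _ _ ↦ curvatureTensor_add_fst
      map_smul' := fun c _ ↦ curvatureTensor_smul_fst c } _ _

/-- The scalar curvature computed in an arbitrary orthonormal basis. -/
lemma scalarCurvature_eq_sum (b : OrthonormalBasis ι ℝ (TangentSpace I x)) :
    scalarCurvature I x = ∑ j, ∑ i, (inner ℝ (curvatureTensor x (b i) (b j) (b j)) (b i) : ℝ) := by
  -- The Ricci tensor as an endomorphism, so that the outer trace is basis independent too.
  let S : TangentSpace I x →ₗ[ℝ] TangentSpace I x :=
    { toFun := fun v ↦ -∑ i, curvatureTensor x (b i) v (b i)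
      map_add' := fun _ _ ↦ by
        simp only [curvatureTensor_add_snd, Finset.sum_add_distrib, neg_add]
      map_smul' := fun c _ ↦ by
        simp only [curvatureTensor_smul_snd, ← Finset.smul_sum, RingHom.id_apply, smul_neg] }
  have hS : ∀ v w, ricci x v w = inner ℝ (S v) w := by
    intro v w
    rw [ricci_eq_sum b]
    change _ = inner ℝ (-∑ i, curvatureTensor x (b i) v (b i)) w
    rw [inner_neg_left, sum_inner, ← Finset.sum_neg_distrib]
    exact Finset.sum_congr rfl fun i _ ↦ inner_curvatureTensor_swap
  simp only [← ricci_eq_sum b]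
  simp only [scalarCurvature, hS]
  exact sum_inner_apply_eq S _ _

lemma IsOrthoFrame.scalarCurvature_eq {e : Fin (Module.finrank ℝ E) → Π x : M, TangentSpace I x}
    (he : IsOrthoFrame I e U) (hx : x ∈ U) :
    scalarCurvature I x = ∑ j, ∑ i, (inner ℝ (curvature (e i) (e j) (e j) x) (e i x) : ℝ) := by
  obtain ⟨b, hb⟩ := he.exists_orthonormalBasis hx
  rw [scalarCurvature_eq_sum b]
  refine Finset.sum_congr rfl fun j _ ↦ Finset.sum_congr rfl fun i _ ↦ ?_
  rw [curvature_eq_curvatureTensor he.isOpen (he.smooth i) (he.smooth j) (he.smooth j) hx, hb, hb]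

end Trace

lemma inner_gradient (f : M → ℝ) (Y : Π x : M, TangentSpace I x) (x : M) :
    (inner ℝ (riemannianGradient I f x) (Y x) : ℝ) = fieldDeriv I Y f x := inner_sharp x _ _

lemma SmoothFun.gradient (hU : IsOpen U) (hf : SmoothFun I f U) :
    SmoothField I (riemannianGradient I f) U := by
  intro x hx
  obtain ⟨V, e, hxV, he'⟩ := exists_isOrthoFrame I x
  have he := he'.mono (hU.inter he'.isOpen) Set.inter_subset_right
  refine he.smoothField_of_inner (fun i ↦ ?_) x ⟨hx, hxV⟩
  exact ((he.smooth i).fieldDeriv he.isOpen (hf.mono Set.inter_subset_left)).congr he.isOpen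
    fun y _ ↦ inner_gradient f (e i) y

/-- The factor `R - ρ` in the soliton equation. -/
noncomputable def solitonFactor (I : ModelWithCorners ℝ E H) {M : Type*} [TopologicalSpace M]
    [ChartedSpace H M] [IsManifold I ∞ M] [RiemannianBundle (fun x : M ↦ TangentSpace I x)]
    [IsContMDiffRiemannianBundle I ∞ E (fun x : M ↦ TangentSpace I x)] (ρ : ℝ) (x : M) : ℝ :=
  scalarCurvature I x - ρ

/-- The squared norm of the gradient. -/
noncomputable def gradNormSq (I : ModelWithCorners ℝ E H) {M : Type*} [TopologicalSpace M]
    [ChartedSpace H M] [RiemannianBundle (fun x : M ↦ TangentSpace I x)]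
    (f : M → ℝ) (x : M) : ℝ :=
  inner ℝ (riemannianGradient I f x) (riemannianGradient I f x)

namespace IsGradientYamabeSoliton

variable {ρ : ℝ}

lemma smoothFun (h : IsGradientYamabeSoliton I f ρ) : SmoothFun I f U := fun y _ ↦ h.1 y

lemma smoothField_gradient (h : IsGradientYamabeSoliton I f ρ) :
    SmoothField I (riemannianGradient I f) U :=
  ((h.smoothFun (U := Set.univ)).gradient isOpen_univ).mono (Set.subset_univ U)

/-- Nondegeneracy of the metric turns the equation of bilinear forms into one of vectors, the form
in which the later computations use it. -/
lemma covD_gradient (h : IsGradientYamabeSoliton I f ρ) (Y : Π x : M, TangentSpace I x) (x : M) :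
    covD Y (riemannianGradient I f) x = solitonFactor I ρ x • Y x := by
  refine ext_inner_right ℝ fun w ↦ ?_
  rw [real_inner_smul_left, solitonFactor, h.2 x (Y x) w]
  rfl

/-- The soliton equation gives φ = ⟨∇_e ∇f, e⟩ for a local smooth unit field e, which is visibly
smooth. -/
lemma smooth_factor (h : IsGradientYamabeSoliton I f ρ) : SmoothFun I (solitonFactor (M := M) I ρ) U := by
  intro x _
  obtain ⟨V, e, hxV, he⟩ := exists_isOrthoFrame I x
  let i : Fin (Module.finrank ℝ E) := ⟨0, Module.finrank_pos⟩
  have hc := ((he.smooth i).covD he.isOpen h.smoothField_gradient).innerFun (he.smooth i)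
  refine hc.congr he.isOpen (fun y hy ↦ ?_) x hxV
  rw [h.covD_gradient, real_inner_smul_left, he.inner_apply hy i i]
  simp

lemma smooth_gradNormSq (h : IsGradientYamabeSoliton I f ρ) : SmoothFun I (gradNormSq I f) U :=
  h.smoothField_gradient.innerFun h.smoothField_gradient

lemma fieldDeriv_gradNormSq (h : IsGradientYamabeSoliton I f ρ) (hY : SmoothField I Y U)
    (hx : x ∈ U) :
    fieldDeriv I Y (gradNormSq I f) x = 2 * solitonFactor I ρ x * fieldDeriv I Y f x := by
  have h1 := fieldDeriv_inner hY h.smoothField_gradient h.smoothField_gradient hx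
  rw [h.covD_gradient, real_inner_smul_left, real_inner_smul_right, real_inner_comm,
    inner_gradient] at h1
  change fieldDeriv I Y (fun y ↦ inner ℝ (riemannianGradient I f y) (riemannianGradient I f y)) x
    = _
  rw [h1]
  ring

lemma mvfderiv_gradNormSq (h : IsGradientYamabeSoliton I f ρ) (x : M) :
    mvfderiv I (gradNormSq I f) x = (2 * solitonFactor I ρ x) • mvfderiv I f x := by
  ext v
  obtain ⟨U, hU, hx, hv⟩ := SmoothField.extend (I := I) x v
  have := h.fieldDeriv_gradNormSq hv hx
  simpa [fieldDeriv] using this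

/-- Insert ∇_Y ∇f = φ Y into the definition of curvature. The terms φ (∇_Y Z - ∇_Z Y - [Y,Z])
vanish, and only derivatives of φ are left. -/
lemma curvature_gradient (h : IsGradientYamabeSoliton I f ρ)
    (hY : SmoothField I Y U) (hZ : SmoothField I Z U) (hx : x ∈ U) :
    curvature Y Z (riemannianGradient I f) x =
      fieldDeriv I Y (solitonFactor I ρ) x • Z x - fieldDeriv I Z (solitonFactor I ρ) x • Y x := by
  have h1 : ∀ Y : Π x : M, TangentSpace I x, covD Y (riemannianGradient I f) =
      (solitonFactor I ρ : M → ℝ) • Y := fun Y ↦ funext fun y ↦ h.covD_gradient Y y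
  have h2 : covD (VectorField.mlieBracket I Y Z) (riemannianGradient I f) x =
      solitonFactor I ρ x • covD Y Z x - solitonFactor I ρ x • covD Z Y x := by
    rw [h.covD_gradient, ← smul_sub, covD_sub_swap hY hZ hx]
  rw [curvature_eq, h1, h1, h2, covD_smul_right h.smooth_factor hZ hx,
    covD_smul_right h.smooth_factor hY hx]
  abel

lemma curvatureTensor_gradient (h : IsGradientYamabeSoliton I f ρ) (u v : TangentSpace I x) :
    curvatureTensor x u v (riemannianGradient I f x) =
      mvfderiv I (solitonFactor I ρ) x u • v - mvfderiv I (solitonFactor I ρ) x v • u := by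
  obtain ⟨U, Y, Z, -, hU, hx, hY, hZ, -, rfl, rfl, -⟩ := exists_smoothFields x u v u
  rw [← curvature_eq_curvatureTensor hU hY hZ h.smoothField_gradient hx]
  exact h.curvature_gradient hY hZ hx

/-- `R(∇f, v) w = dφ(w) v - ⟨v, w⟩ ∇φ` -/
lemma curvatureTensor_gradient_fst (h : IsGradientYamabeSoliton I f ρ) (v w : TangentSpace I x) :
    curvatureTensor x (riemannianGradient I f x) v w =
      mvfderiv I (solitonFactor I ρ) x w • v -
        (inner ℝ v w : ℝ) • riemannianGradient I (solitonFactor I ρ) x := by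
  refine ext_inner_right ℝ fun z ↦ ?_
  rw [inner_curvatureTensor_comm, h.curvatureTensor_gradient, inner_sub_left, inner_sub_left,
    real_inner_smul_left, real_inner_smul_left, real_inner_smul_left, real_inner_smul_left]
  have : (inner ℝ (riemannianGradient I (solitonFactor I ρ) x) z : ℝ)
    = mvfderiv I (solitonFactor I ρ) x z := inner_sharp x _ _
  rw [this, real_inner_comm v z, real_inner_comm v w]
  ring

/-- `dφ ∧ df = 0` -/
lemma mvfderiv_wedge (h : IsGradientYamabeSoliton I f ρ) (u v : TangentSpace I x) :
    mvfderiv I (solitonFactor I ρ) x u * mvfderiv I f x v =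
      mvfderiv I (solitonFactor I ρ) x v * mvfderiv I f x u := by
  -- R(u,v)∇f is orthogonal to ∇f, and it equals dφ(u) v - dφ(v) u.
  have h1 := inner_curvatureTensor_self (u := u) (v := v) (w := riemannianGradient I f x)
  have h2 : ∀ z, (inner ℝ z (riemannianGradient I f x) : ℝ) = mvfderiv I f x z := fun z ↦ by
    rw [real_inner_comm]
    exact inner_sharp x _ _
  rw [h.curvatureTensor_gradient, inner_sub_left, real_inner_smul_left, real_inner_smul_left,
    h2, h2] at h1
  linarith

end IsGradientYamabeSoliton

end RiemannianGeometry

end Soliton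

/-! ### Lie derivatives along ∇f of the connection and of the curvature -/

section ScalarCurvatureEvolution

set_option linter.unusedSectionVars false

namespace RiemannianGeometry

variable {E : Type*} [NormedAddCommGroup E] [NormedSpace ℝ E] [FiniteDimensional ℝ E]
  {H : Type*} [TopologicalSpace H] {I : ModelWithCorners ℝ E H}
  {M : Type*} [TopologicalSpace M] [ChartedSpace H M] [IsManifold I ∞ M]
  [RiemannianBundle (fun x : M ↦ TangentSpace I x)]
  [IsContMDiffRiemannianBundle I ∞ E (fun x : M ↦ TangentSpace I x)]
  {X X' Y Y' Z Z' W : Π x : M, TangentSpace I x} {f g : M → ℝ} {U V : Set M} {x : M}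
  [Nontrivial E]

/-- The coefficients ⟨η i, b k⟩ are skew while β (b k) (b i) + β (b i) (b k) is symmetric, so the
sum is its own negative. It removes the rotation of the frame when a trace of the curvature is
differentiated. -/
lemma sum_add_swap_eq_zero {ι F : Type*} [Fintype ι] [NormedAddCommGroup F]
    [InnerProductSpace ℝ F] (b : OrthonormalBasis ι ℝ F) (η : ι → F)
    (hη : ∀ i k, (inner ℝ (η i) (b k) : ℝ) = - inner ℝ (η k) (b i)) (β : F →ₗ[ℝ] F →ₗ[ℝ] ℝ) :
    ∑ i, (β (η i) (b i) + β (b i) (η i)) = 0 := by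
  have h1 : ∀ i, β (η i) (b i) + β (b i) (η i) =
      ∑ k, (inner ℝ (η i) (b k) : ℝ) * (β (b k) (b i) + β (b i) (b k)) := by
    intro i
    have h2 : η i = ∑ k, (inner ℝ (η i) (b k) : ℝ) • b k := by
      conv_lhs => rw [← b.sum_repr' (η i)]
      simp [real_inner_comm]
    conv_lhs => rw [h2]
    simp [mul_add, Finset.sum_add_distrib]
  simp only [h1]
  have h3 : ∑ i, ∑ k, (inner ℝ (η i) (b k) : ℝ) * (β (b k) (b i) + β (b i) (b k)) =
      - ∑ i, ∑ k, (inner ℝ (η i) (b k) : ℝ) * (β (b k) (b i) + β (b i) (b k)) := by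
    conv_lhs => rw [Finset.sum_comm]
    simp only [← Finset.sum_neg_distrib]
    refine Finset.sum_congr rfl fun i _ ↦ Finset.sum_congr rfl fun k _ ↦ ?_
    rw [hη k i]
    ring
  linarith

/-- The Lie derivative along `∇f` of the Levi-Civita connection, when `∇²f = φ g` and
`∇φ = ψ ∇f`. -/
noncomputable def connVariation (f ψ : M → ℝ) (Y Z : Π x : M, TangentSpace I x) :
    Π x : M, TangentSpace I x :=
  ψ • (fieldDeriv I Y f • Z + fieldDeriv I Z f • Y
    - (fun y ↦ (inner ℝ (Y y) (Z y) : ℝ)) • riemannianGradient I f)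

lemma connVariation_apply (f ψ : M → ℝ) (Y Z : Π x : M, TangentSpace I x) (x : M) :
    connVariation f ψ Y Z x = ψ x • (fieldDeriv I Y f x • Z x + fieldDeriv I Z f x • Y x
      - (inner ℝ (Y x) (Z x) : ℝ) • riemannianGradient I f x) := rfl

namespace IsGradientYamabeSoliton

variable {ρ : ℝ} {ψ : M → ℝ}

lemma smooth_connVariation (h : IsGradientYamabeSoliton I f ρ) (hU : IsOpen U)
    (hψ : SmoothFun I ψ U) (hY : SmoothField I Y U) (hZ : SmoothField I Z U) :
    SmoothField I (connVariation f ψ Y Z) U :=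
  hψ.smul ((((hY.fieldDeriv hU h.smoothFun).smul hZ).add
    ((hZ.fieldDeriv hU h.smoothFun).smul hY)).sub ((hY.innerFun hZ).smul h.smoothField_gradient))

lemma bracket_gradient (h : IsGradientYamabeSoliton I f ρ) (hY : SmoothField I Y U) (hx : x ∈ U) :
    VectorField.mlieBracket I (riemannianGradient I f) Y x =
      covD (riemannianGradient I f) Y x - solitonFactor I ρ x • Y x := by
  rw [← covD_sub_swap h.smoothField_gradient hY hx, h.covD_gradient]

/-- For X = ∇f, the rule [X,Y] = ∇_X Y - φ Y reduces the failure of the Lie derivative to commute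
with ∇ to R(X,Y)Z + dφ(Y) Z; the curvature term is known from `curvatureTensor_gradient_fst`. -/
lemma bracket_covD (h : IsGradientYamabeSoliton I f ρ) (hU : IsOpen U)
    (hφ : ∀ y ∈ U, ∀ v, mvfderiv I (solitonFactor I ρ) y v = ψ y * mvfderiv I f y v)
    (hY : SmoothField I Y U) (hZ : SmoothField I Z U) (hx : x ∈ U) :
    VectorField.mlieBracket I (riemannianGradient I f) (covD Y Z) x =
      covD (VectorField.mlieBracket I (riemannianGradient I f) Y) Z x
        + covD Y (VectorField.mlieBracket I (riemannianGradient I f) Z) x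
        + connVariation f ψ Y Z x := by
  have hX := h.smoothField_gradient (U := U)
  have hs := h.smooth_factor (U := U)
  have h1 := curvature_eq_curvatureTensor hU hX hY hZ hx
  have hgrad : riemannianGradient I (solitonFactor I ρ) x = ψ x • riemannianGradient I f x := by
    refine ext_inner_right ℝ fun w ↦ ?_
    rw [real_inner_smul_left]
    have a1 : (inner ℝ (riemannianGradient I f x) w : ℝ) = mvfderiv I f x w := inner_sharp x _ _
    have a2 : (inner ℝ (riemannianGradient I (solitonFactor I ρ) x) w : ℝ) =
      mvfderiv I (solitonFactor I ρ) x w := inner_sharp x _ _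
    rw [a1, a2, hφ x hx]
  rw [h.curvatureTensor_gradient_fst, curvature_eq, hφ x hx, hgrad] at h1
  rw [h.bracket_gradient (hY.covD hU hZ) hx, covD_congr (X := Y) hU hx
    ((hX.covD hU hZ).sub (hs.smul hZ)) fun y hy ↦ h.bracket_gradient hZ hy,
    covD_sub_right (hX.covD hU hZ) (hs.smul hZ) hx, covD_smul_right hs hZ hx,
    connVariation_apply]
  have h2 : fieldDeriv I Y (solitonFactor I ρ) x = ψ x * fieldDeriv I Y f x := hφ x hx _
  rw [h2]
  rw [sub_sub, sub_eq_iff_eq_add] at h1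
  rw [h1]
  simp only [fieldDeriv]
  module

/-- The Lie derivative along `∇f` of the curvature. -/
lemma bracket_curvature (h : IsGradientYamabeSoliton I f ρ) (hU : IsOpen U)
    (hψ : SmoothFun I ψ U)
    (hφ : ∀ y ∈ U, ∀ v, mvfderiv I (solitonFactor I ρ) y v = ψ y * mvfderiv I f y v)
    (hY : SmoothField I Y U) (hZ : SmoothField I Z U) (hW : SmoothField I W U) (hx : x ∈ U) :
    VectorField.mlieBracket I (riemannianGradient I f) (curvature Y Z W) x =
      curvature (VectorField.mlieBracket I (riemannianGradient I f) Y) Z W x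
        + curvature Y (VectorField.mlieBracket I (riemannianGradient I f) Z) W x
        + curvature Y Z (VectorField.mlieBracket I (riemannianGradient I f) W) x
        + (covD Y (connVariation f ψ Z W) x - covD Z (connVariation f ψ Y W) x
          + connVariation f ψ Y (covD Z W) x - connVariation f ψ Z (covD Y W) x
          - connVariation f ψ (VectorField.mlieBracket I Y Z) W x) := by
  have hX := h.smoothField_gradient (U := U)
  set X := riemannianGradient I f
  -- Apply `bracket_covD` to both covariant derivatives in ∇_Y ∇_Z W. The term with [Y,Z] needs the
  -- Jacobi identity as well.
  have step : ∀ Y Z : Π x : M, TangentSpace I x, SmoothField I Y U → SmoothField I Z U →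
      VectorField.mlieBracket I X (covD Y (covD Z W)) x =
        covD (VectorField.mlieBracket I X Y) (covD Z W) x
        + (covD Y (covD (VectorField.mlieBracket I X Z) W) x
          + covD Y (covD Z (VectorField.mlieBracket I X W)) x
          + covD Y (connVariation f ψ Z W) x)
        + connVariation f ψ Y (covD Z W) x := by
    intro Y Z hY hZ
    have s1 := (hX.bracket hZ).covD hU hW
    have s2 := hZ.covD hU (hX.bracket hW)
    have s3 := h.smooth_connVariation hU hψ hZ hW
    rw [h.bracket_covD hU hφ hY (hZ.covD hU hW) hx, covD_congr (X := Y) hU hx ((s1.add s2).add s3)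
      fun y hy ↦ h.bracket_covD hU hφ hZ hW hy, covD_add_right (s1.add s2) s3 hx,
      covD_add_right s1 s2 hx]
  have : IsManifold I (minSmoothness ℝ 3) M := by
    simpa using! (inferInstance : IsManifold I 3 M)
  have h2 : minSmoothness ℝ 2 ≤ ∞ := by
    rw [minSmoothness_of_isRCLikeNormedField]
    exact (WithTop.coe_le_coe.2 le_top : ((2 : ℕ∞) : ℕ∞ω) ≤ ((⊤ : ℕ∞) : ℕ∞ω))
  have jac := VectorField.leibniz_identity_mlieBracket_apply (I := I) ((hX x hx).of_le h2)
    ((hY x hx).of_le h2) ((hZ x hx).of_le h2)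
  have s1 := hY.covD hU (hZ.covD hU hW)
  have s2 := hZ.covD hU (hY.covD hU hW)
  have s3 := (hY.bracket hZ).covD hU hW
  have e0 : curvature Y Z W = covD Y (covD Z W) + ((-1 : ℝ) • covD Z (covD Y W)
      + (-1 : ℝ) • covD (VectorField.mlieBracket I Y Z) W) := by
    funext y
    simp only [curvature_eq, Pi.add_apply, Pi.smul_apply]
    module
  have c2 : SmoothField I ((-1 : ℝ) • covD Z (covD Y W)) U := fun y hy ↦ (s2 y hy).const_smul_section
  have c3 : SmoothField I ((-1 : ℝ) • covD (VectorField.mlieBracket I Y Z) W) U :=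
    fun y hy ↦ (s3 y hy).const_smul_section
  have e1 : covD (VectorField.mlieBracket I X (VectorField.mlieBracket I Y Z)) W x =
      covD (VectorField.mlieBracket I (VectorField.mlieBracket I X Y) Z) W x
      + covD (VectorField.mlieBracket I Y (VectorField.mlieBracket I X Z)) W x := by
    simp only [covD]
    rw [jac, map_add]
  rw [e0, VectorField.mlieBracket_add_right (s1.mdiffAt hx) ((c2.add c3).mdiffAt hx),
    VectorField.mlieBracket_add_right (c2.mdiffAt hx) (c3.mdiffAt hx),
    VectorField.mlieBracket_const_smul_right (s2.mdiffAt hx),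
    VectorField.mlieBracket_const_smul_right (s3.mdiffAt hx), step Y Z hY hZ, step Z Y hZ hY,
    h.bracket_covD hU hφ (hY.bracket hZ) hW hx, e1]
  simp only [curvature_eq]
  module

/-- The product rule: differentiating df and ∇f produces the Hessian φ g, hence the terms with ψ φ,
and differentiating ψ produces the terms with Yψ. -/
lemma covD_connVariation (h : IsGradientYamabeSoliton I f ρ) (hU : IsOpen U)
    (hψ : SmoothFun I ψ U)
    (hY : SmoothField I Y U) (hZ : SmoothField I Z U) (hW : SmoothField I W U) (hx : x ∈ U) :
    covD Y (connVariation f ψ Z W) x = connVariation f ψ (covD Y Z) W x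
      + connVariation f ψ Z (covD Y W) x
      + fieldDeriv I Y ψ x • (fieldDeriv I Z f x • W x + fieldDeriv I W f x • Z x
        - (inner ℝ (Z x) (W x) : ℝ) • riemannianGradient I f x)
      + (ψ x * solitonFactor I ρ x) • ((inner ℝ (Y x) (Z x) : ℝ) • W x
        + (inner ℝ (Y x) (W x) : ℝ) • Z x - (inner ℝ (Z x) (W x) : ℝ) • Y x) := by
  have hX := h.smoothField_gradient (U := U)
  have hess : ∀ Z : Π x : M, TangentSpace I x, SmoothField I Z U →
      fieldDeriv I Y (fieldDeriv I Z f) x =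
        solitonFactor I ρ x * inner ℝ (Y x) (Z x) + fieldDeriv I (covD Y Z) f x := by
    intro Z hZ
    rw [← fieldDeriv_congr hU hx fun y _ ↦ inner_gradient f Z y, fieldDeriv_inner hY hX hZ hx,
      h.covD_gradient, real_inner_smul_left, inner_gradient]
  have a1 := (hZ.fieldDeriv hU (h.smoothFun)).smul hW
  have a2 := (hW.fieldDeriv hU (h.smoothFun)).smul hZ
  have a3 := (hZ.innerFun hW).smul hX
  rw [connVariation, covD_smul_right hψ ((a1.add a2).sub a3) hx,
    covD_sub_right (a1.add a2) a3 hx, covD_add_right a1 a2 hx,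
    covD_smul_right (hZ.fieldDeriv hU (h.smoothFun)) hW hx,
    covD_smul_right (hW.fieldDeriv hU (h.smoothFun)) hZ hx,
    covD_smul_right (hZ.innerFun hW) hX hx, hess Z hZ, hess W hW, fieldDeriv_inner hY hZ hW hx,
    h.covD_gradient, connVariation_apply, connVariation_apply]
  simp only [Pi.add_apply, Pi.sub_apply, Pi.smul_apply']
  module

/-- Antisymmetrize `covD_connVariation` in Y and Z. The terms with differentiated arguments cancel,
using ∇_Y Z - ∇_Z Y = [Y,Z]; the surviving ψ φ terms double. -/
lemma bracket_curvature_explicit (h : IsGradientYamabeSoliton I f ρ) (hU : IsOpen U)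
    (hψ : SmoothFun I ψ U)
    (hφ : ∀ y ∈ U, ∀ v, mvfderiv I (solitonFactor I ρ) y v = ψ y * mvfderiv I f y v)
    (hY : SmoothField I Y U) (hZ : SmoothField I Z U) (hW : SmoothField I W U) (hx : x ∈ U) :
    VectorField.mlieBracket I (riemannianGradient I f) (curvature Y Z W) x =
      curvature (VectorField.mlieBracket I (riemannianGradient I f) Y) Z W x
        + curvature Y (VectorField.mlieBracket I (riemannianGradient I f) Z) W x
        + curvature Y Z (VectorField.mlieBracket I (riemannianGradient I f) W) x
        + (fieldDeriv I Y ψ x • (fieldDeriv I Z f x • W x + fieldDeriv I W f x • Z x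
            - (inner ℝ (Z x) (W x) : ℝ) • riemannianGradient I f x)
          - fieldDeriv I Z ψ x • (fieldDeriv I Y f x • W x + fieldDeriv I W f x • Y x
            - (inner ℝ (Y x) (W x) : ℝ) • riemannianGradient I f x)
          + (2 * ψ x * solitonFactor I ρ x) • ((inner ℝ (Y x) (W x) : ℝ) • Z x
            - (inner ℝ (Z x) (W x) : ℝ) • Y x)) := by
  have e : connVariation f ψ (VectorField.mlieBracket I Y Z) W x =
      connVariation f ψ (covD Y Z) W x - connVariation f ψ (covD Z Y) W x := by
    simp only [connVariation_apply, fieldDeriv]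
    rw [← covD_sub_swap hY hZ hx, inner_sub_left, map_sub]
    module
  rw [h.bracket_curvature hU hψ hφ hY hZ hW hx, h.covD_connVariation hU hψ hY hZ hW hx,
    h.covD_connVariation hU hψ hZ hY hW hx, e, real_inner_comm (Y x) (Z x)]
  module

end IsGradientYamabeSoliton

end RiemannianGeometry

end ScalarCurvatureEvolution

/-! ### The derivative of the scalar curvature along ∇f -/

section ExtremumArguments

set_option linter.unusedSectionVars false

namespace RiemannianGeometry

variable {E : Type*} [NormedAddCommGroup E] [NormedSpace ℝ E] [FiniteDimensional ℝ E]
  {H : Type*} [TopologicalSpace H] {I : ModelWithCorners ℝ E H}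
  {M : Type*} [TopologicalSpace M] [ChartedSpace H M] [IsManifold I ∞ M]
  [RiemannianBundle (fun x : M ↦ TangentSpace I x)]
  [IsContMDiffRiemannianBundle I ∞ E (fun x : M ↦ TangentSpace I x)]
  {X X' Y Y' Z Z' W : Π x : M, TangentSpace I x} {f g : M → ℝ} {U V : Set M} {x : M}
  [Nontrivial E]

lemma SmoothField.curvature (hU : IsOpen U) (hX : SmoothField I X U) (hY : SmoothField I Y U)
    (hZ : SmoothField I Z U) : SmoothField I (curvature X Y Z) U :=
  ((hX.covD hU (hY.covD hU hZ)).sub (hY.covD hU (hX.covD hU hZ))).sub ((hX.bracket hY).covD hU hZ)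

namespace IsGradientYamabeSoliton

variable {ρ : ℝ} {ψ : M → ℝ}

/-- The derivative of the scalar curvature along `∇f`:
`∇f(R) = -2 φ R - 2 (n - 1) Δφ`, where `Δφ = ∇f(ψ) + n ψ φ`. -/
lemma fieldDeriv_gradient_factor (h : IsGradientYamabeSoliton I f ρ) (hU : IsOpen U)
    (hψ : SmoothFun I ψ U)
    (hφ : ∀ y ∈ U, ∀ v, mvfderiv I (solitonFactor I ρ) y v = ψ y * mvfderiv I f y v)
    (hx : x ∈ U) :
    fieldDeriv I (riemannianGradient I f) (solitonFactor I ρ) x =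
      -2 * solitonFactor I ρ x * (solitonFactor I ρ x + ρ)
      - 2 * (Module.finrank ℝ E - 1) * (fieldDeriv I (riemannianGradient I f) ψ x
        + Module.finrank ℝ E * ψ x * solitonFactor I ρ x) := by
  obtain ⟨V, e, hxV, he'⟩ := exists_isOrthoFrame I x
  have he := he'.mono (hU.inter he'.isOpen) Set.inter_subset_right
  have hs : U ∩ V ⊆ U := Set.inter_subset_left
  replace hψ := hψ.mono hs
  replace hφ : ∀ y ∈ U ∩ V, ∀ v, mvfderiv I (solitonFactor I ρ) y v = ψ y * mvfderiv I f y v :=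
    fun y hy ↦ hφ y hy.1
  replace hx : x ∈ U ∩ V := ⟨hx, hxV⟩
  replace hU := he.isOpen
  clear he' hs hxV
  generalize U ∩ V = N at *
  have hX := h.smoothField_gradient (U := N)
  have hsm := he.smooth
  have hC : ∀ i j, SmoothField I (curvature (e i) (e j) (e j)) N :=
    fun i j ↦ (hsm i).curvature hU (hsm j) (hsm j)
  obtain ⟨b, hb⟩ := he.exists_orthonormalBasis hx
  obtain ⟨X, hXdef⟩ : ∃ X, X = riemannianGradient I f := ⟨_, rfl⟩
  obtain ⟨φ, hφdef⟩ : ∃ φ, φ = solitonFactor (M := M) I ρ := ⟨_, rfl⟩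
  rw [← hXdef] at hX
  rw [← hXdef, ← hφdef]
  have h1 : fieldDeriv I X φ x = ∑ j, ∑ i,
      fieldDeriv I X (fun y ↦ (inner ℝ (curvature (e i) (e j) (e j) y) (e i y) : ℝ)) x := by
    have h2 : ∀ y ∈ N, φ y = ((fun y ↦ ∑ j, ∑ i,
        (inner ℝ (curvature (e i) (e j) (e j) y) (e i y) : ℝ)) - fun _ ↦ ρ : M → ℝ) y := by
      intro y hy
      rw [Pi.sub_apply, ← he.scalarCurvature_eq hy, hφdef]
      rfl
    have h3 : ∀ j, SmoothFun I (fun y ↦ ∑ i,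
        (inner ℝ (curvature (e i) (e j) (e j) y) (e i y) : ℝ)) N :=
      fun j ↦ SmoothFun.sum fun i _ ↦ (hC i j).innerFun (hsm i)
    rw [fieldDeriv_congr hU hx h2, fieldDeriv_sub_fun (SmoothFun.sum fun j _ ↦ h3 j)
      (SmoothFun.const ρ) hx, fieldDeriv_const, sub_zero, fieldDeriv_sum (fun j _ ↦ h3 j) hx]
    exact Finset.sum_congr rfl fun j _ ↦
      fieldDeriv_sum (fun i _ ↦ (hC i j).innerFun (hsm i)) hx
  -- The rotation of the frame along X, skew because the inner products ⟨e i, e k⟩ are constant.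
  let η : Fin (Module.finrank ℝ E) → TangentSpace I x := fun i ↦ covD X (e i) x
  have hη : ∀ i k, (inner ℝ (η i) (b k) : ℝ) = - inner ℝ (η k) (b i) := by
    intro i k
    have h2 := fieldDeriv_inner hX (hsm i) (hsm k) hx
    rw [fieldDeriv_congr (g := fun _ ↦ if i = k then 1 else 0) hU hx
      (fun y hy ↦ he.inner_apply hy i k), fieldDeriv_const] at h2
    rw [hb, hb]
    have h3 := real_inner_comm (e i x) (η k)
    simp only [η] at h3 ⊢
    linarith
  have hbr : ∀ i, VectorField.mlieBracket I X (e i) x = η i + (-φ x) • b i := by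
    intro i
    rw [hXdef, h.bracket_gradient (hsm i) hx, hb, ← hXdef, ← hφdef]
    simp only [η]
    module
  let ψ' : Fin (Module.finrank ℝ E) → ℝ := fun i ↦ fieldDeriv I (e i) ψ x
  let f' : Fin (Module.finrank ℝ E) → ℝ := fun i ↦ fieldDeriv I (e i) f x
  let δ : Fin (Module.finrank ℝ E) → Fin (Module.finrank ℝ E) → ℝ := fun i j ↦ if i = j then 1 else 0
  have hf' : ∀ i, (inner ℝ (X x) (e i x) : ℝ) = f' i := fun i ↦ hXdef ▸ inner_gradient f (e i) x
  have he1 : ∀ i j, (inner ℝ (e i x) (e j x) : ℝ) = δ i j := fun i j ↦ he.inner_apply hx i j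
  let T : TangentSpace I x → TangentSpace I x → TangentSpace I x → TangentSpace I x → ℝ :=
    fun u v w z ↦ inner ℝ (curvatureTensor x u v w) z
  -- Each of the three slots receives [X, e i] = η i - φ e i, which gives -3φ; passing from the
  -- bracket of X with the curvature to ∇_X gives +φ, and the net coefficient is -2φ. The terms with
  -- η have zero sum by `sum_add_swap_eq_zero`.
  have h4 : ∀ j i, fieldDeriv I X
      (fun y ↦ (inner ℝ (curvature (e i) (e j) (e j) y) (e i y) : ℝ)) x =
      (T (η i) (b j) (b j) (b i) + T (b i) (b j) (b j) (η i))
      + (T (b i) (η j) (b j) (b i) + T (b i) (b j) (η j) (b i))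
      - 2 * φ x * T (b i) (b j) (b j) (b i)
      + (ψ' i * (2 * f' j * δ j i - f' i) - ψ' j * (f' i * δ j i + f' j - δ i j * f' i)
        + 2 * ψ x * φ x * (δ i j * δ j i - 1)) := by
    intro j i
    have h5 := h.bracket_curvature_explicit hU hψ hφ (hsm i) (hsm j) (hsm j) hx
    have h6 := h.bracket_gradient (hC i j) hx
    rw [← hXdef, curvature_eq_curvatureTensor hU (hX.bracket (hsm i)) (hsm j) (hsm j) hx,
      curvature_eq_curvatureTensor hU (hsm i) (hX.bracket (hsm j)) (hsm j) hx,
      curvature_eq_curvatureTensor hU (hsm i) (hsm j) (hX.bracket (hsm j)) hx, hbr, hbr] at h5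
    rw [curvature_eq_curvatureTensor hU (hsm i) (hsm j) (hsm j) hx, ← hXdef, ← hφdef] at h6
    rw [← hφdef, h6] at h5
    rw [fieldDeriv_inner hX (hC i j) (hsm i) hx, sub_eq_iff_eq_add.mp h5,
      curvature_eq_curvatureTensor hU (hsm i) (hsm j) (hsm j) hx]
    simp only [inner_add_left, inner_sub_left, real_inner_smul_left, curvatureTensor_add_fst,
      curvatureTensor_add_snd, curvatureTensor_add_trd, curvatureTensor_smul_fst,
      curvatureTensor_smul_snd, curvatureTensor_smul_trd, T, hb, he1, hf']
    have d1 : ∀ k, δ k k = 1 := fun k ↦ by simp [δ]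
    simp only [d1, ψ', f', η]
    ring
  have sum1 : ∀ j, ∑ i, (T (η i) (b j) (b j) (b i) + T (b i) (b j) (b j) (η i)) = 0 := by
    intro j
    refine sum_add_swap_eq_zero b η hη (LinearMap.mk₂ ℝ (fun u z ↦ T u (b j) (b j) z) ?_ ?_ ?_ ?_)
    · intro u u' z
      simp only [T, curvatureTensor_add_fst, inner_add_left]
    · intro c u z
      simp only [T, curvatureTensor_smul_fst, real_inner_smul_left, smul_eq_mul]
    · intro u z z'
      simp only [T, inner_add_right]
    · intro c u z
      simp only [T, real_inner_smul_right, smul_eq_mul]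
  have sum2 : ∀ i, ∑ j, (T (b i) (η j) (b j) (b i) + T (b i) (b j) (η j) (b i)) = 0 := by
    intro i
    refine sum_add_swap_eq_zero b η hη (LinearMap.mk₂ ℝ (fun u z ↦ T (b i) u z (b i)) ?_ ?_ ?_ ?_)
    · intro u u' z
      simp only [T, curvatureTensor_add_snd, inner_add_left]
    · intro c u z
      simp only [T, curvatureTensor_smul_snd, real_inner_smul_left, smul_eq_mul]
    · intro u z z'
      simp only [T, curvatureTensor_add_trd, inner_add_left]
    · intro c u z
      simp only [T, curvatureTensor_smul_trd, real_inner_smul_left, smul_eq_mul]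
  have sum3 : ∑ j, ∑ i, T (b i) (b j) (b j) (b i) = φ x + ρ := by
    have h5 := scalarCurvature_eq_sum b
    simp only [T]
    rw [← h5, hφdef, solitonFactor]
    ring
  have sum4 : fieldDeriv I X ψ x = ∑ i, f' i * ψ' i := by
    have h5 : X x = ∑ i, f' i • e i x := by
      conv_lhs => rw [← he.sum_inner_smul hx (X x)]
      refine Finset.sum_congr rfl fun i _ ↦ ?_
      rw [← hf', real_inner_comm]
    rw [fieldDeriv, h5, map_sum]
    exact Finset.sum_congr rfl fun i _ ↦ by rw [map_smul]; rfl
  -- The double trace of the variation of the connection: in total -2 (n - 1) (Xψ + n ψ φ).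
  have sum5 : ∑ j, ∑ i, (ψ' i * (2 * f' j * δ j i - f' i)
        - ψ' j * (f' i * δ j i + f' j - δ i j * f' i)
        + 2 * ψ x * φ x * (δ i j * δ j i - 1)) =
      - 2 * (Module.finrank ℝ E - 1) * ∑ i, f' i * ψ' i
        - 2 * ψ x * φ x * (Module.finrank ℝ E * (Module.finrank ℝ E - 1)) := by
    have h6 : ∀ j i, (ψ' i * (2 * f' j * δ j i - f' i)
        - ψ' j * (f' i * δ j i + f' j - δ i j * f' i)
        + 2 * ψ x * φ x * (δ i j * δ j i - 1)) = (if j = i then 2 * (f' j * ψ' j) + 2 * ψ x * φ x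
          else 0) - f' i * ψ' i - f' j * ψ' j - 2 * ψ x * φ x := by
      intro j i
      by_cases hij : j = i
      · subst hij
        simp only [δ, if_true]
        ring
      · simp only [δ, if_neg hij, if_neg (Ne.symm hij)]
        ring
    simp only [h6, Finset.sum_sub_distrib, Finset.sum_ite_eq, Finset.mem_univ, if_true,
      Finset.sum_add_distrib, Finset.sum_const, Finset.card_univ, Fintype.card_fin, nsmul_eq_mul,
      ← Finset.mul_sum]
    ring
  rw [h1]
  simp only [h4]
  have split : ∀ (A B C D : Fin (Module.finrank ℝ E) → Fin (Module.finrank ℝ E) → ℝ) (c : ℝ),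
      ∑ j, ∑ i, (A j i + B j i - c * C j i + D j i) = ∑ j, ∑ i, A j i + ∑ i, ∑ j, B j i
        - c * ∑ j, ∑ i, C j i + ∑ j, ∑ i, D j i := by
    intro A B C D c
    rw [Finset.sum_comm (f := fun i j ↦ B j i)]
    simp only [Finset.sum_add_distrib, Finset.sum_sub_distrib, Finset.mul_sum]
  refine (split (fun j i ↦ T (η i) (b j) (b j) (b i) + T (b i) (b j) (b j) (η i))
    (fun j i ↦ T (b i) (η j) (b j) (b i) + T (b i) (b j) (η j) (b i))
    (fun j i ↦ T (b i) (b j) (b j) (b i)) _ (2 * φ x)).trans ?_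
  simp only [sum1, sum2, sum3, sum4, sum5, Finset.sum_const_zero]
  ring

end IsGradientYamabeSoliton

/-! ### Maximum arguments; dimension one and dimension at least three -/

section Extremum

/-- The passage ε → 0 after a perturbation by ε f: for ε = a / (2 (|b| + 1)), a positive a would
satisfy a ≤ a / 2. -/
lemma nonpos_of_forall_le_mul {a b : ℝ} (h : ∀ ε : ℝ, 0 < ε → a ≤ ε * b) : a ≤ 0 := by
  by_contra! ha
  have hb : 0 < |b| + 1 := by positivity
  have h1 := h (a / (2 * (|b| + 1))) (by positivity)
  have h2 : a / (2 * (|b| + 1)) * b ≤ a / (2 * (|b| + 1)) * (|b| + 1) :=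
    mul_le_mul_of_nonneg_left (by linarith [le_abs_self b]) (by positivity)
  have h3 : a / (2 * (|b| + 1)) * (|b| + 1) = a / 2 := by field_simp
  linarith

variable [I.Boundaryless]

lemma mvfderiv_eq_zero_of_isLocalMax {F : M → ℝ} (hF : MDiffAt F x) (hmax : IsLocalMax F x) :
    mvfderiv I F x = 0 := by
  rw [hF.mvfderiv, I.range_eq_univ, fderivWithin_univ]
  refine IsLocalMax.fderiv_eq_zero ?_
  have h1 : Filter.Tendsto (extChartAt I x).symm (𝓝 (extChartAt I x x)) (𝓝 x) := by
    have := (continuousAt_extChartAt_symm (I := I) x).tendsto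
    rwa [extChartAt_to_inv] at this
  have h2 := h1.eventually hmax
  have h3 : ∀ y, writtenInExtChartAt I 𝓘(ℝ, ℝ) x F y = F ((extChartAt I x).symm y) := fun y ↦ rfl
  filter_upwards [h2] with y hy
  rw [h3, h3, extChartAt_to_inv]
  exact hy

lemma mvfderiv_eq_zero_of_isLocalMin {F : M → ℝ} (hF : MDiffAt F x) (hmin : IsLocalMin F x) :
    mvfderiv I F x = 0 := by
  have h1 := mvfderiv_eq_zero_of_isLocalMax (F := -F) hF.neg hmin.neg
  rwa [mvfderiv_neg, neg_eq_zero] at h1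

/-- A continuous function without critical points outside of `{w = 0}` is bounded by its supremum
on that set. -/
lemma le_of_le_on_zeroSet [CompactSpace M] {F w : M → ℝ} {C : ℝ} (hF : Continuous F)
    (hd : ∀ x, w x ≠ 0 → MDiffAt F x ∧ mvfderiv I F x ≠ 0)
    (hC : ∀ x, w x = 0 → F x ≤ C) (x : M) : F x ≤ C := by
  obtain ⟨z, -, hz⟩ := isCompact_univ.exists_isMaxOn ⟨x, Set.mem_univ x⟩ hF.continuousOn
  have hw : w z = 0 := by
    by_contra hne
    refine (hd z hne).2 (mvfderiv_eq_zero_of_isLocalMax (hd z hne).1 ?_)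
    exact hz.isLocalMax Filter.univ_mem
  exact (hz (Set.mem_univ x)).trans (hC z hw)

namespace IsGradientYamabeSoliton

variable {ρ : ℝ}

lemma continuous_of_smoothFun {F : M → ℝ} (hF : SmoothFun I F Set.univ) : Continuous F :=
  continuous_iff_continuousAt.mpr fun x ↦ (hF x (Set.mem_univ x)).continuousAt

lemma mvfderiv_gradient (f : M → ℝ) (x : M) :
    mvfderiv I f x (riemannianGradient I f x) = gradNormSq I f x :=
  (inner_sharp x (mvfderiv I f x) (riemannianGradient I f x)).symm

lemma gradNormSq_nonneg (f : M → ℝ) (x : M) : 0 ≤ gradNormSq I f x := real_inner_self_nonneg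

lemma gradient_eq_zero_iff : gradNormSq I f x = 0 ↔ riemannianGradient I f x = 0 :=
  inner_self_eq_zero

lemma mvfderiv_eq_zero_iff : mvfderiv I f x = 0 ↔ gradNormSq I f x = 0 := by
  constructor
  · intro h
    rw [← mvfderiv_gradient, h]
    rfl
  · intro h
    ext v
    rw [← inner_sharp x (mvfderiv I f x) v]
    change inner ℝ (riemannianGradient I f x) v = (0 : ℝ)
    rw [gradient_eq_zero_iff.mp h, inner_zero_left]

/-- If the gradient vanishes identically then so does the soliton factor. -/
lemma factor_eq_zero_of_gradient (h : IsGradientYamabeSoliton I f ρ)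
    (hw : ∀ x, gradNormSq I f x = 0) (x : M) : solitonFactor I ρ x = 0 := by
  obtain ⟨V, e, hxV, he⟩ := exists_isOrthoFrame I x
  let i : Fin (Module.finrank ℝ E) := ⟨0, Module.finrank_pos⟩
  have h1 := h.covD_gradient (e i) x
  -- The zero field is written as 0 • ∇f so that the Leibniz rule shows its covariant derivative,
  -- which is φ e, to vanish.
  have h0 : ∀ y ∈ V, riemannianGradient I f y = ((fun _ ↦ 0 : M → ℝ) • riemannianGradient I f) y := by
    intro y _
    rw [gradient_eq_zero_iff.mp (hw y)]
    simp
  rw [covD_congr he.isOpen hxV (SmoothFun.smul (SmoothFun.const 0) h.smoothField_gradient) h0,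
    covD_smul_right (SmoothFun.const 0) h.smoothField_gradient hxV, fieldDeriv_const] at h1
  have h2 := congrArg (fun v ↦ (inner ℝ v (e i x) : ℝ)) h1
  simp only [zero_smul, add_zero, inner_zero_left, real_inner_smul_left,
    he.inner_apply hxV, if_true, mul_one] at h2
  exact h2.symm

/-- If the soliton factor vanishes at all regular points of `f` then it vanishes. -/
lemma factor_eq_zero [CompactSpace M] (h : IsGradientYamabeSoliton I f ρ)
    (h0 : ∀ x, gradNormSq I f x ≠ 0 → solitonFactor I ρ x = 0) (x : M) :
    solitonFactor I ρ x = 0 := by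
  refine h.factor_eq_zero_of_gradient (fun x ↦ le_antisymm ?_ (gradNormSq_nonneg f x)) x
  have hf := continuous_of_smoothFun (h.smoothFun (U := Set.univ))
  obtain ⟨z, -, hz⟩ := isCompact_univ.exists_isMaxOn ⟨x, Set.mem_univ x⟩ hf.continuousOn
  -- At regular points dw = 2φ df = 0, so w + ε f has derivative ε w ≠ 0 along ∇f. It is therefore
  -- bounded by its values on {w = 0}, which are at most ε max f.
  have key : ∀ ε : ℝ, 0 < ε → gradNormSq I f x + ε * f x ≤ ε * f z := by
    intro ε hε
    have hsm : SmoothFun I (gradNormSq I f + (fun _ ↦ ε) * f) (Set.univ : Set M) :=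
      h.smooth_gradNormSq.add ((SmoothFun.const ε).mul h.smoothFun)
    refine le_of_le_on_zeroSet (I := I) (F := gradNormSq I f + (fun _ ↦ ε) * f)
      (w := gradNormSq I f) (continuous_of_smoothFun hsm) (fun y hy ↦
      ⟨hsm.mdiffAt (Set.mem_univ y), fun hd ↦ ?_⟩) (fun y hy ↦ ?_) x
    · rw [mvfderiv_add (h.smooth_gradNormSq.mdiffAt (Set.mem_univ y))
        (((SmoothFun.const ε).mul h.smoothFun).mdiffAt (Set.mem_univ y)),
        mvfderiv_mul ((SmoothFun.const ε).mdiffAt (Set.mem_univ y))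
        (h.smoothFun.mdiffAt (Set.mem_univ y)), mvfderiv_const, h.mvfderiv_gradNormSq,
        h0 y hy] at hd
      have h1 := congrArg (fun A ↦ A (riemannianGradient I f y)) hd
      simp only [mul_zero, zero_smul, smul_zero, add_zero, zero_add, smul_apply,
        mvfderiv_gradient, smul_eq_mul] at h1
      rcases mul_eq_zero.mp h1 with h2 | h2
      · exact hε.ne' h2
      · exact hy h2
    · simp only [Pi.add_apply, Pi.mul_apply, hy, zero_add]
      exact mul_le_mul_of_nonneg_left (hz (Set.mem_univ y)) hε.le
  exact nonpos_of_forall_le_mul (b := f z - f x) fun ε hε ↦ by linarith [key ε hε]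

/-- The conclusion in dimension one, where the scalar curvature vanishes. -/
lemma factor_eq_zero_of_finrank_eq_one [CompactSpace M] (h : IsGradientYamabeSoliton I f ρ)
    (hn : Module.finrank ℝ E = 1) (x : M) : solitonFactor I ρ x = 0 := by
  have hR : ∀ x : M, solitonFactor I ρ x = -ρ := by
    intro x
    obtain ⟨V, e, hxV, he⟩ := exists_isOrthoFrame I x
    have hsub : ∀ i j : Fin (Module.finrank ℝ E), i = j := fun i j ↦ by
      apply Fin.ext
      have := i.2
      have := j.2
      omega
    rw [solitonFactor, he.scalarCurvature_eq hxV, Finset.sum_eq_zero, zero_sub]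
    refine fun j _ ↦ Finset.sum_eq_zero fun i _ ↦ ?_
    -- The frame has a single element, and R(e,e) = 0.
    have h1 := curvature_swap (X := e i) (Y := e i) (Z := e i) (x := x)
    have h2 := congrArg (fun v ↦ (inner ℝ v (e i x) : ℝ)) h1
    simp only [inner_neg_left] at h2
    rw [hsub j i]
    linarith
  by_cases hρ : ρ = 0
  · rw [hR, hρ, neg_zero]
  refine h.factor_eq_zero_of_gradient (fun x ↦ le_antisymm ?_ (gradNormSq_nonneg f x)) x
  refine le_of_le_on_zeroSet (I := I) (w := gradNormSq I f) (continuous_of_smoothFun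
    h.smooth_gradNormSq) (fun y hy ↦ ⟨h.smooth_gradNormSq.mdiffAt (Set.mem_univ y), ?_⟩)
    (fun y hy ↦ hy.le) x
  rw [h.mvfderiv_gradNormSq, hR, smul_ne_zero_iff]
  exact ⟨by simpa using hρ, fun h1 ↦ hy (mvfderiv_eq_zero_iff.mp h1)⟩

lemma isOpen_regular (h : IsGradientYamabeSoliton I f ρ) :
    IsOpen {x : M | gradNormSq I f x ≠ 0} :=
  isOpen_ne_fun (continuous_of_smoothFun h.smooth_gradNormSq) continuous_const

/-- The conclusion in dimension at least three. -/
lemma factor_eq_zero_of_three_le_finrank [CompactSpace M] (h : IsGradientYamabeSoliton I f ρ)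
    (hn : 3 ≤ Module.finrank ℝ E) (x : M) : solitonFactor I ρ x = 0 := by
  obtain ⟨n, hn'⟩ : ∃ n : ℝ, n = Module.finrank ℝ E := ⟨_, rfl⟩
  have hn3 : 3 ≤ n := by rw [hn']; exact_mod_cast hn
  set w : M → ℝ := gradNormSq I f with hw
  set φ : M → ℝ := solitonFactor I ρ with hφ
  set X := riemannianGradient I f with hX
  set U : Set M := {x | w x ≠ 0} with hU
  have hUo : IsOpen U := h.isOpen_regular
  have hXφ : SmoothFun I (fieldDeriv I X φ) Set.univ :=
    h.smoothField_gradient.fieldDeriv isOpen_univ h.smooth_factor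
  -- The factor in dφ = ψ df, obtained by putting ∇f into one slot of dφ ∧ df = 0.
  let ψ : M → ℝ := fieldDeriv I X φ / w
  have hψ : SmoothFun I ψ U :=
    (hXφ.mono (Set.subset_univ U)).div h.smooth_gradNormSq fun y hy ↦ hy
  have hφψ : ∀ y ∈ U, ∀ v, mvfderiv I φ y v = ψ y * mvfderiv I f y v := by
    intro y hy v
    have h1 := h.mvfderiv_wedge v (X y)
    rw [hX, mvfderiv_gradient] at h1
    simp only [ψ, Pi.div_apply]
    rw [div_mul_eq_mul_div, eq_div_iff hy]
    exact h1
  -- At regular points this is w^(n/2) K. Written without division by w it is continuous everywhere,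
  -- and it vanishes at critical points because n/2 - 1 > 0. The weights 1/2 and ρ/n in K make the
  -- terms Xψ, ψφ and ρφ drop out of XG.
  let G : M → ℝ := fun y ↦ w y ^ (n / 2 - 1) * ((n - 1) * fieldDeriv I X φ y
    + w y * (φ y / 2 + ρ / n))
  let K : M → ℝ := (fun _ ↦ n - 1) * ψ + ((fun _ ↦ (1 / 2 : ℝ)) * φ + fun _ ↦ ρ / n)
  have hwpos : ∀ y ∈ U, 0 < w y := fun y hy ↦ lt_of_le_of_ne (gradNormSq_nonneg f y) (Ne.symm hy)
  have hG : ∀ y ∈ U, G y = ((fun y ↦ w y ^ (n / 2)) * K : M → ℝ) y := by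
    intro y hy
    have h1 : w y ^ (n / 2) = w y ^ (n / 2 - 1) * w y := by
      rw [← Real.rpow_add_one (hwpos y hy).ne']
      ring_nf
    have h2 : fieldDeriv I X φ y = ψ y * w y := by
      simp only [ψ, Pi.div_apply]
      rw [div_mul_cancel₀ _ hy]
    simp only [G, K, Pi.mul_apply, Pi.add_apply, h1, h2]
    ring
  have hws : SmoothFun I w U := h.smooth_gradNormSq
  have hwr : SmoothFun I (fun y ↦ w y ^ (n / 2)) U :=
    hws.comp (k := fun t ↦ t ^ (n / 2)) fun y hy ↦ Real.contDiffAt_rpow_const_of_ne hy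
  have hφs : SmoothFun I φ U := h.smooth_factor
  have hK1 : SmoothFun I ((fun _ ↦ n - 1) * ψ) U := (SmoothFun.const (n - 1)).mul hψ
  have hK2 : SmoothFun I ((fun _ ↦ (1 / 2 : ℝ)) * φ) U := (SmoothFun.const (1 / 2)).mul hφs
  have hK3 : SmoothFun I (fun _ : M ↦ ρ / n) U := SmoothFun.const _
  have hKs : SmoothFun I K U := hK1.add (hK2.add hK3)
  have hGs : SmoothFun I G U := (hwr.mul hKs).congr hUo hG
  have hXf : ∀ y, fieldDeriv I X f y = w y := fun y ↦ mvfderiv_gradient f y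
  have hXw : ∀ y ∈ U, fieldDeriv I X w y = 2 * φ y * w y := by
    intro y hy
    rw [← hXf]
    exact h.fieldDeriv_gradNormSq (h.smoothField_gradient (U := U)) hy
  have hXG : ∀ y ∈ U, fieldDeriv I X G y = (n / 2 - 1) * φ y ^ 2 * w y ^ (n / 2) := by
    intro y hy
    have e1 := h.fieldDeriv_gradient_factor hUo hψ hφψ hy
    have e2 : fieldDeriv I X φ y = ψ y * w y := by
      simp only [ψ, Pi.div_apply]
      rw [div_mul_cancel₀ _ hy]
    have e3 : w y * w y ^ (n / 2 - 1) = w y ^ (n / 2) := by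
      rw [mul_comm, ← Real.rpow_add_one (hwpos y hy).ne']
      ring_nf
    rw [← hX, ← hφ, e2, ← hn'] at e1
    rw [fieldDeriv_congr hUo hy hG, fieldDeriv_mul_fun hwr hKs hy,
      fieldDeriv_comp_real (k := fun t ↦ t ^ (n / 2)) hws hy
        (Real.hasDerivAt_rpow_const (Or.inl hy)), hXw y hy,
      fieldDeriv_add_fun hK1 (hK2.add hK3) hy, fieldDeriv_add_fun hK2 hK3 hy,
      fieldDeriv_mul_fun (SmoothFun.const (n - 1)) hψ hy,
      fieldDeriv_mul_fun (SmoothFun.const (1 / 2)) hφs hy, fieldDeriv_const, fieldDeriv_const,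
      fieldDeriv_const, e2, ← e3]
    simp only [K, Pi.add_apply, Pi.mul_apply]
    have hnn : n * (ρ / n) = ρ := by field_simp
    linear_combination (w y * w y ^ (n / 2 - 1)) * (1 / 2) * e1
      + (w y * w y ^ (n / 2 - 1)) * φ y * hnn
  have hGc : Continuous G := by
    have c1 : Continuous w := continuous_of_smoothFun h.smooth_gradNormSq
    have c2 : Continuous φ := continuous_of_smoothFun h.smooth_factor
    have c3 := continuous_of_smoothFun hXφ
    exact (c1.rpow_const fun y ↦ Or.inr (by linarith)).mul
      ((continuous_const.mul c3).add (c1.mul ((c2.div_const 2).add continuous_const)))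
  have hG0 : ∀ y, w y = 0 → G y = 0 := by
    intro y hy
    simp only [G, hy]
    rw [Real.zero_rpow (by linarith), zero_mul]
  have hfc : Continuous f := continuous_of_smoothFun h.smoothFun
  obtain ⟨z, -, hz⟩ := isCompact_univ.exists_isMaxOn ⟨x, Set.mem_univ x⟩ hfc.continuousOn
  obtain ⟨z', -, hz'⟩ := isCompact_univ.exists_isMinOn ⟨x, Set.mem_univ x⟩ hfc.continuousOn
  -- XG ≥ 0 and X(ε f) = ε w > 0. The same nonzero derivative serves for the maximum and for the
  -- minimum.
  have hd : ∀ (ε : ℝ), 0 < ε → ∀ y, w y ≠ 0 →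
      MDifferentiableAt I 𝓘(ℝ, ℝ) (G + (fun _ ↦ ε) * f : M → ℝ) y ∧
        mvfderiv I (G + (fun _ ↦ ε) * f : M → ℝ) y ≠ 0 := by
    intro ε hε y hy
    have s1 : SmoothFun I ((fun _ ↦ ε) * f : M → ℝ) U := (SmoothFun.const ε).mul h.smoothFun
    refine ⟨(hGs.add s1).mdiffAt hy, fun h0 ↦ ?_⟩
    have h1 : fieldDeriv I X (G + (fun _ ↦ ε) * f : M → ℝ) y = 0 := by
      rw [fieldDeriv, h0]
      rfl
    rw [fieldDeriv_add_fun hGs s1 hy, fieldDeriv_mul_fun (SmoothFun.const ε)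
      (h.smoothFun (U := U)) hy, fieldDeriv_const, hXG y hy, hXf] at h1
    have h2 : 0 ≤ (n / 2 - 1) * φ y ^ 2 * w y ^ (n / 2) :=
      mul_nonneg (mul_nonneg (by linarith) (sq_nonneg _)) (Real.rpow_nonneg (hwpos y hy).le _)
    have h3 : 0 < ε * w y := mul_pos hε (hwpos y hy)
    linarith
  have hcont : ∀ ε : ℝ, Continuous (G + (fun _ ↦ ε) * f : M → ℝ) :=
    fun ε ↦ hGc.add (continuous_const.mul hfc)
  have hle : ∀ y, G y ≤ 0 := by
    intro y
    refine nonpos_of_forall_le_mul (b := f z - f y) fun ε hε ↦ ?_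
    have h1 := le_of_le_on_zeroSet (I := I) (C := ε * f z) (hcont ε) (hd ε hε) (fun u hu ↦ ?_) y
    · simp only [Pi.add_apply, Pi.mul_apply] at h1
      linarith
    · simp only [Pi.add_apply, Pi.mul_apply, hG0 u hu, zero_add]
      exact mul_le_mul_of_nonneg_left (hz (Set.mem_univ u)) hε.le
  have hge : ∀ y, 0 ≤ G y := by
    intro y
    refine neg_nonpos.mp (nonpos_of_forall_le_mul (b := f y - f z') fun ε hε ↦ ?_)
    have h1 := le_of_le_on_zeroSet (I := I) (C := -(ε * f z')) (hcont ε).neg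
      (fun u hu ↦ ⟨(hd ε hε u hu).1.neg, by
        rw [mvfderiv_neg]; exact neg_ne_zero.mpr (hd ε hε u hu).2⟩) (fun u hu ↦ ?_) y
    · simp only [Pi.add_apply, Pi.mul_apply, Pi.neg_apply] at h1
      linarith
    · simp only [Pi.add_apply, Pi.mul_apply, Pi.neg_apply, hG0 u hu, zero_add]
      exact neg_le_neg (mul_le_mul_of_nonneg_left (hz' (Set.mem_univ u)) hε.le)
  -- Now G = 0, hence 0 = XG = (n/2 - 1) φ² w^(n/2), where only φ² can vanish.
  refine h.factor_eq_zero (fun y hy ↦ ?_) x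
  have h1 := hXG y hy
  rw [fieldDeriv_congr (g := fun _ ↦ (0 : ℝ)) hUo hy fun u _ ↦ le_antisymm (hle u) (hge u),
    fieldDeriv_const] at h1
  have h2 : 0 < w y ^ (n / 2) := Real.rpow_pos_of_pos (hwpos y hy) _
  have h3 : (n / 2 - 1) ≠ 0 := by linarith
  have h4 := mul_eq_zero.mp h1.symm
  rcases h4 with h4 | h4
  · rcases mul_eq_zero.mp h4 with h5 | h5
    · exact absurd h5 h3
    · exact pow_eq_zero_iff (two_ne_zero) |>.mp h5
  · exact absurd h4 h2.ne'

end IsGradientYamabeSoliton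

end Extremum

end RiemannianGeometry

end ExtremumArguments

/-! ### Coordinate fields and differentiation in charts -/

section ChartCalculus

set_option linter.unusedSectionVars false

namespace RiemannianGeometry

variable {E : Type*} [NormedAddCommGroup E] [NormedSpace ℝ E]
  {H : Type*} [TopologicalSpace H] {I : ModelWithCorners ℝ E H}
  {M : Type*} [TopologicalSpace M] [ChartedSpace H M] [IsManifold I ∞ M]
  {F : M → ℝ} {U : Set M} {x₀ y : M} {z v w : E}

variable (I) in
/-- The vector field on the domain of the chart at `x₀` with constant coordinates `v`. -/
noncomputable def coordField (x₀ : M) (v : E) (y : M) : TangentSpace I y :=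
  (trivializationAt E (TangentSpace I : M → Type _) x₀).symmL ℝ y v

variable (I) in
/-- The differential of the chart at `x₀`. -/
noncomputable def coordDiff (x₀ y : M) : TangentSpace I y →L[ℝ] E :=
  mvfderiv I (extChartAt I x₀) y

lemma coordField_add : coordField I x₀ (v + w) y = coordField I x₀ v y + coordField I x₀ w y :=
  map_add _ _ _

lemma coordField_smul (c : ℝ) : coordField I x₀ (c • v) y = c • coordField I x₀ v y :=
  map_smul _ _ _

lemma coordField_sum {ι : Type*} (s : Finset ι) (b : ι → E) :
    coordField I x₀ (∑ i ∈ s, b i) y = ∑ i ∈ s, coordField I x₀ (b i) y :=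
  map_sum _ _ _

lemma smoothField_coordField : SmoothField I (coordField I x₀ v) (chartAt H x₀).source := by
  intro y hy
  set t := trivializationAt E (TangentSpace I : M → Type _) x₀
  have hb : y ∈ t.baseSet := hy
  rw [t.contMDiffAt_section_iff hb]
  have h1 : ContMDiffAt I 𝓘(ℝ, E) ∞ (fun _ : M ↦ v) y := contMDiffAt_const
  refine h1.congr_of_eventuallyEq ?_
  filter_upwards [t.open_baseSet.mem_nhds hb] with u hu
  change (t ⟨u, t.symmL ℝ u v⟩).2 = v
  rw [t.symmL_apply (R := ℝ) hu]
  exact congrArg Prod.snd (t.apply_mk_symm hu v)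

lemma coordDiff_eq (hy : y ∈ (chartAt H x₀).source) (u : TangentSpace I y) :
    coordDiff I x₀ y u = (trivializationAt E (TangentSpace I : M → Type _) x₀).continuousLinearMapAt ℝ y u := by
  rw [TangentBundle.continuousLinearMapAt_trivializationAt hy]
  rfl

lemma coordDiff_coordField (hy : y ∈ (chartAt H x₀).source) :
    coordDiff I x₀ y (coordField I x₀ v y) = v := by
  rw [coordDiff_eq hy]
  exact (trivializationAt E (TangentSpace I : M → Type _) x₀).continuousLinearMapAt_symmL hy v

lemma coordField_coordDiff (hy : y ∈ (chartAt H x₀).source) (u : TangentSpace I y) :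
    coordField I x₀ (coordDiff I x₀ y u) y = u := by
  rw [coordDiff_eq hy]
  exact (trivializationAt E (TangentSpace I : M → Type _) x₀).symmL_continuousLinearMapAt hy u

lemma smoothFun_coord (L : E →L[ℝ] ℝ) :
    SmoothFun I (fun y ↦ L (extChartAt I x₀ y)) (chartAt H x₀).source := fun _ hy ↦
  L.contMDiff.contMDiffAt.comp _ (contMDiffAt_extChartAt' hy)

lemma mvfderiv_coord (L : E →L[ℝ] ℝ) (hy : y ∈ (chartAt H x₀).source) (u : TangentSpace I y) :
    mvfderiv I (fun y ↦ L (extChartAt I x₀ y)) y u = L (coordDiff I x₀ y u) := by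
  have h1 : MDiffAt (extChartAt I x₀) y := mdifferentiableAt_extChartAt hy
  have h2 := (L.hasMFDerivAt (x := extChartAt I x₀ y)).comp y h1.hasMFDerivAt
  have h3 : mfderiv I 𝓘(ℝ, ℝ) (fun y ↦ L (extChartAt I x₀ y)) y
    = L.comp (mfderiv I 𝓘(ℝ, E) (extChartAt I x₀) y) := h2.mfderiv
  simp only [mvfderiv]
  rw [h3]
  rfl

section Boundaryless

variable [I.Boundaryless]

lemma symm_mem_source (hz : z ∈ (extChartAt I x₀).target) :
    (extChartAt I x₀).symm z ∈ (chartAt H x₀).source := by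
  have := (extChartAt I x₀).map_target hz
  rwa [extChartAt_source] at this

/-- The inverse of the chart has `symmL` of the trivialization as its derivative, so partial
derivatives in the chart are derivatives along the coordinate fields. -/
lemma hasFDerivAt_comp_symm (hz : z ∈ (extChartAt I x₀).target)
    (hF : MDiffAt F ((extChartAt I x₀).symm z)) :
    HasFDerivAt (fun z ↦ F ((extChartAt I x₀).symm z))
      ((mvfderiv I F ((extChartAt I x₀).symm z)).comp
        ((trivializationAt E (TangentSpace I : M → Type _) x₀).symmL ℝ
          ((extChartAt I x₀).symm z))) z := by
  have h1 := mdifferentiableWithinAt_extChartAt_symm hz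
  rw [I.range_eq_univ, mdifferentiableWithinAt_univ] at h1
  have h2 := hF.hasMFDerivAt.comp z h1.hasMFDerivAt
  have h3 := h2.hasFDerivAt
  have h4 := TangentBundle.symmL_trivializationAt (I := I) (𝕜 := ℝ) (symm_mem_source hz)
  rw [(extChartAt I x₀).right_inv hz, I.range_eq_univ, mfderivWithin_univ] at h4
  rw [h4]
  exact h3

lemma fderiv_comp_symm (hz : z ∈ (extChartAt I x₀).target)
    (hF : MDiffAt F ((extChartAt I x₀).symm z)) (v : E) :
    fderiv ℝ (fun z ↦ F ((extChartAt I x₀).symm z)) z v =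
      mvfderiv I F ((extChartAt I x₀).symm z) (coordField I x₀ v ((extChartAt I x₀).symm z)) := by
  rw [(hasFDerivAt_comp_symm hz hF).fderiv]
  rfl

lemma SmoothFun.contDiffAt_comp_symm (hF : SmoothFun I F U)
    (hz : z ∈ (extChartAt I x₀).target) (hU : (extChartAt I x₀).symm z ∈ U) :
    ContDiffAt ℝ ∞ (fun z ↦ F ((extChartAt I x₀).symm z)) z := by
  have h1 := (contMDiffOn_extChartAt_symm (I := I) (n := ∞) x₀).contMDiffAt
    ((isOpen_extChartAt_target x₀).mem_nhds hz)
  exact (((hF _ hU).comp z h1)).contDiffAt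

/-- A function with vanishing differential is locally constant. -/
lemma isLocallyConstant_of_mvfderiv_eq_zero (hF : SmoothFun I F Set.univ)
    (h0 : ∀ y, mvfderiv I F y = 0) : IsLocallyConstant F := by
  rw [IsLocallyConstant.iff_eventually_eq]
  intro x
  obtain ⟨r, hr, hball⟩ := Metric.isOpen_iff.mp (isOpen_extChartAt_target (I := I) x)
    _ (mem_extChartAt_target x)
  have hc : ∀ z ∈ Metric.ball (extChartAt I x x) r,
      F ((extChartAt I x).symm z) = F ((extChartAt I x).symm (extChartAt I x x)) := by
    intro z hz
    refine (convex_ball _ r).is_const_of_fderivWithin_eq_zero (𝕜 := ℝ)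
      (f := fun z ↦ F ((extChartAt I x).symm z)) (fun u hu ↦ ?_) (fun u hu ↦ ?_) hz
      (Metric.mem_ball_self hr)
    · exact (hasFDerivAt_comp_symm (hball hu)
        (hF.mdiffAt (Set.mem_univ _))).differentiableAt.differentiableWithinAt
    · rw [fderivWithin_of_isOpen Metric.isOpen_ball hu]
      ext v
      rw [fderiv_comp_symm (hball hu) (hF.mdiffAt (Set.mem_univ _)), h0]
      rfl
  have h1 := (continuousAt_extChartAt (I := I) x).eventually (Metric.ball_mem_nhds _ hr)
  filter_upwards [h1, extChartAt_source_mem_nhds (I := I) x] with y hy hys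
  have h2 := hc _ hy
  rwa [(extChartAt I x).left_inv hys, extChartAt_to_inv] at h2

end Boundaryless

end RiemannianGeometry

end ChartCalculus

/-! ### Surfaces: R and |∇f|² as explicit functions of f -/

section SurfaceAlgebra

set_option linter.unusedSectionVars false

namespace RiemannianGeometry

variable {E : Type*} [NormedAddCommGroup E] [NormedSpace ℝ E] [FiniteDimensional ℝ E]
  {H : Type*} [TopologicalSpace H] {I : ModelWithCorners ℝ E H}
  {M : Type*} [TopologicalSpace M] [ChartedSpace H M] [IsManifold I ∞ M]
  [RiemannianBundle (fun x : M ↦ TangentSpace I x)]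
  [IsContMDiffRiemannianBundle I ∞ E (fun x : M ↦ TangentSpace I x)]
  {f : M → ℝ} {ρ : ℝ} [Nontrivial E]

namespace IsGradientYamabeSoliton

/-- On a surface, the scalar curvature satisfies `dR = -(R / 2) df`. -/
lemma mvfderiv_factor (h : IsGradientYamabeSoliton I f ρ) (hn : Module.finrank ℝ E = 2) (x : M) :
    mvfderiv I (solitonFactor I ρ) x = (-(scalarCurvature I x / 2)) • mvfderiv I f x := by
  obtain ⟨V, e, hxV, he⟩ := exists_isOrthoFrame I x
  obtain ⟨b', -⟩ := he.exists_orthonormalBasis hxV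
  let b := b'.reindex (finCongr hn)
  have hR : scalarCurvature I x = 2 * inner ℝ (curvatureTensor x (b 0) (b 1) (b 1)) (b 0) := by
    have z : ∀ u w z : TangentSpace I x, (inner ℝ (curvatureTensor x u u w) z : ℝ) = 0 := by
      intro u w z
      have h1 := congrArg (fun v ↦ (inner ℝ v z : ℝ)) (curvatureTensor_swap (u := u) (v := u) (w := w))
      simp only [inner_neg_left] at h1
      linarith
    have s : (inner ℝ (curvatureTensor x (b 1) (b 0) (b 0)) (b 1) : ℝ) =
        inner ℝ (curvatureTensor x (b 0) (b 1) (b 1)) (b 0) := by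
      rw [inner_curvatureTensor_comm]
    rw [scalarCurvature_eq_sum b]
    simp only [Fin.sum_univ_two, z, s]
    ring
  have hX : ∀ z, (inner ℝ z (riemannianGradient I f x) : ℝ) = mvfderiv I f x z := fun z ↦ by
    rw [real_inner_comm]
    exact inner_sharp x _ _
  have ob : ∀ i j, (inner ℝ (b i) (b j) : ℝ) = if i = j then 1 else 0 :=
    orthonormal_iff_ite.mp b.orthonormal
  have hG := h.curvatureTensor_gradient (b 0) (b 1)
  set K : ℝ := inner ℝ (curvatureTensor x (b 0) (b 1) (b 1)) (b 0) with hK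
  -- On a plane the skew map R(b 0, b 1) is determined by K = R / 2. Pairing `hG` with b 1 and with
  -- b 0 then gives dφ on the two basis vectors.
  have k1 : curvatureTensor x (b 0) (b 1) (b 1) = K • b 0 := by
    rw [← b.sum_repr' (curvatureTensor x (b 0) (b 1) (b 1)), Fin.sum_univ_two,
      real_inner_comm, ← hK, real_inner_comm, inner_curvatureTensor_self, zero_smul, add_zero]
  have k0 : curvatureTensor x (b 0) (b 1) (b 0) = (-K) • b 1 := by
    rw [← b.sum_repr' (curvatureTensor x (b 0) (b 1) (b 0)), Fin.sum_univ_two,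
      real_inner_comm, inner_curvatureTensor_self, zero_smul, zero_add, real_inner_comm,
      inner_curvatureTensor_swap]
  have e0 : mvfderiv I (solitonFactor I ρ) x (b 0) = -K * mvfderiv I f x (b 0) := by
    have h1 := congrArg (fun v ↦ (inner ℝ v (b 1) : ℝ)) hG
    simp only [inner_sub_left, real_inner_smul_left, ob] at h1
    rw [inner_curvatureTensor_swap, k1, real_inner_smul_left, hX] at h1
    simpa using h1.symm
  have e1 : mvfderiv I (solitonFactor I ρ) x (b 1) = -K * mvfderiv I f x (b 1) := by
    have h1 := congrArg (fun v ↦ (inner ℝ v (b 0) : ℝ)) hG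
    simp only [inner_sub_left, real_inner_smul_left, ob] at h1
    rw [inner_curvatureTensor_swap, k0, real_inner_smul_left, hX] at h1
    simp at h1
    linarith
  ext v
  rw [← b.sum_repr' v, Fin.sum_univ_two]
  simp only [map_add, map_smul, smul_apply, e0, e1, smul_eq_mul, hR]
  ring

variable [I.Boundaryless]

/-- On each connected component of a surface, the scalar curvature and `|∇f|²` are explicit
functions of `f`. -/
lemma exists_profile (h : IsGradientYamabeSoliton I f ρ) (hn : Module.finrank ℝ E = 2) (x₀ : M) :
    ∃ B C : ℝ, ∀ y ∈ connectedComponent x₀,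
      solitonFactor I ρ y = C * Real.exp (-f y / 2) - ρ ∧
      gradNormSq I f y = B - 4 * C * Real.exp (-f y / 2) - 2 * ρ * f y := by
  have hR : SmoothFun I (fun y : M ↦ scalarCurvature I y) Set.univ := by
    refine SmoothFun.congr ((h.smooth_factor (U := Set.univ)).add (SmoothFun.const ρ)) isOpen_univ
      fun y _ ↦ ?_
    simp [solitonFactor]
  have hdR : ∀ y, mvfderiv I (fun y : M ↦ scalarCurvature I y) y =
      (-(scalarCurvature I y / 2)) • mvfderiv I f y := by
    intro y
    rw [← h.mvfderiv_factor hn y]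
    have h1 : (solitonFactor I ρ : M → ℝ) = (fun y : M ↦ scalarCurvature I y) - fun _ ↦ ρ := rfl
    rw [h1, mvfderiv_sub (hR.mdiffAt (Set.mem_univ y)) ((SmoothFun.const ρ).mdiffAt (Set.mem_univ y)),
      mvfderiv_const, sub_zero]
  have hf : SmoothFun I f Set.univ := h.smoothFun
  have hexp : SmoothFun I (fun y ↦ Real.exp (f y / 2)) Set.univ :=
    hf.comp (k := fun s ↦ Real.exp (s / 2)) fun y _ ↦ by fun_prop
  have hdexp : ∀ y, mvfderiv I (fun y ↦ Real.exp (f y / 2)) y =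
      (Real.exp (f y / 2) / 2) • mvfderiv I f y := by
    intro y
    refine mvfderiv_comp_real (k := fun s ↦ Real.exp (s / 2)) (hf.mdiffAt (Set.mem_univ y)) ?_
    have := (Real.hasDerivAt_exp (f y / 2)).comp (f y) ((hasDerivAt_id (f y)).div_const 2)
    exact this.congr_deriv (by ring)
  -- Two first integrals: R exp(f/2), because dR = -(R/2) df, and w + 4R + 2ρ f, because dw = 2(R -
  -- ρ) df.
  let P : M → ℝ := (fun y : M ↦ scalarCurvature I y) * fun y ↦ Real.exp (f y / 2)
  let Q : M → ℝ := gradNormSq I f + ((fun _ ↦ 4 : M → ℝ) * (fun y : M ↦ scalarCurvature I y)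
    + (fun _ ↦ 2 * ρ : M → ℝ) * f)
  have m : ∀ {G : M → ℝ} (_ : SmoothFun I G Set.univ) (y : M), MDiffAt G y :=
    fun hG y ↦ hG.mdiffAt (Set.mem_univ y)
  have hP : IsLocallyConstant P := by
    refine isLocallyConstant_of_mvfderiv_eq_zero (hR.mul hexp) fun y ↦ ?_
    rw [mvfderiv_mul (m hR y) (m hexp y), hdR, hdexp]
    ext v
    simp only [add_apply, smul_apply, smul_eq_mul, zero_apply]
    ring
  have hQ : IsLocallyConstant Q := by
    have c4 : SmoothFun I (fun _ : M ↦ (4 : ℝ)) Set.univ := SmoothFun.const 4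
    have c2 : SmoothFun I (fun _ : M ↦ 2 * ρ) Set.univ := SmoothFun.const (2 * ρ)
    have hw : SmoothFun I (gradNormSq I f) Set.univ := h.smooth_gradNormSq
    refine isLocallyConstant_of_mvfderiv_eq_zero (hw.add ((c4.mul hR).add (c2.mul hf))) fun y ↦ ?_
    rw [mvfderiv_add (m hw y) (m ((c4.mul hR).add (c2.mul hf)) y),
      mvfderiv_add (m (c4.mul hR) y) (m (c2.mul hf) y), mvfderiv_mul (m c4 y) (m hR y),
      mvfderiv_mul (m c2 y) (m hf y), mvfderiv_const, mvfderiv_const, hdR, h.mvfderiv_gradNormSq]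
    ext v
    simp only [add_apply, smul_apply, smul_eq_mul, zero_apply, solitonFactor]
    ring
  refine ⟨Q x₀, P x₀, fun y hy ↦ ?_⟩
  have p : P y = P x₀ :=
    hP.apply_eq_of_isPreconnected isPreconnected_connectedComponent hy mem_connectedComponent
  have q : Q y = Q x₀ :=
    hQ.apply_eq_of_isPreconnected isPreconnected_connectedComponent hy mem_connectedComponent
  have r : P x₀ * Real.exp (-f y / 2) = scalarCurvature I y := by
    rw [← p]
    simp only [P, Pi.mul_apply]
    rw [mul_assoc, ← Real.exp_add]
    ring_nf
    simp
  refine ⟨by rw [r, solitonFactor], ?_⟩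
  rw [mul_assoc, r, ← q]
  simp only [Q, Pi.add_apply, Pi.mul_apply]
  ring

end IsGradientYamabeSoliton

end RiemannianGeometry

/-- The slopes of a strictly concave profile `B - 4 C exp (-s / 2) - 2 ρ s` at two different zeros
are not opposite. -/
lemma profile_slopes_ne {B C ρ m k : ℝ} (hC : 0 < C) (hmk : m < k)
    (h0 : B - 4 * C * Real.exp (-m / 2) - 2 * ρ * m = 0)
    (h1 : B - 4 * C * Real.exp (-k / 2) - 2 * ρ * k = 0) :
    C * Real.exp (-m / 2) - ρ ≠ -(C * Real.exp (-k / 2) - ρ) := by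
  intro h2
  set y := (k - m) / 2 with hy
  have hy0 : 0 < y := by rw [hy]; linarith
  have e1 : Real.exp (-k / 2) = Real.exp (-m / 2) * Real.exp (-y) := by
    rw [← Real.exp_add, hy]
    ring_nf
  have hpos : 0 < C * Real.exp (-m / 2) := mul_pos hC (Real.exp_pos _)
  -- With A = C exp(-m/2), opposite slopes mean 2ρ = A (1 + exp(-y)), and the two zeros give ρ y = A
  -- (1 - exp(-y)); eliminate ρ and divide by A.
  have e2 : y * (1 + Real.exp (-y)) - 2 * (1 - Real.exp (-y)) = 0 := by
    refine (mul_eq_zero.mp ?_).resolve_left hpos.ne'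
    rw [e1] at h1 h2
    have : k = m + 2 * y := by rw [hy]; ring
    rw [this] at h1
    linear_combination y * h2 - (1 / 2) * (h1 - h0)
  -- The derivative 1 - (1 + t) exp(-t) is positive for t > 0, so y = 0 is the only zero with y ≥ 0.
  have hmono : StrictMonoOn (fun y : ℝ ↦ y * (1 + Real.exp (-y)) - 2 * (1 - Real.exp (-y)))
      (Set.Ici 0) := by
    refine strictMonoOn_of_deriv_pos (convex_Ici 0) (by fun_prop) fun t ht ↦ ?_
    rw [interior_Ici, Set.mem_Ioi] at ht
    have hE : HasDerivAt (fun t : ℝ ↦ Real.exp (-t)) (-Real.exp (-t)) t := by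
      simpa using (hasDerivAt_neg t).exp
    have hd : HasDerivAt (fun y : ℝ ↦ y * (1 + Real.exp (-y)) - 2 * (1 - Real.exp (-y)))
        (1 * (1 + Real.exp (-t)) + t * (-Real.exp (-t)) - 2 * (-(-Real.exp (-t)))) t :=
      ((hasDerivAt_id t).mul (hE.const_add 1)).sub ((hE.const_sub 1).const_mul 2)
    rw [hd.deriv]
    have h3 : 1 + t < Real.exp t := by linarith [Real.add_one_lt_exp ht.ne']
    have h4 : (1 + t) * Real.exp (-t) < Real.exp t * Real.exp (-t) :=
      mul_lt_mul_of_pos_right h3 (Real.exp_pos _)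
    rw [← Real.exp_add, add_neg_cancel, Real.exp_zero] at h4
    linarith
  have h3 := hmono (Set.self_mem_Ici) (Set.mem_Ici.mpr hy0.le) hy0
  simp only [neg_zero, Real.exp_zero, zero_mul] at h3
  linarith

/-- A nonnegative profile `B - 4 C exp (-s / 2) - 2 ρ s` vanishing at two points and positive
somewhere between them is strictly concave, and its critical point lies between its zeros. -/
lemma profile_shape {B C ρ m k s₀ : ℝ} (hm : m < s₀) (hk : s₀ < k)
    (h0 : B - 4 * C * Real.exp (-m / 2) - 2 * ρ * m = 0)
    (h1 : B - 4 * C * Real.exp (-k / 2) - 2 * ρ * k = 0)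
    (hs₀ : 0 < B - 4 * C * Real.exp (-s₀ / 2) - 2 * ρ * s₀) :
    0 < C ∧ 0 < C * Real.exp (-m / 2) - ρ ∧ C * Real.exp (-k / 2) - ρ < 0 ∧
      ∀ s ∈ Set.Ioo m k, 0 < B - 4 * C * Real.exp (-s / 2) - 2 * ρ * s := by
  set W : ℝ → ℝ := fun s ↦ B - 4 * C * Real.exp (-s / 2) - 2 * ρ * s with hW
  have hE : ∀ t, HasDerivAt (fun t : ℝ ↦ Real.exp (-t / 2)) (-(Real.exp (-t / 2) / 2)) t := by
    intro t
    have := ((hasDerivAt_neg t).div_const 2).exp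
    exact this.congr_deriv (by ring)
  have hd : ∀ t, HasDerivAt W (2 * (C * Real.exp (-t / 2) - ρ)) t := by
    intro t
    have := (((hE t).const_mul (4 * C)).const_sub B).sub ((hasDerivAt_id t).const_mul (2 * ρ))
    exact this.congr_deriv (by ring)
  have hcont : Continuous W := by fun_prop
  have hmk : m < k := hm.trans hk
  -- The slope 2(C exp(-s/2) - ρ) is positive somewhere before s₀ and negative somewhere after it,
  -- which forces C > 0; it is then strictly decreasing.
  obtain ⟨a, ha, hWa⟩ := exists_hasDerivAt_eq_slope W _ hm hcont.continuousOn fun t _ ↦ hd t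
  obtain ⟨b, hb, hWb⟩ := exists_hasDerivAt_eq_slope W _ hk hcont.continuousOn fun t _ ↦ hd t
  have hWm : W m = 0 := h0
  have hWk : W k = 0 := h1
  have hWs : 0 < W s₀ := hs₀
  have hapos : 0 < 2 * (C * Real.exp (-a / 2) - ρ) := by
    rw [hWa, hWm]
    exact div_pos (by linarith) (by linarith)
  have hbneg : 2 * (C * Real.exp (-b / 2) - ρ) < 0 := by
    rw [hWb, hWk]
    exact div_neg_of_neg_of_pos (by linarith) (by linarith)
  have hab : a < b := ha.2.trans hb.1
  have hexp : ∀ s t : ℝ, s < t → Real.exp (-t / 2) < Real.exp (-s / 2) := fun s t hst ↦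
    Real.exp_lt_exp.mpr (by linarith)
  have hC : 0 < C := by
    have h3 := hexp a b hab
    by_contra! hC
    have := mul_le_mul_of_nonpos_left h3.le hC
    linarith
  have hanti : ∀ s t : ℝ, s < t → C * Real.exp (-t / 2) - ρ < C * Real.exp (-s / 2) - ρ :=
    fun s t hst ↦ by linarith [mul_lt_mul_of_pos_left (hexp s t hst) hC]
  refine ⟨hC, by linarith [hanti m a ha.1], by linarith [hanti b k hb.2], fun s hs ↦ ?_⟩
  change 0 < W s
  -- A nonpositive value at s would give a slope ≤ 0 before s and a slope ≥ 0 after it.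
  by_contra! hneg
  obtain ⟨c, hc, hWc⟩ := exists_hasDerivAt_eq_slope W _ hs.1 hcont.continuousOn fun t _ ↦ hd t
  obtain ⟨d, hd', hWd⟩ := exists_hasDerivAt_eq_slope W _ hs.2 hcont.continuousOn fun t _ ↦ hd t
  have h3 : 2 * (C * Real.exp (-c / 2) - ρ) ≤ 0 := by
    rw [hWc, hWm]
    exact div_nonpos_of_nonpos_of_nonneg (by linarith) (by linarith [hs.1])
  have h4 : 0 ≤ 2 * (C * Real.exp (-d / 2) - ρ) := by
    rw [hWd, hWk]
    exact div_nonneg (by linarith) (by linarith [hs.2])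
  linarith [hanti c d (hc.2.trans hd'.1)]

end SurfaceAlgebra

/-! ### A mountain pass lemma by connectedness -/

section MountainPass

variable {M : Type*} [TopologicalSpace M] {f : M → ℝ} {Z : Set M} {p q : M}

/-- Separate F₁ and F₂ by disjoint open sets. On the compact rest of Z the minimum of f exceeds s,
so slightly higher sublevel sets remain separated and no connected set below such a level joins p to
q. -/
lemma false_of_separated_sublevel [NormalSpace M] [CompactSpace M] {s : ℝ} {F₁ F₂ : Set M}
    (hf : Continuous f) (hZ : IsClosed Z) (hF₁ : IsClosed F₁) (hF₂ : IsClosed F₂)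
    (hd : Disjoint F₁ F₂) (hc : ∀ x ∈ Z, f x ≤ s → x ∈ F₁ ∪ F₂) (hp : p ∈ F₁) (hq : q ∈ F₂)
    (h : ∀ ε : ℝ, 0 < ε → ∃ T ⊆ Z, IsPreconnected T ∧ p ∈ T ∧ q ∈ T ∧ ∀ x ∈ T, f x < s + ε) :
    False := by
  obtain ⟨U₁, U₂, hU₁, hU₂, h₁, h₂, hU⟩ := normal_separation hF₁ hF₂ hd
  have key : ∀ ε : ℝ, 0 < ε → ¬ ∀ x ∈ Z, f x < s + ε → x ∈ U₁ ∪ U₂ := by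
    intro ε hε hx
    obtain ⟨T, hTZ, hT, hpT, hqT, hlt⟩ := h ε hε
    obtain ⟨x, -, hx1, hx2⟩ := hT U₁ U₂ hU₁ hU₂ (fun x hxT ↦ hx x (hTZ hxT) (hlt x hxT))
      ⟨p, hpT, h₁ hp⟩ ⟨q, hqT, h₂ hq⟩
    exact Set.disjoint_left.mp hU hx1 hx2
  set K : Set M := Z \ (U₁ ∪ U₂)
  have hK : IsCompact K := (hZ.sdiff (hU₁.union hU₂)).isCompact
  rcases K.eq_empty_or_nonempty with he | hne
  · refine key 1 one_pos fun x hx _ ↦ ?_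
    by_contra hxU
    exact (he ▸ (⟨hx, hxU⟩ : x ∈ K) : x ∈ (∅ : Set M))
  · obtain ⟨z, hz, hmin⟩ := hK.exists_isMinOn hne hf.continuousOn
    have hzs : s < f z := by
      by_contra! hle
      rcases hc z hz.1 hle with h3 | h3
      · exact hz.2 (Or.inl (h₁ h3))
      · exact hz.2 (Or.inr (h₂ h3))
    refine key (f z - s) (by linarith) fun x hx hlt ↦ ?_
    by_contra hxU
    have : f z ≤ f x := hmin ⟨hx, hxU⟩
    linarith

/-- Mountain pass: on a connected clopen set, if strict sublevel sets are locally connected at all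
points above the minimal level and minimum points are isolated, the minimum point is unique. -/
theorem eq_of_minimum_of_locally_connected_sublevel [T2Space M] [CompactSpace M]
    [LocallyPathConnectedSpace M] {m : ℝ} (hf : Continuous f) (hZ : IsClopen Z)
    (hZc : IsPreconnected Z) (hm : ∀ x ∈ Z, m ≤ f x)
    (hconn : ∀ x ∈ Z, m < f x → ∃ N ∈ 𝓝 x, IsPreconnected (N ∩ {y | f y < f x}))
    (hcl : ∀ x ∈ Z, m < f x → x ∈ closure {y | f y < f x})
    (hiso : ∀ x ∈ Z, f x = m → ∀ᶠ y in 𝓝[≠] x, f y ≠ m)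
    (hp : p ∈ Z) (hq : q ∈ Z) (hfp : f p = m) (hfq : f q = m) : p = q := by
  by_contra hpq
  -- The levels below which p and q can be joined; the infimum s is the height of the pass.
  let S : Set ℝ := {s | ∃ T ⊆ Z, IsPreconnected T ∧ p ∈ T ∧ q ∈ T ∧ ∀ x ∈ T, f x < s}
  have hSb : ∀ s ∈ S, m < s := fun s ⟨T, _, _, hpT, _, hlt⟩ ↦ hfp ▸ hlt p hpT
  have hSbdd : BddBelow S := ⟨m, fun s hs ↦ (hSb s hs).le⟩
  have hSne : S.Nonempty := by
    obtain ⟨z, -, hz⟩ := isCompact_univ.exists_isMaxOn ⟨p, Set.mem_univ p⟩ hf.continuousOn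
    refine ⟨f z + 1, Z, subset_rfl, hZc, hp, hq, fun x _ ↦ ?_⟩
    have : f x ≤ f z := hz (Set.mem_univ x)
    linarith
  set s := sInf S with hs
  have hms : m ≤ s := le_csInf hSne fun t ht ↦ (hSb t ht).le
  have happrox : ∀ ε : ℝ, 0 < ε →
      ∃ T ⊆ Z, IsPreconnected T ∧ p ∈ T ∧ q ∈ T ∧ ∀ x ∈ T, f x < s + ε := by
    intro ε hε
    obtain ⟨t, ⟨T, h1, h2, h3, h4, h5⟩, ht⟩ := exists_lt_of_csInf_lt hSne
      (show sInf S < s + ε by linarith)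
    exact ⟨T, h1, h2, h3, h4, fun x hx ↦ (h5 x hx).trans ht⟩
  -- If s = m, the minimum set splits into {p} and the rest, since p is isolated. If s > m, the
  -- splitting is by the component A of p in the strict sublevel set O and its complement in O.
  rcases hms.eq_or_lt with hms | hms
  · have h1 := hiso p hp hfp
    rw [eventually_nhdsWithin_iff, eventually_nhds_iff] at h1
    obtain ⟨V, hV, hVo, hpV⟩ := h1
    have hcl : IsClosed {x | f x ≤ m} := isClosed_le hf continuous_const
    refine false_of_separated_sublevel (F₁ := {p}) (F₂ := (Z ∩ {x | f x ≤ m}) \ V) hf hZ.isClosed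
      isClosed_singleton ((hZ.isClosed.inter hcl).sdiff hVo)
      (Set.disjoint_singleton_left.mpr fun h ↦ h.2 hpV) (fun x hx hle ↦ ?_)
      rfl ⟨⟨hq, hfq.le⟩, fun h ↦ hV q h (Ne.symm hpq) hfq⟩ happrox
    rw [← hms] at hle
    by_cases hxp : x = p
    · exact Or.inl hxp
    · exact Or.inr ⟨⟨hx, hle⟩, fun h ↦ hV x h hxp (le_antisymm hle (hm x hx))⟩
  set O : Set M := Z ∩ {x | f x < s} with hO
  have hOo : IsOpen O := hZ.isOpen.inter (isOpen_lt hf continuous_const)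
  have hpO : p ∈ O := ⟨hp, by simpa [hfp] using hms⟩
  have hqO : q ∈ O := ⟨hq, by simpa [hfq] using hms⟩
  set A := connectedComponentIn O p with hA
  have hAo : IsOpen A := hOo.connectedComponentIn
  have hAO : A ⊆ O := connectedComponentIn_subset O p
  have hpA : p ∈ A := mem_connectedComponentIn hpO
  have hqA : q ∉ A := by
    intro hqA
    have hAc : IsConnected A := isConnected_connectedComponentIn_iff.mpr hpO
    -- A path is compact, so its highest point lies strictly below s, and p and q could be joined
    -- below a level smaller than s.
    obtain ⟨γ, hγ⟩ := (hAo.isConnected_iff_isPathConnected.mp hAc).joinedIn p hpA q hqA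
    have hcomp : IsCompact (Set.range γ) := isCompact_range γ.continuous
    obtain ⟨z, ⟨t, rfl⟩, hz⟩ := hcomp.exists_isMaxOn ⟨_, Set.mem_range_self 0⟩ hf.continuousOn
    have hlt : f (γ t) < s := (hAO (hγ t)).2
    have hmem : (f (γ t) + s) / 2 ∈ S := by
      refine ⟨Set.range γ, ?_, isPreconnected_range γ.continuous, ⟨0, γ.source⟩, ⟨1, γ.target⟩, ?_⟩
      · rintro _ ⟨u, rfl⟩
        exact (hAO (hγ u)).1
      · intro x hx
        have : f x ≤ f (γ t) := hz hx
        linarith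
    have := csInf_le hSbdd hmem
    linarith
  have hcA : closure A ∩ O ⊆ A := by
    rintro y ⟨hy, hyO⟩
    have hyc : y ∈ connectedComponentIn O y := mem_connectedComponentIn hyO
    obtain ⟨z, hz1, hz2⟩ := mem_closure_iff.mp hy _ hOo.connectedComponentIn hyc
    rw [hA, connectedComponentIn_eq hz2, ← connectedComponentIn_eq hz1]
    exact hyc
  have hcle : ∀ B ⊆ O, ∀ x ∈ closure B, x ∈ Z ∧ f x ≤ s := by
    intro B hB x hx
    have hcl : IsClosed (Z ∩ {x | f x ≤ s}) := hZ.isClosed.inter (isClosed_le hf continuous_const)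
    have hsub : B ⊆ Z ∩ {x | f x ≤ s} := fun y hy ↦ ⟨(hB hy).1, show f y ≤ s from le_of_lt (hB hy).2⟩
    exact closure_minimal hsub hcl hx
  refine false_of_separated_sublevel (F₁ := closure A) (F₂ := closure (O \ A)) hf hZ.isClosed
    isClosed_closure isClosed_closure (Set.disjoint_left.mpr fun x hxA hxB ↦ ?_)
    (fun x hx hle ↦ ?_) (subset_closure hpA) (subset_closure ⟨hqO, hqA⟩) happrox
  · obtain ⟨hxZ, hxs⟩ := hcle A hAO x hxA
    rcases hxs.lt_or_eq with hlt | heq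
    · have hxA' : x ∈ A := hcA ⟨hxA, hxZ, hlt⟩
      obtain ⟨z, hz1, hz2⟩ := mem_closure_iff.mp hxB A hAo hxA'
      exact hz2.2 hz1
    -- A point at height s in both closures would have a connected local sublevel set meeting both A
    -- and O \ A.
    · obtain ⟨N, hN, hNc⟩ := hconn x hxZ (heq ▸ hms)
      rw [heq] at hNc
      obtain ⟨a, haN, haA⟩ := mem_closure_iff_nhds.mp hxA N hN
      obtain ⟨b, hbN, hbB⟩ := mem_closure_iff_nhds.mp hxB N hN
      have haQ : a ∈ N ∩ {y | f y < s} := ⟨haN, (hAO haA).2⟩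
      have hQZ : N ∩ {y | f y < s} ⊆ Z := hNc.subset_isClopen hZ ⟨a, haQ, (hAO haA).1⟩
      have hQA := hNc.subset_connectedComponentIn haQ (F := O) fun y hy ↦ ⟨hQZ hy, hy.2⟩
      rw [← connectedComponentIn_eq haA] at hQA
      exact hbB.2 (hQA ⟨hbN, hbB.1.2⟩)
  · rw [← closure_union, Set.union_sdiff_cancel hAO]
    rcases hle.lt_or_eq with hlt | heq
    · exact subset_closure ⟨hx, hlt⟩
    · have h1 := hcl x hx (heq ▸ hms)
      rw [heq] at h1
      rw [hO, Set.inter_comm]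
      exact hZ.isOpen.closure_inter ⟨h1, hx⟩

end MountainPass

/-! ### Local analysis in normed spaces -/

section NormedSpaceLocal

set_option linter.unusedSectionVars false

variable {E : Type*} [NormedAddCommGroup E] [NormedSpace ℝ E] [FiniteDimensional ℝ E]
  {F : E → ℝ} {F' : E →L[ℝ] ℝ} {z : E} {T : Set E}

/-- Near a regular point, the strict sublevel set is connected. -/
lemma HasStrictFDerivAt.exists_isPreconnected_sublevel (hF : HasStrictFDerivAt F F' z)
    (h0 : F' ≠ 0) (hT : T ∈ 𝓝 z) :
    ∃ N ∈ 𝓝 z, N ⊆ T ∧ IsPreconnected (N ∩ {y | F y < F z}) := by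
  have : CompleteSpace E := FiniteDimensional.complete ℝ E
  have hr : F'.range = ⊤ := by
    refine LinearMap.range_eq_top.mpr ?_
    exact LinearMap.surjective (f := F'.toLinearMap) fun h ↦ h0 (by
      ext v; exact congrArg (fun A : E →ₗ[ℝ] ℝ ↦ A v) h)
  -- In the coordinates of the implicit function theorem F is the first coordinate, so the sublevel
  -- set in a ball is an intersection with a half-space and is convex.
  set Φ := hF.implicitToOpenPartialHomeomorph F F' hr with hΦ
  have hz : z ∈ Φ.source := hF.mem_implicitToOpenPartialHomeomorph_source hr
  have hfst : ∀ y, (Φ y).1 = F y := fun y ↦ hF.implicitToOpenPartialHomeomorph_fst hr y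
  have h1 : Φ.target ∩ Φ.symm ⁻¹' T ∈ 𝓝 (Φ z) := by
    refine Filter.inter_mem (Φ.open_target.mem_nhds (Φ.map_source hz)) ?_
    refine (Φ.symm.continuousAt (Φ.map_source hz)).preimage_mem_nhds ?_
    rwa [Φ.left_inv hz]
  obtain ⟨r, hr0, hB⟩ := Metric.mem_nhds_iff.mp h1
  have hBt : Metric.ball (Φ z) r ⊆ Φ.target := fun p hp ↦ (hB hp).1
  refine ⟨Φ.symm '' Metric.ball (Φ z) r, ?_, ?_, ?_⟩
  · have := Φ.symm.image_mem_nhds (Φ.map_source hz) (Metric.ball_mem_nhds (Φ z) hr0)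
    rwa [Φ.left_inv hz] at this
  · rintro _ ⟨p, hp, rfl⟩
    exact (hB hp).2
  · have h2 : Φ.symm '' Metric.ball (Φ z) r ∩ {y | F y < F z} =
        Φ.symm '' (Metric.ball (Φ z) r ∩ {p | p.1 < F z}) := by
      ext y
      constructor
      · rintro ⟨⟨p, hp, rfl⟩, hy⟩
        refine ⟨p, ⟨hp, ?_⟩, rfl⟩
        rw [Set.mem_ofPred_eq, ← hfst, Φ.right_inv (hBt hp)] at hy
        exact hy
      · rintro ⟨p, ⟨hp, hlt⟩, rfl⟩
        refine ⟨⟨p, hp, rfl⟩, ?_⟩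
        rw [Set.mem_ofPred_eq, ← hfst, Φ.right_inv (hBt hp)]
        exact hlt
    rw [h2]
    refine IsPreconnected.image ?_ _ (Φ.continuousOn_symm.mono fun p hp ↦ hBt hp.1)
    refine ((convex_ball _ _).inter ?_).isPreconnected
    exact convex_halfSpace_lt (LinearMap.fst ℝ ℝ F'.ker).isLinear _

/-- Polar coordinates: a continuous image of an interval times the unit sphere, which is connected
when the rank exceeds one. -/
lemma isPreconnected_ball_diff_singleton (h : 1 < Module.rank ℝ E) (z : E) (r : ℝ) :
    IsPreconnected (Metric.ball z r \ {z}) := by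
  have h1 : Metric.ball z r \ {z} =
      (fun p : ℝ × E ↦ z + p.1 • p.2) '' (Set.Ioo 0 r ×ˢ Metric.sphere (0 : E) 1) := by
    ext y
    constructor
    · rintro ⟨hy, hne⟩
      have h0 : y - z ≠ 0 := sub_ne_zero.mpr hne
      refine ⟨(‖y - z‖, ‖y - z‖⁻¹ • (y - z)), ⟨⟨norm_pos_iff.mpr h0, ?_⟩, ?_⟩, ?_⟩
      · rwa [mem_ball_iff_norm] at hy
      · simp [norm_smul, h0]
      · simp [smul_smul, h0]
    · rintro ⟨⟨t, u⟩, ⟨⟨ht0, htr⟩, hu⟩, rfl⟩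
      simp only [mem_sphere_iff_norm, sub_zero] at hu
      refine ⟨?_, ?_⟩
      · simp only [mem_ball_iff_norm, add_sub_cancel_left, norm_smul, hu, mul_one,
          Real.norm_eq_abs, abs_of_pos ht0]
        exact htr
      · have : u ≠ 0 := by
          rintro rfl
          simp at hu
        simp [ht0.ne', this]
  rw [h1]
  exact (isPreconnected_Ioo.prod (isPreconnected_sphere h 0 1)).image _
    (by fun_prop)

/-- Second order Taylor expansion at a critical point. -/
lemma HasFDerivAt.taylor_two {Q : E →L[ℝ] E →L[ℝ] ℝ} (hQ : HasFDerivAt (fderiv ℝ F) Q z)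
    (hsymm : ∀ u v, Q u v = Q v u) (hd : ∀ᶠ y in 𝓝 z, DifferentiableAt ℝ F y)
    (h0 : fderiv ℝ F z = 0) {ε : ℝ} (hε : 0 < ε) :
    ∀ᶠ u in 𝓝 (0 : E), |F (z + u) - F z - Q u u / 2| ≤ ε * ‖u‖ ^ 2 := by
  have h1 : ∀ᶠ v in 𝓝 (0 : E), ‖fderiv ℝ F (z + v) - Q v‖ ≤ ε * ‖v‖ := by
    have := (hasFDerivAt_iff_isLittleO_nhds_zero.mp hQ).def hε
    simpa [h0] using this
  have h2 : ∀ᶠ v in 𝓝 (0 : E), DifferentiableAt ℝ F (z + v) := by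
    have : Filter.Tendsto (fun v ↦ z + v) (𝓝 (0 : E)) (𝓝 z) := by
      have : ContinuousAt (fun v ↦ z + v) (0 : E) := by fun_prop
      simpa [ContinuousAt] using this
    exact this.eventually hd
  obtain ⟨r, hr, hball⟩ := Metric.eventually_nhds_iff_ball.mp (h1.and h2)
  filter_upwards [Metric.ball_mem_nhds 0 hr] with u hu
  -- By symmetry of Q the derivative of G at v is F'(z + v) - Q v, of norm at most ε‖u‖ on the ball
  -- of radius ‖u‖; the mean value inequality concludes.
  set G : E → ℝ := fun v ↦ F (z + v) - Q v v / 2 with hG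
  have hsub : Metric.closedBall (0 : E) ‖u‖ ⊆ Metric.ball 0 r :=
    Metric.closedBall_subset_ball (by simpa using hu)
  have hGd : ∀ v ∈ Metric.closedBall (0 : E) ‖u‖,
      HasFDerivAt G (fderiv ℝ F (z + v) - Q v) v := by
    intro v hv
    have e1 : HasFDerivAt (fun v ↦ F (z + v)) (fderiv ℝ F (z + v)) v := by
      have := (hball v (hsub hv)).2.hasFDerivAt.comp v ((hasFDerivAt_id v).const_add z)
      exact this.congr_fderiv (by ext w; simp)
    have e2 : HasFDerivAt (fun v ↦ Q v v) (2 • Q v) v := by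
      have := (Q.hasFDerivAt (x := v)).clm_apply (hasFDerivAt_id v)
      refine this.congr_fderiv ?_
      ext w
      simp [hsymm w v, two_mul]
    have e3 := e2.const_mul (1 / 2 : ℝ)
    have e4 := e1.sub e3
    refine (e4.congr_of_eventuallyEq (Filter.Eventually.of_forall fun w ↦ ?_)).congr_fderiv ?_
    · simp only [hG, Pi.sub_apply]
      ring
    · ext w
      simp
  have h3 := (convex_closedBall (0 : E) ‖u‖).norm_image_sub_le_of_norm_hasFDerivWithin_le
    (f := G) (C := ε * ‖u‖) (x := 0) (y := u) (fun v hv ↦ (hGd v hv).hasFDerivWithinAt)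
    (fun v hv ↦ ((hball v (hsub hv)).1).trans
      (mul_le_mul_of_nonneg_left (by simpa using hv) hε.le)) (by simp) (by simp)
  simp only [hG, add_zero, map_zero, sub_zero, zero_div, Real.norm_eq_abs] at h3
  calc |F (z + u) - F z - Q u u / 2| = |F (z + u) - Q u u / 2 - F z| := by ring_nf
    _ ≤ ε * ‖u‖ * ‖u‖ := h3
    _ = ε * ‖u‖ ^ 2 := by ring

end NormedSpaceLocal

/-! ### Local structure of the potential in charts -/

section CriticalPoints

set_option linter.unusedSectionVars false

namespace RiemannianGeometry

variable {E : Type*} [NormedAddCommGroup E] [NormedSpace ℝ E] [FiniteDimensional ℝ E]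
  {H : Type*} [TopologicalSpace H] {I : ModelWithCorners ℝ E H}
  {M : Type*} [TopologicalSpace M] [ChartedSpace H M] [IsManifold I ∞ M]
  [RiemannianBundle (fun x : M ↦ TangentSpace I x)]
  [IsContMDiffRiemannianBundle I ∞ E (fun x : M ↦ TangentSpace I x)]
  {f : M → ℝ} {ρ : ℝ} {x : M} [Nontrivial E] [I.Boundaryless]

lemma extChartAt_symm_image_mem_nhds {N : Set E} (hN : N ∈ 𝓝 (extChartAt I x x)) :
    (extChartAt I x).symm '' N ∈ 𝓝 x := by
  have h1 := (continuousAt_extChartAt (I := I) x).preimage_mem_nhds hN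
  filter_upwards [h1, extChartAt_source_mem_nhds (I := I) x] with y hy hys
  exact ⟨_, hy, (extChartAt I x).left_inv hys⟩

/-- The function `f` in the chart at `x`. -/
noncomputable def chartRep (I : ModelWithCorners ℝ E H) (x : M) (f : M → ℝ) (z : E) : ℝ :=
  f ((extChartAt I x).symm z)

lemma chartRep_self : chartRep I x f (extChartAt I x x) = f x := by
  rw [chartRep, extChartAt_to_inv]

lemma coordField_ne_zero {v : E} {y : M} (hy : y ∈ (chartAt H x).source) (hv : v ≠ 0) :
    coordField I x v y ≠ 0 := fun h0 ↦ by
  have := coordDiff_coordField (I := I) hy (v := v)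
  rw [h0, map_zero] at this
  exact hv this.symm

namespace SmoothFun

lemma contDiffAt_chartRep (h : SmoothFun I f Set.univ) {z : E}
    (hz : z ∈ (extChartAt I x).target) : ContDiffAt ℝ ∞ (chartRep I x f) z :=
  h.contDiffAt_comp_symm hz (Set.mem_univ _)

lemma fderiv_chartRep (h : SmoothFun I f Set.univ) {z : E}
    (hz : z ∈ (extChartAt I x).target) (v : E) :
    fderiv ℝ (chartRep I x f) z v = mvfderiv I f ((extChartAt I x).symm z)
      (coordField I x v ((extChartAt I x).symm z)) :=
  fderiv_comp_symm hz (h.mdiffAt (Set.mem_univ _)) v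

lemma mvfderiv_eq_zero_of_fderiv_chartRep (h : SmoothFun I f Set.univ) {y : M}
    (hy : y ∈ (chartAt H x).source) (h0 : mvfderiv I f y = 0) :
    fderiv ℝ (chartRep I x f) (extChartAt I x y) = 0 := by
  have hys : y ∈ (extChartAt I x).source := by rwa [extChartAt_source]
  ext v
  rw [h.fderiv_chartRep ((extChartAt I x).map_source hys), (extChartAt I x).left_inv hys, h0]
  rfl

lemma fderiv_chartRep_ne_zero (h : SmoothFun I f Set.univ) (h0 : mvfderiv I f x ≠ 0) :
    fderiv ℝ (chartRep I x f) (extChartAt I x x) ≠ 0 := by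
  intro h1
  refine h0 ?_
  ext v
  have h2 := h.fderiv_chartRep (mem_extChartAt_target x) (coordDiff I x x v)
  rw [h1, extChartAt_to_inv, coordField_coordDiff (mem_chart_source H x)] at h2
  exact h2.symm

lemma exists_isPreconnected_sublevel (h : SmoothFun I f Set.univ)
    (h0 : mvfderiv I f x ≠ 0) : ∃ N ∈ 𝓝 x, IsPreconnected (N ∩ {y | f y < f x}) := by
  have hz := mem_extChartAt_target (I := I) x
  have h1 : HasStrictFDerivAt (chartRep I x f) (fderiv ℝ (chartRep I x f) (extChartAt I x x))
      (extChartAt I x x) := (h.contDiffAt_chartRep hz).hasStrictFDerivAt (by simp)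
  obtain ⟨N, hN, hNT, hNc⟩ := h1.exists_isPreconnected_sublevel (h.fderiv_chartRep_ne_zero h0)
    ((isOpen_extChartAt_target x).mem_nhds hz)
  refine ⟨_, extChartAt_symm_image_mem_nhds hN, ?_⟩
  have h2 : (extChartAt I x).symm '' N ∩ {y | f y < f x} = (extChartAt I x).symm ''
      (N ∩ {z | chartRep I x f z < chartRep I x f (extChartAt I x x)}) := by
    rw [chartRep_self]
    ext y
    constructor
    · rintro ⟨⟨z, hz, rfl⟩, hy⟩
      exact ⟨z, ⟨hz, hy⟩, rfl⟩
    · rintro ⟨z, ⟨hz, hy⟩, rfl⟩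
      exact ⟨⟨z, hz, rfl⟩, hy⟩
  rw [h2]
  exact hNc.image _ ((continuousOn_extChartAt_symm x).mono fun z hz ↦ hNT hz.1)

lemma mem_closure_sublevel (h : SmoothFun I f Set.univ)
    (h0 : mvfderiv I f x ≠ 0) : x ∈ closure {y | f y < f x} := by
  rw [mem_closure_iff_frequently]
  intro h1
  exact h0 (mvfderiv_eq_zero_of_isLocalMin (h.mdiffAt (Set.mem_univ x))
    (h1.mono fun y hy ↦ not_lt.mp hy))

end SmoothFun

variable (I) in
/-- Near an isolated maximum point, the strict sublevel set is connected in dimension at least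
two. -/
lemma exists_isPreconnected_sublevel_of_isLocalMax [I.Boundaryless]
    (hE : 1 < Module.rank ℝ E) (hmax : IsLocalMax f x)
    (hiso : ∀ᶠ y in 𝓝[≠] x, f y ≠ f x) :
    (∃ N ∈ 𝓝 x, IsPreconnected (N ∩ {y | f y < f x})) ∧ x ∈ closure {y | f y < f x} := by
  have hz := mem_extChartAt_target (I := I) x
  have hsymm : Filter.Tendsto (extChartAt I x).symm (𝓝 (extChartAt I x x)) (𝓝 x) := by
    have := (continuousAt_extChartAt_symm (I := I) x).tendsto
    rwa [extChartAt_to_inv] at this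
  -- Near x the strict sublevel set is thus the punctured neighbourhood.
  have h1 : ∀ᶠ y in 𝓝 x, y ≠ x → f y < f x := by
    rw [eventually_nhdsWithin_iff] at hiso
    filter_upwards [hiso, hmax] with y h1 h2 hne
    exact lt_of_le_of_ne h2 (h1 hne)
  have h2 := (hsymm.eventually h1).and ((isOpen_extChartAt_target x).mem_nhds hz)
  obtain ⟨r, hr, hball⟩ := Metric.eventually_nhds_iff_ball.mp h2
  have h3 : ∀ z ∈ Metric.ball (extChartAt I x x) r,
      f ((extChartAt I x).symm z) < f x ↔ z ≠ extChartAt I x x := by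
    intro z hzb
    constructor
    · rintro hlt rfl
      rw [extChartAt_to_inv] at hlt
      exact lt_irrefl _ hlt
    · intro hne
      refine (hball z hzb).1 fun h4 ↦ hne ?_
      rw [← (extChartAt I x).right_inv (hball z hzb).2, h4]
  refine ⟨⟨_, extChartAt_symm_image_mem_nhds (I := I) (x := x)
    (Metric.ball_mem_nhds (extChartAt I x x) hr), ?_⟩, ?_⟩
  · have h4 : (extChartAt I x).symm '' Metric.ball (extChartAt I x x) r ∩ {y | f y < f x} =
        (extChartAt I x).symm '' (Metric.ball (extChartAt I x x) r \ {extChartAt I x x}) := by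
      ext y
      constructor
      · rintro ⟨⟨z, hzb, rfl⟩, hy⟩
        exact ⟨z, ⟨hzb, (h3 z hzb).mp hy⟩, rfl⟩
      · rintro ⟨z, ⟨hzb, hy⟩, rfl⟩
        exact ⟨⟨z, hzb, rfl⟩, (h3 z hzb).mpr hy⟩
    rw [h4]
    exact (isPreconnected_ball_diff_singleton hE _ _).image _
      ((continuousOn_extChartAt_symm x).mono fun z hz ↦ (hball z hz.1).2)
  · rw [mem_closure_iff_frequently]
    intro h4
    have h5 := (hsymm.eventually h4).and (Metric.ball_mem_nhds _ hr)
    have h6 : ∀ᶠ z in 𝓝[≠] (extChartAt I x x), False := by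
      rw [eventually_nhdsWithin_iff]
      filter_upwards [h5] with z hz hne
      exact hz.1 ((h3 z hz.2).mpr hne)
    exact (Real.punctured_nhds_module_neBot _).ne (Filter.eventually_false_iff_eq_bot.mp h6)

namespace IsGradientYamabeSoliton

lemma smoothFun_univ (h : IsGradientYamabeSoliton I f ρ) : SmoothFun I f Set.univ := h.smoothFun

/-- At a critical point, the second derivative of `f` in a chart is the Hessian. -/
lemma hasFDerivAt_fderiv_chartRep (h : IsGradientYamabeSoliton I f ρ)
    (h0 : mvfderiv I f x = 0) :
    ∃ Q : E →L[ℝ] E →L[ℝ] ℝ, HasFDerivAt (fderiv ℝ (chartRep I x f)) Q (extChartAt I x x) ∧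
      ∀ u v, Q u v = solitonFactor I ρ x * inner ℝ (coordField I x u x) (coordField I x v x) := by
  have hz := mem_extChartAt_target (I := I) x
  have hs := mem_chart_source H x
  have hd : DifferentiableAt ℝ (fderiv ℝ (chartRep I x f)) (extChartAt I x x) :=
    ((h.smoothFun_univ.contDiffAt_chartRep hz).fderiv_right (m := 1) (by
      rw [one_add_one_eq_two]
      exact show ((2 : ℕ∞) : WithTop ℕ∞) ≤ ((⊤ : ℕ∞) : WithTop ℕ∞) from
        WithTop.coe_le_coe.mpr le_top)).differentiableAt (by simp)
  refine ⟨_, hd.hasFDerivAt, fun u v ↦ ?_⟩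
  have h1 : fderiv ℝ (fun z ↦ fderiv ℝ (chartRep I x f) z v) (extChartAt I x x) u =
      fderiv ℝ (fderiv ℝ (chartRep I x f)) (extChartAt I x x) u v := by
    rw [fderiv_clm_apply hd (differentiableAt_const v)]
    simp
  rw [← h1]
  have hU := (chartAt H x).open_source
  have hv : SmoothField I (coordField I x v) (chartAt H x).source := smoothField_coordField
  have hu : SmoothField I (coordField I x u) (chartAt H x).source := smoothField_coordField
  have hsm := (h.smoothField_gradient (U := (chartAt H x).source)).innerFun hv
  have h2 : (fun z ↦ fderiv ℝ (chartRep I x f) z v) =ᶠ[𝓝 (extChartAt I x x)]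
      fun z ↦ (fun y ↦ (inner ℝ (riemannianGradient I f y) (coordField I x v y) : ℝ))
        ((extChartAt I x).symm z) := by
    filter_upwards [(isOpen_extChartAt_target x).mem_nhds hz] with z hz
    rw [h.smoothFun_univ.fderiv_chartRep hz]
    exact (inner_sharp _ _ _).symm
  rw [h2.fderiv_eq, fderiv_comp_symm hz (hsm.mdiffAt (symm_mem_source hz)), extChartAt_to_inv]
  -- The derivative of the coordinate field is paired with ∇f, which is zero at the critical point;
  -- no Christoffel term remains.
  have h3 := fieldDeriv_inner hu (h.smoothField_gradient (U := (chartAt H x).source)) hv hs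
  rw [h.covD_gradient, real_inner_smul_left,
    gradient_eq_zero_iff.mp (mvfderiv_eq_zero_iff.mp h0), inner_zero_left, add_zero] at h3
  exact h3

/-- Critical points at which the soliton factor does not vanish are isolated. -/
lemma eventually_mvfderiv_ne_zero (h : IsGradientYamabeSoliton I f ρ)
    (h0 : mvfderiv I f x = 0) (hφ : solitonFactor I ρ x ≠ 0) :
    ∀ᶠ z in 𝓝[≠] (extChartAt I x x), fderiv ℝ (chartRep I x f) z ≠ 0 := by
  obtain ⟨Q, hQ, hQv⟩ := h.hasFDerivAt_fderiv_chartRep h0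
  refine hQ.eventually_ne ?_
  -- Q is a nonzero multiple of a positive definite form, hence injective, and in finite dimension
  -- bounded below.
  have hker : (Q : E →ₗ[ℝ] E →L[ℝ] ℝ).ker = ⊥ := by
    rw [LinearMap.ker_eq_bot']
    intro u hu
    by_contra hne
    have h1 := hQv u u
    have h2 : Q u = 0 := hu
    rw [h2, zero_apply, eq_comm, mul_eq_zero, inner_self_eq_zero] at h1
    exact h1.elim hφ (coordField_ne_zero (mem_chart_source H x) hne)
  obtain ⟨K, -, hK⟩ := LinearMap.exists_antilipschitzWith _ hker
  exact ⟨K, hK⟩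

lemma eventually_regular (h : IsGradientYamabeSoliton I f ρ)
    (h0 : mvfderiv I f x = 0) (hφ : solitonFactor I ρ x ≠ 0) :
    ∀ᶠ y in 𝓝[≠] x, mvfderiv I f y ≠ 0 := by
  have h1 := h.eventually_mvfderiv_ne_zero h0 hφ
  rw [eventually_nhdsWithin_iff] at h1 ⊢
  have h2 := (continuousAt_extChartAt (I := I) x).eventually h1
  filter_upwards [h2, extChartAt_source_mem_nhds (I := I) x] with y hy hys hne h3
  refine hy (fun h4 ↦ hne ?_) (h.smoothFun_univ.mvfderiv_eq_zero_of_fderiv_chartRep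
    (by rwa [extChartAt_source] at hys) h3)
  exact (extChartAt I x).injOn hys (mem_extChartAt_source x) h4

end IsGradientYamabeSoliton

end RiemannianGeometry

end CriticalPoints

/-! ### Uniqueness of the minimum point on a component -/

section UniqueExtremum

set_option linter.unusedSectionVars false

namespace RiemannianGeometry

variable {E : Type*} [NormedAddCommGroup E] [NormedSpace ℝ E] [FiniteDimensional ℝ E]
  {H : Type*} [TopologicalSpace H] {I : ModelWithCorners ℝ E H}
  {M : Type*} [TopologicalSpace M] [ChartedSpace H M] [IsManifold I ∞ M]
  [RiemannianBundle (fun x : M ↦ TangentSpace I x)]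
  [IsContMDiffRiemannianBundle I ∞ E (fun x : M ↦ TangentSpace I x)]
  {f : M → ℝ} {ρ : ℝ} {x : M} [Nontrivial E] [I.Boundaryless]

lemma isClopen_connectedComponent_of_chartedSpace [LocallyPathConnectedSpace H] (x : M) :
    IsClopen (connectedComponent x) := by
  have : LocallyPathConnectedSpace M := ChartedSpace.locallyPathConnectedSpace H M
  exact ⟨isClosed_connectedComponent, isOpen_connectedComponent⟩

/-- A function on a compact connected manifold of dimension at least two whose critical points are
isolated minimum and maximum points has only one minimum point. -/
theorem eq_of_minimum [T2Space M] [CompactSpace M] [LocallyPathConnectedSpace H] {x₀ p q : M}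
    {m k : ℝ} (hf : SmoothFun I f Set.univ) (hE : 1 < Module.rank ℝ E)
    (hm : ∀ x ∈ connectedComponent x₀, m ≤ f x) (hk : ∀ x ∈ connectedComponent x₀, f x ≤ k)
    (hreg : ∀ x ∈ connectedComponent x₀, m < f x → f x < k → mvfderiv I f x ≠ 0)
    (hiso : ∀ x, mvfderiv I f x = 0 → x ∈ connectedComponent x₀ →
      ∀ᶠ y in 𝓝[≠] x, mvfderiv I f y ≠ 0)
    (hp : p ∈ connectedComponent x₀) (hq : q ∈ connectedComponent x₀)
    (hfp : f p = m) (hfq : f q = m) : p = q := by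
  have : LocallyPathConnectedSpace M := ChartedSpace.locallyPathConnectedSpace H M
  have hZ := isClopen_connectedComponent_of_chartedSpace (H := H) x₀
  have hfc : Continuous f := IsGradientYamabeSoliton.continuous_of_smoothFun hf
  have hd : ∀ x, MDiffAt f x := fun x ↦ hf.mdiffAt (Set.mem_univ x)
  have hmin : ∀ x ∈ connectedComponent x₀, f x = m → IsLocalMin f x := by
    intro x hx hfx
    filter_upwards [hZ.isOpen.mem_nhds hx] with y hy
    rw [hfx]
    exact hm y hy
  have hmax : ∀ x ∈ connectedComponent x₀, f x = k → IsLocalMax f x := by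
    intro x hx hfx
    filter_upwards [hZ.isOpen.mem_nhds hx] with y hy
    rw [hfx]
    exact hk y hy
  -- Above the minimal level a point is regular or an isolated maximum, and both local models have
  -- connected strict sublevel sets.
  have hboth : ∀ x ∈ connectedComponent x₀, m < f x →
      (∃ N ∈ 𝓝 x, IsPreconnected (N ∩ {y | f y < f x})) ∧ x ∈ closure {y | f y < f x} := by
    intro x hx hfx
    rcases (hk x hx).lt_or_eq with hlt | heq
    · exact ⟨hf.exists_isPreconnected_sublevel (hreg x hx hfx hlt),
        hf.mem_closure_sublevel (hreg x hx hfx hlt)⟩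
    · refine exists_isPreconnected_sublevel_of_isLocalMax I hE (hmax x hx heq) ?_
      have h1 := hiso x (mvfderiv_eq_zero_of_isLocalMax (hd x) (hmax x hx heq)) hx
      filter_upwards [h1, mem_nhdsWithin_of_mem_nhds (hZ.isOpen.mem_nhds hx)] with y hy hyZ h2
      exact hy (mvfderiv_eq_zero_of_isLocalMax (hd y) (hmax y hyZ (h2.trans heq)))
  refine eq_of_minimum_of_locally_connected_sublevel hfc hZ isPreconnected_connectedComponent hm
    (fun x hx h ↦ (hboth x hx h).1) (fun x hx h ↦ (hboth x hx h).2) (fun x hx hfx ↦ ?_)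
    hp hq hfp hfq
  have h1 := hiso x (mvfderiv_eq_zero_of_isLocalMin (hd x) (hmin x hx hfx)) hx
  filter_upwards [h1, mem_nhdsWithin_of_mem_nhds (hZ.isOpen.mem_nhds hx)] with y hy hyZ h2
  exact hy (mvfderiv_eq_zero_of_isLocalMin (hd y) (hmin y hyZ h2))

end RiemannianGeometry

end UniqueExtremum

/-! ### The area density of a chart and the divergence of ∇f -/

section ChartDensity

set_option linter.unusedSectionVars false

namespace RiemannianGeometry

variable {E : Type*} [NormedAddCommGroup E] [NormedSpace ℝ E] [FiniteDimensional ℝ E]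
  {H : Type*} [TopologicalSpace H] {I : ModelWithCorners ℝ E H}
  {M : Type*} [TopologicalSpace M] [ChartedSpace H M] [IsManifold I ∞ M]
  [RiemannianBundle (fun x : M ↦ TangentSpace I x)]
  [IsContMDiffRiemannianBundle I ∞ E (fun x : M ↦ TangentSpace I x)]
  {f u : M → ℝ} {ρ : ℝ} {x₀ y : M} [Nontrivial E] {b : Module.Basis (Fin 2) ℝ E}

/-- The Gram determinant of the coordinate fields of the chart at `x₀`. -/
noncomputable def gramDet (I : ModelWithCorners ℝ E H) {M : Type*} [TopologicalSpace M]
    [ChartedSpace H M] [IsManifold I ∞ M] [RiemannianBundle (fun x : M ↦ TangentSpace I x)]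
    (b : Module.Basis (Fin 2) ℝ E) (x₀ y : M) : ℝ :=
  (Matrix.gram ℝ fun i ↦ coordField I x₀ (b i) y).det

/-- The Riemannian area density in the chart at `x₀`. -/
noncomputable def areaDensity (I : ModelWithCorners ℝ E H) {M : Type*} [TopologicalSpace M]
    [ChartedSpace H M] [IsManifold I ∞ M] [RiemannianBundle (fun x : M ↦ TangentSpace I x)]
    (b : Module.Basis (Fin 2) ℝ E) (x₀ y : M) : ℝ :=
  √(gramDet I b x₀ y)

lemma linearIndependent_coordField (hy : y ∈ (chartAt H x₀).source) :
    LinearIndependent ℝ fun i ↦ coordField I x₀ (b i) y := by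
  have h1 : ((coordDiff I x₀ y : TangentSpace I y →ₗ[ℝ] E) ∘ fun i ↦ coordField I x₀ (b i) y) = b :=
    funext fun i ↦ coordDiff_coordField hy
  exact LinearIndependent.of_comp _ (h1 ▸ b.linearIndependent)

lemma det_gram_pos {V : Type*} [NormedAddCommGroup V] [InnerProductSpace ℝ V] {v : Fin 2 → V}
    (hv : LinearIndependent ℝ v) : 0 < (Matrix.gram ℝ v).det :=
  (Matrix.posDef_gram_of_linearIndependent hv).det_pos

lemma gramDet_pos (hy : y ∈ (chartAt H x₀).source) : 0 < gramDet I b x₀ y :=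
  det_gram_pos (V := TangentSpace I y) (linearIndependent_coordField hy)

lemma areaDensity_pos (hy : y ∈ (chartAt H x₀).source) : 0 < areaDensity I b x₀ y :=
  Real.sqrt_pos.mpr (gramDet_pos hy)

/-- The metric coefficients in the chart at `x₀`. -/
noncomputable def metricCoeff (I : ModelWithCorners ℝ E H) {M : Type*} [TopologicalSpace M]
    [ChartedSpace H M] [IsManifold I ∞ M] [RiemannianBundle (fun x : M ↦ TangentSpace I x)]
    (b : Module.Basis (Fin 2) ℝ E) (x₀ : M) (i j : Fin 2) (y : M) : ℝ :=
  inner ℝ (coordField I x₀ (b i) y) (coordField I x₀ (b j) y)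

lemma smoothFun_metricCoeff (i j : Fin 2) :
    SmoothFun I (metricCoeff I b x₀ i j) (chartAt H x₀).source :=
  smoothField_coordField.innerFun smoothField_coordField

lemma gramDet_eq : gramDet I b x₀ =
    metricCoeff I b x₀ 0 0 * metricCoeff I b x₀ 1 1
      - metricCoeff I b x₀ 0 1 * metricCoeff I b x₀ 1 0 := by
  funext y
  rw [gramDet, Matrix.det_fin_two]
  rfl

lemma metricCoeff_comm (i j : Fin 2) : metricCoeff I b x₀ i j y = metricCoeff I b x₀ j i y :=
  real_inner_comm _ _

lemma smoothFun_gramDet : SmoothFun I (gramDet I b x₀) (chartAt H x₀).source := by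
  rw [gramDet_eq]
  exact ((smoothFun_metricCoeff 0 0).mul (smoothFun_metricCoeff 1 1)).sub
    ((smoothFun_metricCoeff 0 1).mul (smoothFun_metricCoeff 1 0))

lemma smoothFun_areaDensity : SmoothFun I (areaDensity I b x₀) (chartAt H x₀).source :=
  smoothFun_gramDet.comp (k := Real.sqrt) fun _ hy ↦ Real.contDiffAt_sqrt (gramDet_pos hy).ne'

variable (f) in
/-- The components of the gradient in the chart at `x₀`. -/
noncomputable def gradCoord (I : ModelWithCorners ℝ E H) {M : Type*} [TopologicalSpace M]
    [ChartedSpace H M] [IsManifold I ∞ M] [RiemannianBundle (fun x : M ↦ TangentSpace I x)]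
    (b : Module.Basis (Fin 2) ℝ E) (x₀ : M) (f : M → ℝ) (i : Fin 2) (y : M) : ℝ :=
  b.coord i (coordDiff I x₀ y (riemannianGradient I f y))

lemma fieldDeriv_coord (X : Π x : M, TangentSpace I x) (i : Fin 2)
    (hy : y ∈ (chartAt H x₀).source) :
    fieldDeriv I X (fun y ↦ b.coord i (extChartAt I x₀ y)) y =
      b.coord i (coordDiff I x₀ y (X y)) :=
  mvfderiv_coord (LinearMap.toContinuousLinearMap (b.coord i)) hy (X y)

lemma smoothFun_coord_basis (i : Fin 2) :
    SmoothFun I (fun y ↦ b.coord i (extChartAt I x₀ y)) (chartAt H x₀).source :=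
  smoothFun_coord (LinearMap.toContinuousLinearMap (b.coord i))

/-- A tangent vector in terms of the coordinate fields. -/
lemma eq_sum_coordField (hy : y ∈ (chartAt H x₀).source) (v : TangentSpace I y) :
    v = ∑ i, b.coord i (coordDiff I x₀ y v) • coordField I x₀ (b i) y := by
  conv_lhs => rw [← coordField_coordDiff hy v, ← b.sum_repr (coordDiff I x₀ y v)]
  rw [coordField_sum]
  exact Finset.sum_congr rfl fun i _ ↦ coordField_smul _

namespace IsGradientYamabeSoliton

lemma smoothFun_gradCoord (h : IsGradientYamabeSoliton I f ρ) (i : Fin 2) :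
    SmoothFun I (gradCoord I b x₀ f i) (chartAt H x₀).source := by
  have hU := (chartAt H x₀).open_source
  refine SmoothFun.congr (SmoothField.fieldDeriv hU (h.smoothField_gradient)
    (smoothFun_coord_basis (b := b) i)) hU fun y hy ↦ ?_
  exact (fieldDeriv_coord _ i hy).symm

/-- The bracket of the gradient with a coordinate field. -/
lemma bracket_coordField (h : IsGradientYamabeSoliton I f ρ) (hy : y ∈ (chartAt H x₀).source)
    (v : E) :
    VectorField.mlieBracket I (riemannianGradient I f) (coordField I x₀ v) y =
      -∑ i, fieldDeriv I (coordField I x₀ v) (gradCoord I b x₀ f i) y •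
        coordField I x₀ (b i) y := by
  have hU := (chartAt H x₀).open_source
  rw [eq_sum_coordField (b := b) hy
    (VectorField.mlieBracket I (riemannianGradient I f) (coordField I x₀ v) y),
    ← Finset.sum_neg_distrib]
  refine Finset.sum_congr rfl fun i _ ↦ ?_
  rw [← neg_smul]
  congr 1
  -- The components of the bracket are found by applying it to the coordinate functions, whose
  -- derivatives along a coordinate field are constant.
  have h1 := fieldDeriv_comm hU (h.smoothField_gradient (U := (chartAt H x₀).source))
    (smoothField_coordField (x₀ := x₀) (v := v)) (smoothFun_coord_basis (b := b) i) hy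
  rw [fieldDeriv_coord _ i hy] at h1
  rw [← h1]
  have h2 : ∀ y ∈ (chartAt H x₀).source, fieldDeriv I (coordField I x₀ v)
      (fun y ↦ b.coord i (extChartAt I x₀ y)) y = (fun _ ↦ b.coord i v : M → ℝ) y := by
    intro y hy
    rw [fieldDeriv_coord _ i hy, coordDiff_coordField hy]
  have h3 : ∀ y ∈ (chartAt H x₀).source, fieldDeriv I (riemannianGradient I f)
      (fun y ↦ b.coord i (extChartAt I x₀ y)) y = gradCoord I b x₀ f i y :=
    fun y hy ↦ fieldDeriv_coord _ i hy
  rw [fieldDeriv_congr hU hy h2, fieldDeriv_const, fieldDeriv_congr hU hy h3, zero_sub]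

/-- The conformal equation L_X g = 2φ g for X = ∇f, in coordinates; the two sums come from the
brackets of X with the coordinate fields. -/
lemma fieldDeriv_metricCoeff (h : IsGradientYamabeSoliton I f ρ)
    (hy : y ∈ (chartAt H x₀).source) (i j : Fin 2) :
    fieldDeriv I (riemannianGradient I f) (metricCoeff I b x₀ i j) y =
      2 * solitonFactor I ρ y * metricCoeff I b x₀ i j y
      - (∑ k, fieldDeriv I (coordField I x₀ (b i)) (gradCoord I b x₀ f k) y *
          metricCoeff I b x₀ k j y)
      - ∑ k, fieldDeriv I (coordField I x₀ (b j)) (gradCoord I b x₀ f k) y *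
          metricCoeff I b x₀ i k y := by
  have hc : ∀ v, SmoothField I (coordField I x₀ v) (chartAt H x₀).source :=
    fun v ↦ smoothField_coordField
  have hcov : ∀ v, covD (riemannianGradient I f) (coordField I x₀ v) y =
      solitonFactor I ρ y • coordField I x₀ v y
        - ∑ i, fieldDeriv I (coordField I x₀ v) (gradCoord I b x₀ f i) y •
        coordField I x₀ (b i) y := by
    intro v
    have h1 := h.bracket_gradient (hc v) hy
    rw [h.bracket_coordField (b := b) hy] at h1
    rw [sub_eq_add_neg, h1, add_sub_cancel]
  have h1 := fieldDeriv_inner (h.smoothField_gradient (U := (chartAt H x₀).source))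
    (hc (b i)) (hc (b j)) hy
  rw [hcov, hcov, inner_sub_left, inner_sub_right, sum_inner, inner_sum] at h1
  simp only [real_inner_smul_left, real_inner_smul_right] at h1
  refine h1.trans ?_
  simp only [metricCoeff]
  ring

/-- The divergence of the gradient with respect to the coordinate measure of a chart. -/
lemma fieldDeriv_areaDensity (h : IsGradientYamabeSoliton I f ρ)
    (hy : y ∈ (chartAt H x₀).source) :
    fieldDeriv I (riemannianGradient I f) (areaDensity I b x₀) y =
      (2 * solitonFactor I ρ y
        - ∑ k, fieldDeriv I (coordField I x₀ (b k)) (gradCoord I b x₀ f k) y)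
      * areaDensity I b x₀ y := by
  have h0 := gramDet_pos (I := I) (b := b) hy
  -- The trace in the derivative of a determinant: the conformal part contributes 4φ and each of the
  -- two bracket sums one coordinate divergence. The square root then halves the factor.
  have h1 : fieldDeriv I (riemannianGradient I f) (gramDet I b x₀) y =
      2 * (2 * solitonFactor I ρ y
        - ∑ k, fieldDeriv I (coordField I x₀ (b k)) (gradCoord I b x₀ f k) y)
      * gramDet I b x₀ y := by
    rw [gramDet_eq]
    have s := fun i j : Fin 2 ↦ smoothFun_metricCoeff (I := I) (b := b) (x₀ := x₀) i j
    rw [fieldDeriv_sub_fun ((s 0 0).mul (s 1 1)) ((s 0 1).mul (s 1 0)) hy,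
      fieldDeriv_mul_fun (s 0 0) (s 1 1) hy, fieldDeriv_mul_fun (s 0 1) (s 1 0) hy,
      h.fieldDeriv_metricCoeff hy, h.fieldDeriv_metricCoeff hy, h.fieldDeriv_metricCoeff hy,
      h.fieldDeriv_metricCoeff hy]
    simp only [Fin.sum_univ_two, Pi.sub_apply, Pi.mul_apply, metricCoeff_comm (y := y) 1 0]
    ring
  have h2 := fieldDeriv_comp_real (X := riemannianGradient I f) (k := Real.sqrt)
    (smoothFun_gramDet (b := b)) hy (Real.hasDerivAt_sqrt h0.ne')
  refine h2.trans ?_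
  rw [h1]
  have h3 : gramDet I b x₀ y = areaDensity I b x₀ y * areaDensity I b x₀ y :=
    (Real.mul_self_sqrt h0.le).symm
  have h4 : √(gramDet I b x₀ y) = areaDensity I b x₀ y := rfl
  have h5 := (areaDensity_pos (I := I) (b := b) hy).ne'
  rw [h4, h3]
  field_simp

/-- `(∇f(u) + 2 φ u)` times the area density is a coordinate divergence. -/
lemma sum_fieldDeriv_gradCoord (h : IsGradientYamabeSoliton I f ρ)
    (hy : y ∈ (chartAt H x₀).source) (hu : SmoothFun I u Set.univ) :
    ∑ k, fieldDeriv I (coordField I x₀ (b k))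
        (gradCoord I b x₀ f k * (u * areaDensity I b x₀)) y =
      (fieldDeriv I (riemannianGradient I f) u y + 2 * solitonFactor I ρ y * u y)
        * areaDensity I b x₀ y := by
  have hu' := hu.mono (Set.subset_univ (chartAt H x₀).source)
  have hD := smoothFun_areaDensity (I := I) (b := b) (x₀ := x₀)
  have h1 : ∀ k, fieldDeriv I (coordField I x₀ (b k))
        (gradCoord I b x₀ f k * (u * areaDensity I b x₀)) y =
      gradCoord I b x₀ f k y * mvfderiv I (u * areaDensity I b x₀) y (coordField I x₀ (b k) y)
      + u y * areaDensity I b x₀ y *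
        fieldDeriv I (coordField I x₀ (b k)) (gradCoord I b x₀ f k) y := fun k ↦
    fieldDeriv_mul_fun (h.smoothFun_gradCoord k) (hu'.mul hD) hy
  have h2 : fieldDeriv I (riemannianGradient I f) (u * areaDensity I b x₀) y =
      ∑ k, gradCoord I b x₀ f k y *
        mvfderiv I (u * areaDensity I b x₀) y (coordField I x₀ (b k) y) := by
    rw [fieldDeriv]
    conv_lhs => rw [eq_sum_coordField (b := b) hy (riemannianGradient I f y)]
    rw [map_sum]
    exact Finset.sum_congr rfl fun i _ ↦ map_smul _ _ _
  rw [Finset.sum_congr rfl fun k _ ↦ h1 k, Finset.sum_add_distrib, ← h2, ← Finset.mul_sum,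
    fieldDeriv_mul_fun hu' hD hy, h.fieldDeriv_areaDensity hy]
  ring

end IsGradientYamabeSoliton

end RiemannianGeometry

end ChartDensity

/-! ### Integration in a chart and change of chart -/

section ChartIntegral

set_option linter.unusedSectionVars false

namespace RiemannianGeometry

open MeasureTheory

variable {E : Type*} [NormedAddCommGroup E] [NormedSpace ℝ E] [FiniteDimensional ℝ E]
  {H : Type*} [TopologicalSpace H] {I : ModelWithCorners ℝ E H}
  {M : Type*} [TopologicalSpace M] [ChartedSpace H M] [IsManifold I ∞ M]

section Pull

variable {G : M → ℝ} {x₀ : M} {K : Set M}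

/-- A function on `M` read in the chart at `x₀`, extended by zero. -/
noncomputable def chartPull (I : ModelWithCorners ℝ E H) (x₀ : M) (G : M → ℝ) : E → ℝ :=
  (extChartAt I x₀).target.indicator fun z ↦ G ((extChartAt I x₀).symm z)

lemma chartPull_of_mem {z : E} (hz : z ∈ (extChartAt I x₀).target) :
    chartPull I x₀ G z = G ((extChartAt I x₀).symm z) := Set.indicator_of_mem hz _

lemma chartPull_of_notMem {z : E} (hz : z ∉ (extChartAt I x₀).target) :
    chartPull I x₀ G z = 0 := Set.indicator_of_notMem hz _

lemma isCompact_extChartAt_image (hK : IsCompact K) (hKs : K ⊆ (chartAt H x₀).source) :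
    IsCompact (extChartAt I x₀ '' K) :=
  hK.image_of_continuousOn ((continuousOn_extChartAt x₀).mono (by rwa [extChartAt_source]))

lemma extChartAt_image_subset_target (hKs : K ⊆ (chartAt H x₀).source) :
    extChartAt I x₀ '' K ⊆ (extChartAt I x₀).target := by
  rintro _ ⟨y, hy, rfl⟩
  exact (extChartAt I x₀).map_source (by rw [extChartAt_source]; exact hKs hy)

lemma chartPull_eq_zero (h0 : ∀ y ∉ K, G y = 0) {z : E} (hz : z ∉ extChartAt I x₀ '' K) :
    chartPull I x₀ G z = 0 := by
  by_cases hzt : z ∈ (extChartAt I x₀).target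
  · rw [chartPull_of_mem hzt]
    refine h0 _ fun hy ↦ hz ⟨_, hy, (extChartAt I x₀).right_inv hzt⟩
  · exact chartPull_of_notMem hzt

lemma chartPull_eventuallyEq_zero (hK : IsCompact K) (hKs : K ⊆ (chartAt H x₀).source)
    (h0 : ∀ y ∉ K, G y = 0) {z : E} (hz : z ∉ extChartAt I x₀ '' K) :
    chartPull I x₀ G =ᶠ[𝓝 z] fun _ ↦ 0 := by
  filter_upwards [(isCompact_extChartAt_image hK hKs).isClosed.isOpen_compl.mem_nhds hz] with w hw
  exact chartPull_eq_zero h0 hw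

lemma hasCompactSupport_chartPull (hK : IsCompact K) (hKs : K ⊆ (chartAt H x₀).source)
    (h0 : ∀ y ∉ K, G y = 0) : HasCompactSupport (chartPull I x₀ G) :=
  HasCompactSupport.intro (isCompact_extChartAt_image hK hKs) fun _ hz ↦ chartPull_eq_zero h0 hz

variable [I.Boundaryless]

lemma chartPull_eventuallyEq {z : E} (hz : z ∈ (extChartAt I x₀).target) :
    chartPull I x₀ G =ᶠ[𝓝 z] fun z ↦ G ((extChartAt I x₀).symm z) := by
  filter_upwards [(isOpen_extChartAt_target x₀).mem_nhds hz] with w hw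
  exact chartPull_of_mem hw

lemma contDiff_chartPull (hG : SmoothFun I G (chartAt H x₀).source) (hK : IsCompact K)
    (hKs : K ⊆ (chartAt H x₀).source) (h0 : ∀ y ∉ K, G y = 0) :
    ContDiff ℝ ∞ (chartPull I x₀ G) := by
  rw [contDiff_iff_contDiffAt]
  intro z
  by_cases hz : z ∈ (extChartAt I x₀).target
  · exact (hG.contDiffAt_comp_symm hz (symm_mem_source hz)).congr_of_eventuallyEq
      (chartPull_eventuallyEq hz)
  · exact contDiffAt_const.congr_of_eventuallyEq (chartPull_eventuallyEq_zero hK hKs h0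
      fun h ↦ hz (extChartAt_image_subset_target hKs h))

lemma continuous_chartPull (hG : ContinuousOn G (chartAt H x₀).source) (hK : IsCompact K)
    (hKs : K ⊆ (chartAt H x₀).source) (h0 : ∀ y ∉ K, G y = 0) :
    Continuous (chartPull I x₀ G) := by
  rw [continuous_iff_continuousAt]
  intro z
  by_cases hz : z ∈ (extChartAt I x₀).target
  · refine ContinuousAt.congr ?_ (chartPull_eventuallyEq hz).symm
    have h1 : ContinuousAt (extChartAt I x₀).symm z :=
      (continuousOn_extChartAt_symm x₀).continuousAt ((isOpen_extChartAt_target x₀).mem_nhds hz)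
    exact ContinuousAt.comp (g := G) (hG.continuousAt
      ((chartAt H x₀).open_source.mem_nhds (symm_mem_source hz))) h1
  · exact continuousAt_const.congr (chartPull_eventuallyEq_zero hK hKs h0
      fun h ↦ hz (extChartAt_image_subset_target hKs h)).symm

lemma fderiv_chartPull (hG : SmoothFun I G (chartAt H x₀).source) {z : E}
    (hz : z ∈ (extChartAt I x₀).target) (v : E) :
    fderiv ℝ (chartPull I x₀ G) z v = fieldDeriv I (coordField I x₀ v) G
      ((extChartAt I x₀).symm z) := by
  rw [(chartPull_eventuallyEq hz).fderiv_eq, fderiv_comp_symm hz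
    (hG.mdiffAt (symm_mem_source hz))]
  rfl

variable [MeasurableSpace E] [BorelSpace E] (μ : Measure E) [μ.IsAddHaarMeasure]

/-- Integration by parts against the constant 1. -/
lemma integral_fderiv_eq_zero {g : E → ℝ} (hg : ContDiff ℝ 1 g) (hc : HasCompactSupport g)
    (v : E) : ∫ z, fderiv ℝ g z v ∂μ = 0 := by
  have h1 : Integrable (fun z ↦ fderiv ℝ g z v) μ :=
    ((hg.continuous_fderiv (by simp)).clm_apply continuous_const).integrable_of_hasCompactSupport
      (hc.fderiv_apply ℝ v)
  have h2 := integral_mul_fderiv_eq_neg_fderiv_mul_of_integrable (μ := μ) (f := fun _ : E ↦ (1 : ℝ))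
    (g := g) (v := v) (by simp) (by simpa using h1)
    (by simpa using hg.continuous.integrable_of_hasCompactSupport hc)
    (fun _ _ ↦ differentiableAt_const _) (fun z _ ↦ hg.differentiable (by simp) z)
  simpa using h2

lemma setIntegral_fieldDeriv_coordField (hG : SmoothFun I G (chartAt H x₀).source)
    (hK : IsCompact K) (hKs : K ⊆ (chartAt H x₀).source) (h0 : ∀ y ∉ K, G y = 0) (v : E) :
    IntegrableOn (fun z ↦ fieldDeriv I (coordField I x₀ v) G ((extChartAt I x₀).symm z))
      (extChartAt I x₀).target μ ∧
    ∫ z in (extChartAt I x₀).target,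
      fieldDeriv I (coordField I x₀ v) G ((extChartAt I x₀).symm z) ∂μ = 0 := by
  have hg := (contDiff_chartPull hG hK hKs h0).of_le (m := 1) (by simp)
  have hc := hasCompactSupport_chartPull hK hKs h0 (I := I)
  have hm : MeasurableSet (extChartAt I x₀).target := (isOpen_extChartAt_target x₀).measurableSet
  have h1 : Integrable (fun z ↦ fderiv ℝ (chartPull I x₀ G) z v) μ :=
    ((hg.continuous_fderiv (by simp)).clm_apply continuous_const).integrable_of_hasCompactSupport
      (hc.fderiv_apply ℝ v)
  constructor
  · exact (h1.integrableOn (s := (extChartAt I x₀).target)).congr_fun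
      (fun z hz ↦ fderiv_chartPull hG hz v) hm
  · have h2 := setIntegral_eq_integral_of_forall_compl_eq_zero (μ := μ)
      (s := (extChartAt I x₀).target) (f := fun z ↦ fderiv ℝ (chartPull I x₀ G) z v) ?_
    · rw [integral_fderiv_eq_zero μ hg hc v] at h2
      rw [← h2]
      exact setIntegral_congr_fun hm fun z hz ↦ (fderiv_chartPull hG hz v).symm
    · intro z hz
      rw [(chartPull_eventuallyEq_zero hK hKs h0
        fun h ↦ hz (extChartAt_image_subset_target hKs h)).fderiv_eq]
      simp

end Pull

variable [RiemannianBundle (fun x : M ↦ TangentSpace I x)]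
  [IsContMDiffRiemannianBundle I ∞ E (fun x : M ↦ TangentSpace I x)]
  {f u u' : M → ℝ} {ρ : ℝ} {x₀ x₁ y : M} [Nontrivial E] [I.Boundaryless]
  [MeasurableSpace E] [BorelSpace E]

/-- The integral, with respect to the Riemannian area, of a function supported in the domain of the
chart at `x₀`. -/
noncomputable def chartIntegral (I : ModelWithCorners ℝ E H) {M : Type*} [TopologicalSpace M]
    [ChartedSpace H M] [IsManifold I ∞ M] [RiemannianBundle (fun x : M ↦ TangentSpace I x)]
    (b : Module.Basis (Fin 2) ℝ E) (μ : Measure E) (x₀ : M) (u : M → ℝ) : ℝ :=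
  ∫ z in (extChartAt I x₀).target, u ((extChartAt I x₀).symm z) *
    areaDensity I b x₀ ((extChartAt I x₀).symm z) ∂μ

variable {b : Module.Basis (Fin 2) ℝ E} {μ : Measure E} [μ.IsAddHaarMeasure]

lemma integrableOn_chartIntegral [CompactSpace M] (hu : Continuous u)
    (hs : tsupport u ⊆ (chartAt H x₀).source) :
    IntegrableOn (fun z ↦ u ((extChartAt I x₀).symm z) *
      areaDensity I b x₀ ((extChartAt I x₀).symm z)) (extChartAt I x₀).target μ := by
  have hK : IsCompact (tsupport u) := (isClosed_tsupport u).isCompact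
  have h0 : ∀ y ∉ tsupport u, (u * areaDensity I b x₀) y = 0 := fun y hy ↦ by
    simp [image_eq_zero_of_notMem_tsupport hy]
  have hc : ContinuousOn (u * areaDensity I b x₀) (chartAt H x₀).source :=
    hu.continuousOn.mul fun y hy ↦ ((smoothFun_areaDensity y hy).continuousAt).continuousWithinAt
  have h1 := (continuous_chartPull (I := I) hc hK hs h0).integrable_of_hasCompactSupport (μ := μ)
    (hasCompactSupport_chartPull hK hs h0)
  exact (h1.integrableOn (s := (extChartAt I x₀).target)).congr_fun
    (fun z hz ↦ chartPull_of_mem hz) (isOpen_extChartAt_target x₀).measurableSet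

lemma chartIntegral_add [CompactSpace M] (hu : Continuous u) (hu' : Continuous u')
    (hs : tsupport u ⊆ (chartAt H x₀).source) (hs' : tsupport u' ⊆ (chartAt H x₀).source) :
    chartIntegral I b μ x₀ (u + u') = chartIntegral I b μ x₀ u + chartIntegral I b μ x₀ u' := by
  rw [chartIntegral, chartIntegral, chartIntegral, ← integral_add
    (integrableOn_chartIntegral hu hs) (integrableOn_chartIntegral hu' hs')]
  exact integral_congr_ae (Filter.Eventually.of_forall fun z ↦ add_mul _ _ _)

lemma chartIntegral_neg : chartIntegral I b μ x₀ (-u) = -chartIntegral I b μ x₀ u := by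
  rw [chartIntegral, chartIntegral, ← integral_neg]
  exact integral_congr_ae (Filter.Eventually.of_forall fun z ↦ neg_mul _ _)

lemma chartIntegral_zero : chartIntegral I b μ x₀ (0 : M → ℝ) = 0 := by
  simp [chartIntegral]

/-- The divergence theorem for `u ∇f`, with `u` supported in the domain of a chart. -/
lemma IsGradientYamabeSoliton.chartIntegral_eq_zero [CompactSpace M]
    (h : IsGradientYamabeSoliton I f ρ) (hu : SmoothFun I u Set.univ)
    (hs : tsupport u ⊆ (chartAt H x₀).source) :
    chartIntegral I b μ x₀ (fun y ↦ fieldDeriv I (riemannianGradient I f) u y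
      + 2 * solitonFactor I ρ y * u y) = 0 := by
  have hK : IsCompact (tsupport u) := (isClosed_tsupport u).isCompact
  have hG : ∀ k, SmoothFun I (gradCoord I b x₀ f k * (u * areaDensity I b x₀))
      (chartAt H x₀).source := fun k ↦
    (h.smoothFun_gradCoord k).mul ((hu.mono (Set.subset_univ _)).mul smoothFun_areaDensity)
  have h0 : ∀ k, ∀ y ∉ tsupport u,
      (gradCoord I b x₀ f k * (u * areaDensity I b x₀)) y = 0 := fun k y hy ↦ by
    simp [image_eq_zero_of_notMem_tsupport hy]
  have hk := fun k ↦ setIntegral_fieldDeriv_coordField μ (hG k) hK hs (h0 k) (b k)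
  have h1 : chartIntegral I b μ x₀ (fun y ↦ fieldDeriv I (riemannianGradient I f) u y
      + 2 * solitonFactor I ρ y * u y) =
      ∫ z in (extChartAt I x₀).target, ∑ k, fieldDeriv I (coordField I x₀ (b k))
        (gradCoord I b x₀ f k * (u * areaDensity I b x₀)) ((extChartAt I x₀).symm z) ∂μ :=
    setIntegral_congr_fun (isOpen_extChartAt_target x₀).measurableSet
      fun z hz ↦ (h.sum_fieldDeriv_gradCoord (symm_mem_source hz) hu).symm
  rw [h1, integral_finsetSum _ fun k _ ↦ (hk k).1]
  exact Finset.sum_eq_zero fun k _ ↦ (hk k).2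

section Change

lemma hasFDerivAt_chartChange {z : E} (hz : z ∈ (extChartAt I x₀).target)
    (hz' : (extChartAt I x₀).symm z ∈ (chartAt H x₁).source) :
    HasFDerivAt (fun z ↦ extChartAt I x₁ ((extChartAt I x₀).symm z))
      ((coordDiff I x₁ ((extChartAt I x₀).symm z)).comp
        ((trivializationAt E (TangentSpace I : M → Type _) x₀).symmL ℝ
          ((extChartAt I x₀).symm z))) z := by
  have h1 := mdifferentiableWithinAt_extChartAt_symm hz
  rw [I.range_eq_univ, mdifferentiableWithinAt_univ] at h1
  have h0 : MDiffAt (extChartAt I x₁) ((extChartAt I x₀).symm z) := mdifferentiableAt_extChartAt hz'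
  have h3 := (h0.hasMFDerivAt.comp z h1.hasMFDerivAt).hasFDerivAt
  have h4 := TangentBundle.symmL_trivializationAt (I := I) (𝕜 := ℝ) (symm_mem_source hz)
  rw [(extChartAt I x₀).right_inv hz, I.range_eq_univ, mfderivWithin_univ] at h4
  rw [h4]
  exact h3

lemma gram_sum_smul {V : Type*} [NormedAddCommGroup V] [InnerProductSpace ℝ V]
    (w : Fin 2 → V) (A : Matrix (Fin 2) (Fin 2) ℝ) :
    Matrix.gram ℝ (fun i ↦ ∑ k, A k i • w k) = A.transpose * Matrix.gram ℝ w * A := by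
  ext i j
  simp only [Matrix.gram_apply, Matrix.mul_apply, sum_inner, inner_sum, real_inner_smul_left,
    real_inner_smul_right, Matrix.transpose_apply, Finset.sum_mul]
  exact Finset.sum_congr rfl fun k _ ↦ Finset.sum_congr rfl fun l _ ↦ by ring

/-- A change of coordinate frame by A replaces the Gram matrix by its congruence AᵀGA, so the
density is multiplied by |det A|, the Jacobian of the transition map. -/
lemma areaDensity_eq (hy₁ : y ∈ (chartAt H x₁).source) :
    areaDensity I b x₀ y = |((coordDiff I x₁ y).comp
      ((trivializationAt E (TangentSpace I : M → Type _) x₀).symmL ℝ y)).det| *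
        areaDensity I b x₁ y := by
  set A : E →L[ℝ] E := (coordDiff I x₁ y).comp
      ((trivializationAt E (TangentSpace I : M → Type _) x₀).symmL ℝ y) with hA
  have h1 : ∀ i, coordField I x₀ (b i) y =
      ∑ k, LinearMap.toMatrix b b (A : E →ₗ[ℝ] E) k i • coordField I x₁ (b k) y := by
    intro i
    rw [eq_sum_coordField (b := b) hy₁ (coordField I x₀ (b i) y)]
    refine Finset.sum_congr rfl fun k _ ↦ ?_
    rw [LinearMap.toMatrix_apply]
    rfl
  have h2 : gramDet I b x₀ y = A.det ^ 2 * gramDet I b x₁ y := by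
    rw [gramDet, funext h1]
    rw [gram_sum_smul (V := TangentSpace I y), Matrix.det_mul, Matrix.det_mul,
      Matrix.det_transpose, LinearMap.det_toMatrix, gramDet, ContinuousLinearMap.det]
    ring
  rw [areaDensity, h2, Real.sqrt_mul (sq_nonneg _), Real.sqrt_sq_eq_abs]
  rfl

/-- The integral does not depend on the chart. -/
lemma chartIntegral_eq_chartIntegral
    (hu : ∀ y, u y ≠ 0 → y ∈ (chartAt H x₀).source ∩ (chartAt H x₁).source) :
    chartIntegral I b μ x₀ u = chartIntegral I b μ x₁ u := by
  have hopen : ∀ x x' : M, IsOpen ((extChartAt I x).target ∩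
      (extChartAt I x).symm ⁻¹' (chartAt H x').source) := fun x x' ↦
    (continuousOn_extChartAt_symm x).isOpen_inter_preimage (isOpen_extChartAt_target x)
      (chartAt H x').open_source
  -- The integrand vanishes off the overlap of the two charts, to which both integrals are
  -- restricted before the change of variables.
  have hres : ∀ x x' : M, (∀ y, u y ≠ 0 → y ∈ (chartAt H x').source) →
      chartIntegral I b μ x u = ∫ z in (extChartAt I x).target ∩
        (extChartAt I x).symm ⁻¹' (chartAt H x').source, u ((extChartAt I x).symm z) *
        areaDensity I b x ((extChartAt I x).symm z) ∂μ := by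
    intro x x' hx
    have hm : MeasurableSet (extChartAt I x).target := (isOpen_extChartAt_target x).measurableSet
    refine setIntegral_eq_of_subset_of_forall_sdiff_eq_zero hm Set.inter_subset_left fun z hz ↦ ?_
    have : u ((extChartAt I x).symm z) = 0 := by
      by_contra hne
      exact hz.2 ⟨hz.1, hx _ hne⟩
    rw [this, zero_mul]
  rw [hres x₀ x₁ fun y hy ↦ (hu y hy).2, hres x₁ x₀ fun y hy ↦ (hu y hy).1]
  set S := (extChartAt I x₀).target ∩ (extChartAt I x₀).symm ⁻¹' (chartAt H x₁).source with hS
  have himage : (fun z ↦ extChartAt I x₁ ((extChartAt I x₀).symm z)) '' S =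
      (extChartAt I x₁).target ∩ (extChartAt I x₁).symm ⁻¹' (chartAt H x₀).source := by
    ext w
    constructor
    · rintro ⟨z, ⟨hz, hz'⟩, rfl⟩
      have hz1 : (extChartAt I x₀).symm z ∈ (extChartAt I x₁).source := by
        rw [extChartAt_source]; exact hz'
      refine ⟨(extChartAt I x₁).map_source hz1, ?_⟩
      rw [Set.mem_preimage, (extChartAt I x₁).left_inv hz1]
      exact symm_mem_source hz
    · rintro ⟨hw, hw'⟩
      have hw1 : (extChartAt I x₁).symm w ∈ (extChartAt I x₀).source := by
        rw [extChartAt_source]; exact hw'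
      refine ⟨extChartAt I x₀ ((extChartAt I x₁).symm w), ⟨(extChartAt I x₀).map_source hw1, ?_⟩, ?_⟩
      · rw [Set.mem_preimage, (extChartAt I x₀).left_inv hw1]
        exact symm_mem_source hw
      · simp only
        rw [(extChartAt I x₀).left_inv hw1, (extChartAt I x₁).right_inv hw]
  have hinj : Set.InjOn (fun z ↦ extChartAt I x₁ ((extChartAt I x₀).symm z)) S := by
    intro z hz w hw hzw
    have h1 : (extChartAt I x₀).symm z = (extChartAt I x₀).symm w :=
      (extChartAt I x₁).injOn (by rw [extChartAt_source]; exact hz.2)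
        (by rw [extChartAt_source]; exact hw.2) hzw
    rw [← (extChartAt I x₀).right_inv hz.1, h1, (extChartAt I x₀).right_inv hw.1]
  rw [← himage, integral_image_eq_integral_abs_det_fderiv_smul μ (hopen x₀ x₁).measurableSet
    (fun z hz ↦ (hasFDerivAt_chartChange hz.1 hz.2).hasFDerivWithinAt) hinj]
  refine setIntegral_congr_fun (hopen x₀ x₁).measurableSet fun z hz ↦ ?_
  rw [(extChartAt I x₁).left_inv (by rw [extChartAt_source]; exact hz.2),
    areaDensity_eq hz.2, smul_eq_mul]
  ring

end Change

end RiemannianGeometry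

end ChartIntegral

/-! ### Integration over the surface and the divergence theorem -/

section AreaFunctional

set_option linter.unusedSectionVars false

namespace RiemannianGeometry

open MeasureTheory

variable {E : Type*} [NormedAddCommGroup E] [NormedSpace ℝ E] [FiniteDimensional ℝ E]
  {H : Type*} [TopologicalSpace H] {I : ModelWithCorners ℝ E H}
  {M : Type*} [TopologicalSpace M] [ChartedSpace H M] [IsManifold I ∞ M]

variable (I M) in
/-- A finite smooth partition of unity subordinate to charts. -/
lemma exists_finite_partition [CompactSpace M] [T2Space M] :
    ∃ (s : Finset M) (χ : M → M → ℝ), (∀ i, SmoothFun I (χ i) Set.univ) ∧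
      (∀ i, tsupport (χ i) ⊆ (chartAt H i).source) ∧ ∀ y, ∑ i ∈ s, χ i y = 1 := by
  obtain ⟨χ, hχ⟩ := SmoothPartitionOfUnity.exists_isSubordinate_chartAt_source I M
  have hfin := χ.locallyFinite.finite_nonempty_of_compact
  refine ⟨hfin.toFinset, fun i ↦ χ i, fun i y _ ↦ (χ i).contMDiff y, hχ, fun y ↦ ?_⟩
  rw [← χ.sum_eq_one (Set.mem_univ y)]
  refine (finsum_eq_sum_of_support_subset _ fun i hi ↦ ?_).symm
  simp only [Set.Finite.coe_toFinset]
  exact ⟨y, hi⟩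

lemma tsupport_subset_of_forall {u v : M → ℝ} (h : ∀ y ∉ tsupport v, u y = 0) :
    tsupport u ⊆ tsupport v :=
  closure_minimal (fun y hy ↦ by_contra fun hy' ↦ hy (h y hy')) (isClosed_tsupport v)

lemma fieldDeriv_of_notMem_tsupport {X : Π x : M, TangentSpace I x} {v : M → ℝ} {y : M}
    (hy : y ∉ tsupport v) : fieldDeriv I X v y = 0 := by
  rw [fieldDeriv_congr (U := (tsupport v)ᶜ) (g := fun _ ↦ 0) (isClosed_tsupport v).isOpen_compl hy
    fun z hz ↦ image_eq_zero_of_notMem_tsupport hz, fieldDeriv_const]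

variable [RiemannianBundle (fun x : M ↦ TangentSpace I x)]
  [IsContMDiffRiemannianBundle I ∞ E (fun x : M ↦ TangentSpace I x)]
  {f u u' : M → ℝ} {ρ : ℝ} {x₀ x₁ y : M} [Nontrivial E] [I.Boundaryless]
  [MeasurableSpace E] [BorelSpace E]
  (b : Module.Basis (Fin 2) ℝ E) (μ : Measure E) [μ.IsAddHaarMeasure]

/-- Integration against the Riemannian area, with its compatibility with charts and the
divergence theorem for multiples of `∇f`. -/
theorem IsGradientYamabeSoliton.exists_areaFunctional [CompactSpace M] [T2Space M]
    (h : IsGradientYamabeSoliton I f ρ) : ∃ Λ : (M → ℝ) → ℝ,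
      (∀ u u', Continuous u → Continuous u' → Λ (u + u') = Λ u + Λ u') ∧
      (∀ u, Λ (-u) = -Λ u) ∧
      (∀ x₀ u, Continuous u → tsupport u ⊆ (chartAt H x₀).source →
        Λ u = chartIntegral I b μ x₀ u) ∧
      ∀ u, SmoothFun I u Set.univ → Λ (fun y ↦ fieldDeriv I (riemannianGradient I f) u y
        + 2 * solitonFactor I ρ y * u y) = 0 := by
  obtain ⟨s, χ, hχ, hs, hsum⟩ := exists_finite_partition I M
  have hcont : ∀ {g : M → ℝ}, SmoothFun I g Set.univ → Continuous g :=
    fun hg ↦ IsGradientYamabeSoliton.continuous_of_smoothFun hg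
  have hχc : ∀ i, Continuous (χ i) := fun i ↦ hcont (hχ i)
  have hsup : ∀ i (u : M → ℝ), tsupport (χ i * u) ⊆ (chartAt H i).source := fun i u ↦
    (tsupport_subset_of_forall fun y hy ↦ by
      simp [image_eq_zero_of_notMem_tsupport hy]).trans (hs i)
  -- Chart integrals glued by the partition of unity; `hloc` shows that the partition is invisible
  -- on functions supported in one chart.
  let Λ : (M → ℝ) → ℝ := fun u ↦ ∑ i ∈ s, chartIntegral I b μ i (χ i * u)
  have hadd : ∀ u u', Continuous u → Continuous u' → Λ (u + u') = Λ u + Λ u' := by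
    intro u u' hu hu'
    simp only [Λ]
    rw [← Finset.sum_add_distrib]
    refine Finset.sum_congr rfl fun i _ ↦ ?_
    rw [mul_add, chartIntegral_add ((hχc i).mul hu) ((hχc i).mul hu') (hsup i u) (hsup i u')]
  have hzero : Λ 0 = 0 := by
    simp only [Λ, mul_zero, chartIntegral_zero, Finset.sum_const_zero]
  have hneg : ∀ u, Λ (-u) = -Λ u := by
    intro u
    simp only [Λ]
    rw [← Finset.sum_neg_distrib]
    refine Finset.sum_congr rfl fun i _ ↦ ?_
    rw [mul_neg, chartIntegral_neg]
  have hloc : ∀ x₀ u, Continuous u → tsupport u ⊆ (chartAt H x₀).source →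
        Λ u = chartIntegral I b μ x₀ u := by
    intro x₀ u hu hus
    have h1 : ∀ i, chartIntegral I b μ i (χ i * u) = chartIntegral I b μ x₀ (χ i * u) := by
      intro i
      refine chartIntegral_eq_chartIntegral fun y hy ↦ ⟨hs i (subset_tsupport _ ?_),
        hus (subset_tsupport _ ?_)⟩
      · exact left_ne_zero_of_mul hy
      · exact right_ne_zero_of_mul hy
    have hsup' : ∀ i, tsupport (χ i * u) ⊆ (chartAt H x₀).source := fun i ↦
      (tsupport_subset_of_forall fun y hy ↦ by
        simp [image_eq_zero_of_notMem_tsupport hy]).trans hus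
    have h2 : ∀ t : Finset M, ∑ i ∈ t, chartIntegral I b μ x₀ (χ i * u) =
        chartIntegral I b μ x₀ (fun y ↦ ∑ i ∈ t, χ i y * u y) := by
      intro t
      simp only [chartIntegral, Finset.sum_mul]
      exact (integral_finsetSum _ fun i _ ↦
        integrableOn_chartIntegral ((hχc i).mul hu) (hsup' i)).symm
    simp only [Λ, h1, h2]
    congr 1
    funext y
    rw [← Finset.sum_mul, hsum, one_mul]
  refine ⟨Λ, hadd, hneg, hloc, fun u hu ↦ ?_⟩
  set X := riemannianGradient I f with hX
  have hXs : SmoothField I X Set.univ := h.smoothField_gradient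
  have hφc : Continuous (solitonFactor I ρ : M → ℝ) := hcont h.smooth_factor
  have hXχ : ∀ i, Continuous (fieldDeriv I X (χ i)) := fun i ↦
    hcont (hXs.fieldDeriv isOpen_univ (hχ i))
  have huXχ : ∀ i, Continuous (u * fieldDeriv I X (χ i)) := fun i ↦ (hcont hu).mul (hXχ i)
  have hsupX : ∀ i, tsupport (u * fieldDeriv I X (χ i)) ⊆ (chartAt H i).source := fun i ↦
    (tsupport_subset_of_forall fun y hy ↦ by
      simp [fieldDeriv_of_notMem_tsupport hy]).trans (hs i)
  -- χ i (Xu + 2φ u) is X(χ i u) + 2φ χ i u, whose integral vanishes in the chart at i, minus u X(χ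
  -- i).
  have key : ∀ i, chartIntegral I b μ i
      (χ i * fun y ↦ fieldDeriv I X u y + 2 * solitonFactor I ρ y * u y) =
        -Λ (u * fieldDeriv I X (χ i)) := by
    intro i
    have h1 := h.chartIntegral_eq_zero (b := b) (μ := μ) ((hχ i).mul hu) (hsup i u)
    have hc1 : Continuous (fun y ↦ fieldDeriv I X (χ i * u) y
        + 2 * solitonFactor I ρ y * (χ i * u) y) :=
      (hcont (hXs.fieldDeriv isOpen_univ ((hχ i).mul hu))).add
        ((continuous_const.mul hφc).mul ((hχc i).mul (hcont hu)))
    have hs1 : tsupport (fun y ↦ fieldDeriv I X (χ i * u) y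
        + 2 * solitonFactor I ρ y * (χ i * u) y) ⊆ (chartAt H i).source :=
      (tsupport_subset_of_forall fun y hy ↦ by
        simp only [fieldDeriv_of_notMem_tsupport hy, image_eq_zero_of_notMem_tsupport hy]
        ring).trans (hsup i u)
    have h2 : (χ i * fun y ↦ fieldDeriv I X u y + 2 * solitonFactor I ρ y * u y) =
        (fun y ↦ fieldDeriv I X (χ i * u) y + 2 * solitonFactor I ρ y * (χ i * u) y)
          + -(u * fieldDeriv I X (χ i)) := by
      funext y
      simp only [Pi.mul_apply, Pi.add_apply, Pi.neg_apply]
      rw [fieldDeriv_mul_fun (hχ i) hu (Set.mem_univ y)]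
      ring
    have hs2 : tsupport (-(u * fieldDeriv I X (χ i))) ⊆ (chartAt H i).source :=
      (tsupport_subset_of_forall fun y hy ↦ by
        simp [image_eq_zero_of_notMem_tsupport hy]).trans (hsupX i)
    rw [h2, chartIntegral_add hc1 (huXχ i).neg hs1 hs2, h1, zero_add, chartIntegral_neg,
      hloc i _ (huXχ i) (hsupX i)]
  have hsumΛ : ∀ t : Finset M, ∑ i ∈ t, Λ (u * fieldDeriv I X (χ i)) =
      Λ (fun y ↦ ∑ i ∈ t, u y * fieldDeriv I X (χ i) y) := by
    classical
    intro t
    induction t using Finset.induction_on with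
    | empty => exact hzero.symm
    | insert a t ha ih =>
      rw [Finset.sum_insert ha, ih]
      refine (hadd _ _ (huXχ a) (continuous_finsetSum t fun i _ ↦ huXχ i)).symm.trans ?_
      congr 1
      funext y
      rw [Finset.sum_insert ha]
      rfl
  change ∑ i ∈ s, chartIntegral I b μ i _ = 0
  rw [Finset.sum_congr rfl fun i _ ↦ key i, Finset.sum_neg_distrib, hsumΛ, neg_eq_zero]
  -- The leftover terms add up to u X(1) = 0.
  convert hzero using 2
  funext y
  rw [← Finset.mul_sum, ← fieldDeriv_sum (fun i _ ↦ hχ i) (Set.mem_univ y),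
    fieldDeriv_congr (g := fun _ ↦ 1) isOpen_univ (Set.mem_univ y) fun y _ ↦ hsum y,
    fieldDeriv_const, mul_zero]
  rfl

end RiemannianGeometry

end AreaFunctional

/-! ### Concentration of integrals at a nondegenerate minimum in dimension two -/

section Scaling

set_option linter.unusedSectionVars false

open MeasureTheory

variable {E : Type*} [NormedAddCommGroup E] [NormedSpace ℝ E] [FiniteDimensional ℝ E]
  [MeasurableSpace E] [BorelSpace E]

/-- Concentration of `t⁻² β ((F - F z₀) / t²)` at a nondegenerate minimum point `z₀` of `F` in
dimension two. -/
theorem tendsto_integral_rescaled (μ : Measure E) [μ.IsAddHaarMeasure]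
    (hE : Module.finrank ℝ E = 2) {F D q : E → ℝ} {z₀ : E} {r c C : ℝ} {β : ℝ → ℝ}
    (hr : 0 < r) (hc : 0 < c) (hF : ContinuousOn F (Metric.ball z₀ r))
    (hD : ContinuousOn D (Metric.ball z₀ r)) (hDC : ∀ z ∈ Metric.ball z₀ r, |D z| ≤ C)
    (hFq : ∀ ε : ℝ, 0 < ε → ∀ᶠ u in 𝓝 (0 : E), |F (z₀ + u) - F z₀ - q u| ≤ ε * ‖u‖ ^ 2)
    (hFc : ∀ z ∈ Metric.ball z₀ r, c * ‖z - z₀‖ ^ 2 ≤ F z - F z₀)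
    (hq : ∀ (t : ℝ) u, q (t • u) = t ^ 2 * q u)
    (hβ : Continuous β) (hβ0 : ∀ s, 2 < s → β s = 0) {B : ℝ} (hβB : ∀ s, |β s| ≤ B) :
    Filter.Tendsto (fun t : ℝ ↦ ∫ z in Metric.ball z₀ r,
      (t ^ 2)⁻¹ * β ((F z - F z₀) / t ^ 2) * D z ∂μ) (𝓝[>] 0) (𝓝 (∫ v, β (q v) * D z₀ ∂μ)) := by
  have hB0 : 0 ≤ B := (abs_nonneg _).trans (hβB 0)
  have hC0 : 0 ≤ C := (abs_nonneg _).trans (hDC z₀ (Metric.mem_ball_self hr))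
  -- The integrand after z = z₀ + t v; in dimension two the Jacobian t² cancels the factor t⁻².
  set P : ℝ → E → ℝ := fun t ↦ (fun v ↦ z₀ + t • v) ⁻¹' (Metric.ball z₀ r) |>.indicator
    fun v ↦ β ((F (z₀ + t • v) - F z₀) / t ^ 2) * D (z₀ + t • v) with hP
  have hchange : ∀ t : ℝ, 0 < t → ∫ z in Metric.ball z₀ r,
      (t ^ 2)⁻¹ * β ((F z - F z₀) / t ^ 2) * D z ∂μ = ∫ v, P t v ∂μ := by
    intro t ht
    set g : E → ℝ := (Metric.ball z₀ r).indicator fun z ↦ β ((F z - F z₀) / t ^ 2) * D z with hg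
    have h1 : ∀ v, P t v = g (z₀ + t • v) := fun v ↦ rfl
    have h2 : ∫ v, P t v ∂μ = (t ^ 2)⁻¹ * ∫ z, g z ∂μ := by
      simp only [h1]
      rw [Measure.integral_comp_smul μ (fun v ↦ g (z₀ + v)) t, hE,
        integral_add_left_eq_self (μ := μ) g z₀, abs_of_pos (by positivity), smul_eq_mul]
    rw [h2, hg, integral_indicator Metric.isOpen_ball.measurableSet, ← integral_const_mul]
    simp only [mul_assoc]
  refine Filter.Tendsto.congr' (f₁ := fun t ↦ ∫ v, P t v ∂μ) ?_ ?_
  · filter_upwards [self_mem_nhdsWithin] with t ht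
    exact (hchange t ht).symm
  -- Domination: β vanishes beyond 2 and the rescaled F is at least c‖v‖², so P t is zero once ‖v‖²
  -- > 2 / c.
  refine tendsto_integral_filter_of_dominated_convergence
    ((Metric.closedBall (0 : E) (√(2 / c))).indicator fun _ ↦ B * C) ?_ ?_ ?_ ?_
  · filter_upwards with t
    have hopen : IsOpen ((fun v : E ↦ z₀ + t • v) ⁻¹' Metric.ball z₀ r) :=
      Metric.isOpen_ball.preimage (by fun_prop)
    rw [hP, aestronglyMeasurable_indicator_iff hopen.measurableSet]
    refine ContinuousOn.aestronglyMeasurable ?_ hopen.measurableSet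
    have hm : Set.MapsTo (fun v : E ↦ z₀ + t • v) ((fun v : E ↦ z₀ + t • v) ⁻¹' Metric.ball z₀ r)
      (Metric.ball z₀ r) := fun v hv ↦ hv
    have hcm : ContinuousOn (fun v : E ↦ z₀ + t • v)
      ((fun v : E ↦ z₀ + t • v) ⁻¹' Metric.ball z₀ r) := by fun_prop
    exact (hβ.comp_continuousOn (((hF.comp hcm hm).sub continuousOn_const).div_const _)).mul
      (hD.comp hcm hm)
  · filter_upwards [self_mem_nhdsWithin] with t ht
    refine Filter.Eventually.of_forall fun v ↦ ?_
    have ht2 : (0 : ℝ) < t ^ 2 := by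
      have : (0 : ℝ) < t := ht
      positivity
    by_cases hv : z₀ + t • v ∈ Metric.ball z₀ r
    · have h1 : P t v = β ((F (z₀ + t • v) - F z₀) / t ^ 2) * D (z₀ + t • v) :=
        Set.indicator_of_mem (s := (fun v ↦ z₀ + t • v) ⁻¹' (Metric.ball z₀ r)) hv _
      rw [h1, norm_mul]
      by_cases hv2 : v ∈ Metric.closedBall (0 : E) (√(2 / c))
      · rw [Set.indicator_of_mem hv2]
        exact mul_le_mul (hβB _) (hDC _ hv) (norm_nonneg _) hB0
      · rw [Set.indicator_of_notMem hv2, hβ0, norm_zero, zero_mul]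
        rw [mem_closedBall_zero_iff, not_le, Real.sqrt_lt' ] at hv2
        · have h2 := hFc _ hv
          rw [add_sub_cancel_left, norm_smul, mul_pow, Real.norm_eq_abs, sq_abs] at h2
          rw [lt_div_iff₀ ht2]
          rw [div_lt_iff₀ hc] at hv2
          nlinarith
        · by_contra! h3
          have h4 := Real.sqrt_nonneg (2 / c)
          linarith
    · have h1 : P t v = 0 :=
        Set.indicator_of_notMem (s := (fun v ↦ z₀ + t • v) ⁻¹' (Metric.ball z₀ r)) hv _
      rw [h1, norm_zero]
      exact Set.indicator_nonneg (fun _ _ ↦ mul_nonneg hB0 hC0) _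
  · exact (integrable_indicator_iff Metric.isClosed_closedBall.measurableSet).mpr
      (integrableOn_const (isCompact_closedBall (0 : E) _).measure_ne_top)
  · refine Filter.Eventually.of_forall fun v ↦ ?_
    have hlim : Filter.Tendsto (fun t : ℝ ↦ z₀ + t • v) (𝓝[>] 0) (𝓝 z₀) := by
      have : ContinuousAt (fun t : ℝ ↦ z₀ + t • v) 0 := by fun_prop
      have h2 := this.tendsto
      rw [zero_smul, add_zero] at h2
      exact h2.mono_left nhdsWithin_le_nhds
    have hin := hlim.eventually (Metric.ball_mem_nhds z₀ hr)
    have hratio : Filter.Tendsto (fun t : ℝ ↦ (F (z₀ + t • v) - F z₀) / t ^ 2) (𝓝[>] 0)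
        (𝓝 (q v)) := by
      rw [Metric.tendsto_nhds]
      intro ε hε
      have h0 : Filter.Tendsto (fun t : ℝ ↦ t • v) (𝓝[>] 0) (𝓝 0) := by
        have : ContinuousAt (fun t : ℝ ↦ t • v) 0 := by fun_prop
        have h2 := this.tendsto
        rw [zero_smul] at h2
        exact h2.mono_left nhdsWithin_le_nhds
      have hε' : 0 < ε / (‖v‖ ^ 2 + 1) := by positivity
      filter_upwards [h0.eventually (hFq _ hε'), self_mem_nhdsWithin] with t h1 ht
      have ht2 : (0 : ℝ) < t ^ 2 := by
        have : (0 : ℝ) < t := ht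
        positivity
      rw [hq, norm_smul, mul_pow, Real.norm_eq_abs, sq_abs] at h1
      rw [Real.dist_eq]
      have e1 : (F (z₀ + t • v) - F z₀) / t ^ 2 - q v =
          (F (z₀ + t • v) - F z₀ - t ^ 2 * q v) / t ^ 2 := by
        rw [sub_div _ (t ^ 2 * q v), mul_div_cancel_left₀ _ ht2.ne']
      rw [e1, abs_div, abs_of_pos ht2, div_lt_iff₀ ht2]
      refine h1.trans_lt ?_
      have e2 : ε / (‖v‖ ^ 2 + 1) * (t ^ 2 * ‖v‖ ^ 2) =
          ε * t ^ 2 * (‖v‖ ^ 2 / (‖v‖ ^ 2 + 1)) := by ring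
      rw [e2]
      have e3 : ‖v‖ ^ 2 / (‖v‖ ^ 2 + 1) < 1 := by
        rw [div_lt_one (by positivity)]
        linarith
      exact mul_lt_of_lt_one_right (by positivity) e3
    have hDt : Filter.Tendsto (fun t : ℝ ↦ D (z₀ + t • v)) (𝓝[>] 0) (𝓝 (D z₀)) :=
      (hD.continuousAt (Metric.ball_mem_nhds z₀ hr)).tendsto.comp hlim
    refine Filter.Tendsto.congr' ?_ (((hβ.tendsto _).comp hratio).mul hDt)
    filter_upwards [hin] with t ht
    have h1 : P t v = β ((F (z₀ + t • v) - F z₀) / t ^ 2) * D (z₀ + t • v) :=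
      Set.indicator_of_mem (s := (fun v ↦ z₀ + t • v) ⁻¹' (Metric.ball z₀ r)) ht _
    rw [h1]
    rfl

/-- The standard quadratic form of a basis. -/
noncomputable def basisQuadratic (b : Module.Basis (Fin 2) ℝ E) (v : E) : ℝ :=
  b.coord 0 v ^ 2 + b.coord 1 v ^ 2

variable {b : Module.Basis (Fin 2) ℝ E}

lemma continuous_basisQuadratic : Continuous (basisQuadratic b) := by
  have h : ∀ i, Continuous (b.coord i) := fun i ↦ (b.coord i).continuous_of_finiteDimensional
  exact ((h 0).pow 2).add ((h 1).pow 2)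

lemma basisQuadratic_smul (t : ℝ) (v : E) :
    basisQuadratic b (t • v) = t ^ 2 * basisQuadratic b v := by
  simp only [basisQuadratic, map_smul, smul_eq_mul]
  ring

lemma integral_comp_linearMap (μ : Measure E) [μ.IsAddHaarMeasure] (L : E →L[ℝ] E)
    (hL : L.det ≠ 0) (g : E → ℝ) : ∫ v, |L.det| * g (L v) ∂μ = ∫ v, g v ∂μ := by
  have hu : IsUnit (LinearMap.det (L : E →ₗ[ℝ] E)) := isUnit_iff_ne_zero.mpr hL
  have hbij : Function.Bijective L := (LinearEquiv.ofIsUnitDet (f := (L : E →ₗ[ℝ] E))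
    (v := Module.finBasis ℝ E) (v' := Module.finBasis ℝ E)
    (by rwa [LinearMap.det_toMatrix])).bijective
  have h1 := integral_image_eq_integral_abs_det_fderiv_smul (s := Set.univ) μ MeasurableSet.univ
    (f := L) (f' := fun _ ↦ L) (fun x _ ↦ L.hasFDerivAt.hasFDerivWithinAt)
    (hbij.1.injOn) g
  rw [Set.image_univ, hbij.2.range_eq, setIntegral_univ, setIntegral_univ] at h1
  exact h1.symm

lemma integral_basisQuadratic_pos (μ : Measure E) [μ.IsAddHaarMeasure] {β : ℝ → ℝ}
    (hβ : Continuous β) (hβ0 : ∀ s, 2 < s → β s = 0) (hnn : ∀ s, 0 ≤ β s) {s₀ : ℝ} (hs₀ : 0 ≤ s₀)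
    (hpos : 0 < β s₀) : 0 < ∫ v, β (basisQuadratic b v) ∂μ := by
  have hcont : Continuous fun v ↦ β (basisQuadratic b v) := hβ.comp continuous_basisQuadratic
  let e : E ≃L[ℝ] (Fin 2 → ℝ) := b.equivFun.toContinuousLinearEquiv
  have hsupp : HasCompactSupport fun v ↦ β (basisQuadratic b v) := by
    refine HasCompactSupport.intro (K := e ⁻¹' Metric.closedBall 0 2)
      (e.toHomeomorph.isCompact_preimage.mpr (isCompact_closedBall _ _)) fun v hv ↦ hβ0 _ ?_
    by_contra! hle
    refine hv ?_
    rw [Set.mem_preimage, mem_closedBall_zero_iff, pi_norm_le_iff_of_nonneg (by norm_num)]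
    have hb : ∀ i, e v i = b.coord i v := fun i ↦ rfl
    simp only [basisQuadratic] at hle
    intro i
    rw [hb, Real.norm_eq_abs]
    refine abs_le_of_sq_le_sq (?_ : b.coord i v ^ 2 ≤ 2 ^ 2) (by norm_num)
    fin_cases i
    · simp only [Fin.zero_eta]
      nlinarith [sq_nonneg (b.coord 1 v)]
    · simp only [Fin.mk_one]
      nlinarith [sq_nonneg (b.coord 0 v)]
  refine hcont.integral_pos_of_hasCompactSupport_nonneg_nonzero (x := √s₀ • b 0) hsupp
    (fun v ↦ hnn _) ?_
  rw [basisQuadratic_smul, Real.sq_sqrt hs₀]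
  simp [basisQuadratic, hpos.ne']

/-- The integral of a function of a quadratic form on a plane. -/
lemma integral_comp_norm_sq (μ : Measure E) [μ.IsAddHaarMeasure] {V : Type*}
    [NormedAddCommGroup V] [InnerProductSpace ℝ V] (hV : Module.finrank ℝ V = 2) (J : E →ₗ[ℝ] V)
    (hJ : 0 < (Matrix.gram ℝ fun i ↦ J (b i)).det) {a : ℝ} (ha : 0 < a) (β : ℝ → ℝ) :
    ∫ v, β (a * ‖J v‖ ^ 2) * √(Matrix.gram ℝ fun i ↦ J (b i)).det ∂μ =
      a⁻¹ * ∫ v, β (basisQuadratic b v) ∂μ := by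
  have : FiniteDimensional ℝ V := Module.finite_of_finrank_eq_succ hV
  let e : OrthonormalBasis (Fin 2) ℝ V := (stdOrthonormalBasis ℝ V).reindex (finCongr hV)
  -- L is √a times the matrix A of J with respect to b and an orthonormal basis, so it pulls the
  -- standard quadratic form back to a‖J v‖². As det L = a det A and the Gram determinant is (det
  -- A)², the substitution leaves the factor a⁻¹.
  let L : E →ₗ[ℝ] E := ∑ i, (((√a • (innerₛₗ ℝ (e i)).comp J : E →ₗ[ℝ] ℝ))).smulRight (b i)
  have hLv : ∀ v, L v = ∑ i, (√a * inner ℝ (e i) (J v)) • b i := fun v ↦ by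
    simp [L]
  have hLc : ∀ v i, b.coord i (L v) = √a * inner ℝ (e i) (J v) := by
    intro v i
    rw [hLv, map_sum]
    simp [Finsupp.single_apply]
  have hq : ∀ v, basisQuadratic b (L v) = a * ‖J v‖ ^ 2 := by
    intro v
    rw [basisQuadratic, hLc, hLc, mul_pow, mul_pow, Real.sq_sqrt ha.le, ← mul_add,
      ← e.sum_sq_inner_right, Fin.sum_univ_two]
  let A : Matrix (Fin 2) (Fin 2) ℝ := fun k i ↦ inner ℝ (e k) (J (b i))
  have hgram : (Matrix.gram ℝ fun i ↦ J (b i)).det = A.det ^ 2 := by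
    have h1 : (fun i ↦ J (b i)) = fun i ↦ ∑ k, A k i • e k :=
      funext fun i ↦ (e.sum_repr' (J (b i))).symm
    have h2 : Matrix.gram ℝ e = 1 := by
      ext i j
      rw [Matrix.gram_apply, Matrix.one_apply, orthonormal_iff_ite.mp e.orthonormal]
    rw [h1, RiemannianGeometry.gram_sum_smul, h2, mul_one, Matrix.det_mul, Matrix.det_transpose, sq]
  have hdet : L.toContinuousLinearMap.det = a * A.det := by
    have h1 : LinearMap.toMatrix b b L = √a • A := by
      ext k i
      rw [LinearMap.toMatrix_apply, Matrix.smul_apply, smul_eq_mul]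
      exact hLc (b i) k
    rw [ContinuousLinearMap.det, LinearMap.coe_toContinuousLinearMap, ← LinearMap.det_toMatrix b,
      h1, Matrix.det_smul, Fintype.card_fin, Real.sq_sqrt ha.le]
  have hA : A.det ≠ 0 := by
    intro h0
    rw [hgram, h0] at hJ
    norm_num at hJ
  have h := integral_comp_linearMap μ L.toContinuousLinearMap
    (by rw [hdet]; exact mul_ne_zero ha.ne' hA) fun v ↦ β (basisQuadratic b v)
  rw [← h, hdet, hgram, Real.sqrt_sq_eq_abs, abs_mul, abs_of_pos ha, ← integral_const_mul]
  refine integral_congr_ae (Filter.Eventually.of_forall fun v ↦ ?_)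
  simp only [LinearMap.coe_toContinuousLinearMap', hq]
  field_simp

end Scaling

/-! ### Area integrals near an extremum of the potential -/

section Pole

set_option linter.unusedSectionVars false

namespace RiemannianGeometry

open MeasureTheory

variable {E : Type*} [NormedAddCommGroup E] [NormedSpace ℝ E] [FiniteDimensional ℝ E]
  {H : Type*} [TopologicalSpace H] {I : ModelWithCorners ℝ E H}
  {M : Type*} [TopologicalSpace M] [ChartedSpace H M] [IsManifold I ∞ M]
  [RiemannianBundle (fun x : M ↦ TangentSpace I x)]
  [IsContMDiffRiemannianBundle I ∞ E (fun x : M ↦ TangentSpace I x)]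
  {f : M → ℝ} {ρ σ : ℝ} {p : M} [Nontrivial E] [I.Boundaryless]

variable (I) in
/-- The linear map `v ↦ coordField I x₀ v y`. -/
noncomputable def coordFieldLinear (x₀ y : M) : E →ₗ[ℝ] TangentSpace I y where
  toFun v := coordField I x₀ v y
  map_add' _ _ := coordField_add
  map_smul' c _ := coordField_smul c

/-- An injective linear map on a finite-dimensional space is bounded below. Together with the Taylor
expansion this gives quadratic growth at a nondegenerate extremum. -/
lemma exists_coordField_lower_bound : ∃ c : ℝ, 0 < c ∧
    ∀ u : E, c * ‖u‖ ^ 2 ≤ ‖coordField I p u p‖ ^ 2 := by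
  have hker : (coordFieldLinear I p p).ker = ⊥ := by
    rw [LinearMap.ker_eq_bot']
    intro u hu
    by_contra hne
    exact coordField_ne_zero (I := I) (mem_chart_source H p) hne hu
  obtain ⟨K, hK, hKa⟩ := LinearMap.exists_antilipschitzWith (F := TangentSpace I p) _ hker
  have hK' : (0 : ℝ) < K := by exact_mod_cast hK
  refine ⟨((K : ℝ) ^ 2)⁻¹, by positivity, fun u ↦ ?_⟩
  have h1 : ‖u‖ ≤ K * ‖coordField I p u p‖ := by
    have := hKa.le_mul_dist u 0
    rw [map_zero, dist_zero_right, dist_zero_right] at this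
    exact this
  rw [inv_mul_le_iff₀ (by positivity), ← mul_pow]
  exact pow_le_pow_left₀ (norm_nonneg _) h1 2

lemma isCompact_symm_image {K : Set E} (hK : IsCompact K) (hKt : K ⊆ (extChartAt I p).target) :
    IsCompact ((extChartAt I p).symm '' K) :=
  hK.image_of_continuousOn ((continuousOn_extChartAt_symm p).mono hKt)

namespace IsGradientYamabeSoliton

/-- Quadratic approximation at a critical point. -/
lemma eventually_quadratic (h : IsGradientYamabeSoliton I f ρ) (h0 : mvfderiv I f p = 0)
    (σ : ℝ) {ε : ℝ} (hε : 0 < ε) : ∀ᶠ u in 𝓝 (0 : E),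
      |σ * chartRep I p f (extChartAt I p p + u) - σ * chartRep I p f (extChartAt I p p)
        - σ * solitonFactor I ρ p / 2 * ‖coordField I p u p‖ ^ 2| ≤ ε * ‖u‖ ^ 2 := by
  obtain ⟨Q, hQ, hQv⟩ := h.hasFDerivAt_fderiv_chartRep h0
  have hε' : 0 < ε / (|σ| + 1) := by positivity
  have hT := hQ.taylor_two (fun u v ↦ by rw [hQv, hQv, real_inner_comm])
    (by
      filter_upwards [(isOpen_extChartAt_target p).mem_nhds (mem_extChartAt_target (I := I) p)]
        with z hz
      exact (h.smoothFun_univ.contDiffAt_chartRep hz).differentiableAt (by simp))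
    (h.smoothFun_univ.mvfderiv_eq_zero_of_fderiv_chartRep (mem_chart_source H p) h0) hε'
  filter_upwards [hT] with u hu
  rw [hQv, real_inner_self_eq_norm_sq] at hu
  have e1 : σ * chartRep I p f (extChartAt I p p + u) - σ * chartRep I p f (extChartAt I p p)
        - σ * solitonFactor I ρ p / 2 * ‖coordField I p u p‖ ^ 2 =
      σ * (chartRep I p f (extChartAt I p p + u) - chartRep I p f (extChartAt I p p)
        - solitonFactor I ρ p * ‖coordField I p u p‖ ^ 2 / 2) := by ring
  rw [e1, abs_mul]
  refine (mul_le_mul_of_nonneg_left hu (abs_nonneg σ)).trans ?_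
  have e2 : |σ| * (ε / (|σ| + 1) * ‖u‖ ^ 2) = |σ| / (|σ| + 1) * (ε * ‖u‖ ^ 2) := by ring
  rw [e2]
  refine mul_le_of_le_one_left (by positivity) ?_
  rw [div_le_one (by positivity)]
  linarith

variable [MeasurableSpace E] [BorelSpace E]

/-- Area integrals concentrating at a nondegenerate extremum of the potential. -/
theorem tendsto_chartIntegral_pole [CompactSpace M] [T2Space M]
    (h : IsGradientYamabeSoliton I f ρ) (hn : Module.finrank ℝ E = 2)
    (b : Module.Basis (Fin 2) ℝ E) (μ : Measure E) [μ.IsAddHaarMeasure]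
    (h0 : mvfderiv I f p = 0) (hσ : 0 < σ * solitonFactor I ρ p) {Z : Set M} (hZ : IsClopen Z)
    (hp : p ∈ Z) (hmin : ∀ y ∈ Z, y ≠ p → 0 < σ * (f y - f p)) {β : ℝ → ℝ} (hβ : Continuous β)
    (hβ0 : ∀ s, 2 < s → β s = 0) {B : ℝ} (hβB : ∀ s, |β s| ≤ B) :
    (∀ᶠ t in 𝓝[>] (0 : ℝ), tsupport (Z.indicator fun y ↦
      (t ^ 2)⁻¹ * β (σ * (f y - f p) / t ^ 2)) ⊆ (chartAt H p).source) ∧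
    Filter.Tendsto (fun t : ℝ ↦ chartIntegral I b μ p
      (Z.indicator fun y ↦ (t ^ 2)⁻¹ * β (σ * (f y - f p) / t ^ 2))) (𝓝[>] 0)
      (𝓝 ((σ * solitonFactor I ρ p / 2)⁻¹ * ∫ v, β (basisQuadratic b v) ∂μ)) := by
  set z₀ := extChartAt I p p with hz₀
  set a := σ * solitonFactor I ρ p / 2 with ha
  have ha0 : 0 < a := by positivity
  have hfc : Continuous f := IsGradientYamabeSoliton.continuous_of_smoothFun h.smoothFun_univ
  obtain ⟨c, hc, hcb⟩ := exists_coordField_lower_bound (I := I) (p := p)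
  have hac : 0 < a * c := by positivity
  have hsymm : Filter.Tendsto (extChartAt I p).symm (𝓝 z₀) (𝓝 p) := by
    have := (continuousAt_extChartAt_symm (I := I) p).tendsto
    rwa [extChartAt_to_inv] at this
  -- A Taylor error of a c / 2 uses up half of the growth a c.
  have hquad : ∀ᶠ z in 𝓝 z₀, a * c / 2 * ‖z - z₀‖ ^ 2 ≤
      σ * chartRep I p f z - σ * chartRep I p f z₀ := by
    have h1 : Filter.Tendsto (fun z ↦ z - z₀) (𝓝 z₀) (𝓝 0) := by
      have : ContinuousAt (fun z ↦ z - z₀) z₀ := by fun_prop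
      simpa using this.tendsto
    filter_upwards [h1.eventually (h.eventually_quadratic h0 σ (half_pos hac))] with z hz
    rw [← hz₀, add_sub_cancel, ← ha] at hz
    have h2 := (abs_le.mp hz).1
    have h3 := mul_le_mul_of_nonneg_left (hcb (z - z₀)) ha0.le
    linarith
  obtain ⟨r₀, hr₀, hball⟩ := Metric.eventually_nhds_iff_ball.mp ((hquad.and
    ((isOpen_extChartAt_target p).mem_nhds (mem_extChartAt_target (I := I) p))).and
    (hsymm.eventually (hZ.isOpen.mem_nhds hp)))
  set r := r₀ / 2 with hr
  have hr0 : 0 < r := by positivity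
  have hcl : Metric.closedBall z₀ r ⊆ Metric.ball z₀ r₀ :=
    Metric.closedBall_subset_ball (by rw [hr]; linarith)
  have hclt : Metric.closedBall z₀ r ⊆ (extChartAt I p).target := fun z hz ↦ (hball z (hcl hz)).1.2
  have hbt : Metric.ball z₀ r ⊆ (extChartAt I p).target :=
    Metric.ball_subset_closedBall.trans hclt
  set D : E → ℝ := fun z ↦ areaDensity I b p ((extChartAt I p).symm z) with hDdef
  have hDc : ContinuousOn D (extChartAt I p).target := fun z hz ↦
    ((smoothFun_areaDensity (I := I) (b := b) (x₀ := p)).contDiffAt_comp_symm hz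
      (symm_mem_source hz)).continuousAt.continuousWithinAt
  obtain ⟨C, hC⟩ := (isCompact_closedBall z₀ r).exists_bound_of_continuousOn (hDc.mono hclt)
  have hFc : ContinuousOn (fun z ↦ σ * chartRep I p f z) (extChartAt I p).target := fun z hz ↦
    ((h.smoothFun_univ.contDiffAt_chartRep hz).continuousAt.const_mul σ).continuousWithinAt
  -- outside a neighbourhood of `p` the integrand vanishes
  set N : Set M := (chartAt H p).source ∩ extChartAt I p ⁻¹' Metric.ball z₀ r with hN
  have hNo : IsOpen N := isOpen_extChartAt_preimage p Metric.isOpen_ball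
  have hpN : p ∈ N := ⟨mem_chart_source H p, Metric.mem_ball_self hr0⟩
  -- By compactness f stays away from its extreme value off N; since β vanishes beyond 2, the
  -- integrand is zero there as soon as 2 t² < η.
  have hlow : ∃ η : ℝ, 0 < η ∧ ∀ y ∈ Z \ N, η ≤ σ * (f y - f p) := by
    rcases (Z \ N).eq_empty_or_nonempty with he | hne
    · exact ⟨1, one_pos, fun y hy ↦ by rw [he] at hy; exact hy.elim⟩
    · obtain ⟨y₀, hy₀, hy₀m⟩ := (hZ.isClosed.sdiff hNo).isCompact.exists_isMinOn hne
        (f := fun y ↦ σ * (f y - f p)) (by fun_prop)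
      exact ⟨_, hmin y₀ hy₀.1 fun he ↦ hy₀.2 (he ▸ hpN), fun y hy ↦ hy₀m hy⟩
  obtain ⟨η, hη, hηl⟩ := hlow
  have hsmall : ∀ᶠ t in 𝓝[>] (0 : ℝ), 0 < t ∧ 2 * t ^ 2 < η := by
    have h1 : ContinuousAt (fun t : ℝ ↦ 2 * t ^ 2) 0 := by fun_prop
    have h2 : ∀ᶠ t in 𝓝 (0 : ℝ), 2 * t ^ 2 < η := h1.eventually_lt_const (by simpa using hη)
    filter_upwards [self_mem_nhdsWithin, mem_nhdsWithin_of_mem_nhds h2] with t h3 h4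
    exact ⟨h3, h4⟩
  have hvan : ∀ t : ℝ, 0 < t ∧ 2 * t ^ 2 < η → ∀ y ∉ N,
      Z.indicator (fun y ↦ (t ^ 2)⁻¹ * β (σ * (f y - f p) / t ^ 2)) y = 0 := by
    rintro t ⟨ht, ht2⟩ y hy
    by_cases hyZ : y ∈ Z
    · have h1 := hηl y ⟨hyZ, hy⟩
      rw [Set.indicator_of_mem hyZ, hβ0, mul_zero]
      rw [lt_div_iff₀ (by positivity)]
      linarith
    · exact Set.indicator_of_notMem hyZ _
  constructor
  · filter_upwards [hsmall] with t ht
    have hK := isCompact_symm_image (isCompact_closedBall z₀ r) hclt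
    refine (closure_minimal (fun y hy ↦ ?_) hK.isClosed).trans ?_
    · have hyN : y ∈ N := by_contra fun hy' ↦ hy (hvan t ht y hy')
      exact ⟨_, Metric.ball_subset_closedBall hyN.2,
        (extChartAt I p).left_inv (by rw [extChartAt_source]; exact hyN.1)⟩
    · rintro _ ⟨z, hz, rfl⟩
      exact symm_mem_source (hclt hz)
  have hlim := tendsto_integral_rescaled μ hn (F := fun z ↦ σ * chartRep I p f z) (D := D)
    (q := fun u ↦ a * ‖coordField I p u p‖ ^ 2) hr0 (half_pos hac) (hFc.mono hbt) (hDc.mono hbt)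
    (fun z hz ↦ hC z (Metric.ball_subset_closedBall hz))
    (fun ε hε ↦ h.eventually_quadratic h0 σ hε)
    (fun z hz ↦ (hball z (hcl (Metric.ball_subset_closedBall hz))).1.1)
    (fun t u ↦ by
      rw [coordField_smul, norm_smul, mul_pow, Real.norm_eq_abs, sq_abs]
      ring) hβ hβ0 hβB
  have hval := integral_comp_norm_sq (b := b) μ (V := TangentSpace I p) hn
    (coordFieldLinear I p p) (gramDet_pos (I := I) (mem_chart_source H p)) ha0 β
  have hD₀ : D z₀ = √(gramDet I b p p) := by
    rw [hDdef]
    simp only [hz₀, extChartAt_to_inv]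
    rfl
  rw [hD₀] at hlim
  have hval' : ∫ v, β (a * ‖coordField I p v p‖ ^ 2) * √(gramDet I b p p) ∂μ =
      a⁻¹ * ∫ v, β (basisQuadratic b v) ∂μ := hval
  rw [hval'] at hlim
  refine hlim.congr' ?_
  filter_upwards [hsmall] with t ht
  rw [chartIntegral, setIntegral_eq_of_subset_of_forall_sdiff_eq_zero
    (isOpen_extChartAt_target p).measurableSet hbt]
  · refine setIntegral_congr_fun Metric.isOpen_ball.measurableSet fun z hz ↦ ?_
    have hzZ := (hball z (hcl (Metric.ball_subset_closedBall hz))).2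
    simp only [Set.indicator_of_mem (show (extChartAt I p).symm z ∈ Z from hzZ)]
    rw [hz₀, chartRep_self, chartRep, mul_sub]
  · intro z hz
    rw [hvan t ht _ fun hzN ↦ hz.2 ?_, zero_mul]
    have := hzN.2
    rwa [Set.mem_preimage, (extChartAt I p).right_inv hz.1] at this

end IsGradientYamabeSoliton

end RiemannianGeometry

end Pole

/-! ### The balance of the two poles and the conclusion on surfaces -/

section Balance

set_option linter.unusedSectionVars false

namespace RiemannianGeometry

open MeasureTheory

/-- A smooth monotone step from `0` on `(-∞, 1]` to `1` on `[2, ∞)`. -/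
noncomputable def smoothStep (s : ℝ) : ℝ := Real.smoothTransition (s - 1)

lemma contDiff_smoothStep : ContDiff ℝ ∞ smoothStep :=
  (Real.smoothTransition.contDiff (n := ⊤)).comp (contDiff_id.sub contDiff_const)

lemma smoothStep_of_le {s : ℝ} (hs : s ≤ 1) : smoothStep s = 0 :=
  Real.smoothTransition.zero_of_nonpos (by linarith)

lemma smoothStep_of_ge {s : ℝ} (hs : 2 ≤ s) : smoothStep s = 1 :=
  Real.smoothTransition.one_of_one_le (by linarith)

lemma continuous_deriv_smoothStep : Continuous (deriv smoothStep) :=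
  contDiff_smoothStep.continuous_deriv (by simp)

lemma hasDerivAt_smoothStep (s : ℝ) : HasDerivAt smoothStep (deriv smoothStep s) s :=
  (contDiff_smoothStep.differentiable (by simp) s).hasDerivAt

lemma deriv_smoothStep_of_gt {s : ℝ} (hs : 2 < s) : deriv smoothStep s = 0 := by
  have h1 : smoothStep =ᶠ[𝓝 s] fun _ ↦ 1 := by
    filter_upwards [lt_mem_nhds hs] with y hy using smoothStep_of_ge hy.le
  rw [h1.deriv_eq, deriv_const]

lemma deriv_smoothStep_of_lt {s : ℝ} (hs : s < 1) : deriv smoothStep s = 0 := by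
  have h1 : smoothStep =ᶠ[𝓝 s] fun _ ↦ 0 := by
    filter_upwards [gt_mem_nhds hs] with y hy using smoothStep_of_le hy.le
  rw [h1.deriv_eq, deriv_const]

lemma deriv_smoothStep_nonneg (s : ℝ) : 0 ≤ deriv smoothStep s :=
  Monotone.deriv_nonneg fun _ _ hxy ↦ Real.smoothTransition.monotone (sub_le_sub_right hxy 1)

/-- Used to show that the common constant in the limits at the two poles is positive and can be
cancelled. -/
lemma exists_deriv_smoothStep_pos : ∃ s, 0 ≤ s ∧ 0 < deriv smoothStep s := by
  obtain ⟨c, hc, h⟩ := exists_deriv_eq_slope smoothStep (by norm_num : (1 : ℝ) < 2)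
    contDiff_smoothStep.continuous.continuousOn
    (contDiff_smoothStep.differentiable (by simp)).differentiableOn
  refine ⟨c, by linarith [hc.1], ?_⟩
  rw [h, smoothStep_of_le le_rfl, smoothStep_of_ge le_rfl]
  norm_num

lemma exists_deriv_smoothStep_bound : ∃ B, ∀ s, |deriv smoothStep s| ≤ B := by
  obtain ⟨B, hB⟩ := (isCompact_Icc (a := (1 : ℝ)) (b := 2)).exists_bound_of_continuousOn
    continuous_deriv_smoothStep.continuousOn
  refine ⟨max B 0, fun s ↦ ?_⟩
  rcases lt_or_ge s 1 with h1 | h1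
  · rw [deriv_smoothStep_of_lt h1, abs_zero]
    exact le_max_right _ _
  rcases lt_or_ge 2 s with h2 | h2
  · rw [deriv_smoothStep_of_gt h2, abs_zero]
    exact le_max_right _ _
  · exact (hB s ⟨h1, h2⟩).trans (le_max_left _ _)

variable {E : Type*} [NormedAddCommGroup E] [NormedSpace ℝ E] [FiniteDimensional ℝ E]
  {H : Type*} [TopologicalSpace H] {I : ModelWithCorners ℝ E H}
  {M : Type*} [TopologicalSpace M] [ChartedSpace H M] [IsManifold I ∞ M]
  [RiemannianBundle (fun x : M ↦ TangentSpace I x)]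
  [IsContMDiffRiemannianBundle I ∞ E (fun x : M ↦ TangentSpace I x)]
  {f : M → ℝ} {ρ σ : ℝ} {p q : M} [Nontrivial E] [I.Boundaryless]

namespace IsGradientYamabeSoliton

/-- Solving `X u + 2 φ u = k'(f)` for the gradient field `X`, where `k` vanishes near the critical
values. -/
lemma exists_solution (h : IsGradientYamabeSoliton I f ρ) {Z : Set M} (hZ : IsClopen Z)
    {k : ℝ → ℝ} (hk : ContDiff ℝ ∞ k)
    (hk0 : ∀ y ∈ Z, gradNormSq I f y = 0 → k =ᶠ[𝓝 (f y)] fun _ ↦ 0) :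
    ∃ u : M → ℝ, SmoothFun I u Set.univ ∧ ∀ y, fieldDeriv I (riemannianGradient I f) u y
      + 2 * solitonFactor I ρ y * u y = Z.indicator (fun y ↦ deriv k (f y)) y := by
  have hfc : Continuous f := IsGradientYamabeSoliton.continuous_of_smoothFun h.smoothFun_univ
  have hwc : Continuous (gradNormSq I f : M → ℝ) :=
    IsGradientYamabeSoliton.continuous_of_smoothFun h.smooth_gradNormSq
  -- For u = k(f) / w, the rules Xf = w and Xw = 2φ w give Xu = k'(f) - 2φ u. Since k vanishes near
  -- the critical values, u extends smoothly by zero.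
  set g : M → ℝ := (fun y ↦ k (f y)) / gradNormSq I f with hg
  set V : Set M := Z ∩ {y | gradNormSq I f y ≠ 0} with hV
  have hVo : IsOpen V := hZ.isOpen.inter (isOpen_ne_fun hwc continuous_const)
  have hkf : ∀ {U : Set M}, SmoothFun I (fun y ↦ k (f y)) U := fun {U} ↦
    SmoothFun.comp (h.smoothFun (U := U)) fun y _ ↦ hk.contDiffAt
  have hgs : SmoothFun I g V := hkf.div h.smooth_gradNormSq fun y hy ↦ hy.2
  have hzero : ∀ y ∉ V, ∃ U : Set M, IsOpen U ∧ y ∈ U ∧ ∀ z ∈ U, Z.indicator g z = 0 := by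
    intro y hy
    by_cases hyZ : y ∈ Z
    · have hy0 : gradNormSq I f y = 0 := by_contra fun h0 ↦ hy ⟨hyZ, h0⟩
      obtain ⟨U, hU, hUo, hyU⟩ := eventually_nhds_iff.mp
        (hfc.continuousAt.eventually (hk0 y hyZ hy0))
      refine ⟨U, hUo, hyU, fun z hz ↦ ?_⟩
      by_cases hzZ : z ∈ Z
      · rw [Set.indicator_of_mem hzZ, hg, Pi.div_apply, hU z hz, zero_div]
      · exact Set.indicator_of_notMem hzZ _
    · exact ⟨Zᶜ, hZ.isClosed.isOpen_compl, hyZ, fun z hz ↦ Set.indicator_of_notMem hz _⟩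
  refine ⟨Z.indicator g, fun y _ ↦ ?_, fun y ↦ ?_⟩
  · by_cases hy : y ∈ V
    · exact (hgs.congr hVo fun z hz ↦ Set.indicator_of_mem hz.1 _) y hy
    · obtain ⟨U, hU, hyU, h0⟩ := hzero y hy
      exact (SmoothFun.congr (SmoothFun.const 0) hU h0) y hyU
  · by_cases hy : y ∈ V
    · have hw : gradNormSq I f y ≠ 0 := hy.2
      rw [Set.indicator_of_mem hy.1, Set.indicator_of_mem hy.1,
        fieldDeriv_congr hVo hy fun z hz ↦ Set.indicator_of_mem hz.1 g]
      have h1 := fieldDeriv_mul_fun (X := riemannianGradient I f) hgs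
        (h.smooth_gradNormSq (U := V)) hy
      have h2 : fieldDeriv I (riemannianGradient I f) (g * gradNormSq I f) y =
          fieldDeriv I (riemannianGradient I f) (fun z ↦ k (f z)) y :=
        fieldDeriv_congr hVo hy fun z hz ↦ div_mul_cancel₀ _ hz.2
      have h3 : fieldDeriv I (riemannianGradient I f) f y = gradNormSq I f y :=
        mvfderiv_gradient f y
      rw [h2, fieldDeriv_comp_real (h.smoothFun (U := V)) hy
          (hk.differentiable (by simp) _).hasDerivAt,
        h.fieldDeriv_gradNormSq (h.smoothField_gradient (U := V)) hy, h3] at h1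
      refine mul_right_cancel₀ hw ?_
      linear_combination -h1
    · obtain ⟨U, hU, hyU, h0⟩ := hzero y hy
      rw [fieldDeriv_congr hU hyU h0, fieldDeriv_const, h0 y hyU, mul_zero, add_zero]
      by_cases hyZ : y ∈ Z
      · have hy0 : gradNormSq I f y = 0 := by_contra fun h0 ↦ hy ⟨hyZ, h0⟩
        rw [Set.indicator_of_mem hyZ, (hk0 y hyZ hy0).deriv_eq, deriv_const]
      · exact (Set.indicator_of_notMem hyZ _).symm

/-- On a closed surface, if the potential has exactly one minimum and one maximum point on an open
and closed set and no other critical points there, then the soliton factors at these two points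
are opposite. -/
theorem factor_eq_neg_factor [CompactSpace M] [T2Space M]
    (h : IsGradientYamabeSoliton I f ρ) (hn : Module.finrank ℝ E = 2) {Z : Set M}
    (hZ : IsClopen Z) (hp : p ∈ Z) (hq : q ∈ Z) (hp0 : mvfderiv I f p = 0)
    (hq0 : mvfderiv I f q = 0) (hφp : 0 < solitonFactor I ρ p) (hφq : solitonFactor I ρ q < 0)
    (hmin : ∀ y ∈ Z, y ≠ p → f p < f y) (hmax : ∀ y ∈ Z, y ≠ q → f y < f q)
    (hreg : ∀ y ∈ Z, f p < f y → f y < f q → gradNormSq I f y ≠ 0) :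
    solitonFactor I ρ p = -solitonFactor I ρ q := by
  let _ : MeasurableSpace E := borel E
  have : BorelSpace E := ⟨rfl⟩
  let μ : Measure E := Measure.addHaar
  let b : Module.Basis (Fin 2) ℝ E := (Module.finBasis ℝ E).reindex (finCongr hn)
  have hfc : Continuous f := IsGradientYamabeSoliton.continuous_of_smoothFun h.smoothFun_univ
  have hpq : p ≠ q := by
    rintro rfl
    exact hφp.not_gt hφq
  have hmk : f p < f q := hmin q hq hpq.symm
  obtain ⟨B, hB⟩ := exists_deriv_smoothStep_bound
  obtain ⟨s₀, hs₀, hs₀pos⟩ := exists_deriv_smoothStep_pos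
  have hK := integral_basisQuadratic_pos (b := b) μ continuous_deriv_smoothStep
    (fun s ↦ deriv_smoothStep_of_gt) deriv_smoothStep_nonneg hs₀ hs₀pos
  set K := ∫ v, deriv smoothStep (basisQuadratic b v) ∂μ with hKdef
  obtain ⟨hsp, hlp⟩ := h.tendsto_chartIntegral_pole (σ := 1) hn b μ hp0 (by rwa [one_mul]) hZ hp
    (fun y hy hne ↦ by linarith [hmin y hy hne]) continuous_deriv_smoothStep
    (fun s ↦ deriv_smoothStep_of_gt) hB
  obtain ⟨hsq, hlq⟩ := h.tendsto_chartIntegral_pole (σ := -1) hn b μ hq0 (by linarith) hZ hq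
    (fun y hy hne ↦ by linarith [hmax y hy hne]) continuous_deriv_smoothStep
    (fun s ↦ deriv_smoothStep_of_gt) hB
  obtain ⟨Λ, hadd, hneg, hloc, hdiv⟩ := h.exists_areaFunctional b μ
  have hcont : ∀ (σ c t : ℝ), Continuous (Z.indicator fun y ↦
      (t ^ 2)⁻¹ * deriv smoothStep (σ * (f y - c) / t ^ 2)) := by
    intro σ c t
    refine Continuous.indicator (by rw [hZ.frontier_eq]; simp) ?_
    exact continuous_const.mul (continuous_deriv_smoothStep.comp (by fun_prop))
  -- With this gap, a value within t² of one extreme value is more than 2 t² away from the other, so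
  -- that one step equals 0 and the other 1.
  have hsmall : ∀ᶠ t in 𝓝[>] (0 : ℝ), 0 < t ∧ 3 * t ^ 2 < f q - f p := by
    have h1 : ContinuousAt (fun t : ℝ ↦ 3 * t ^ 2) 0 := by fun_prop
    have h2 : ∀ᶠ t in 𝓝 (0 : ℝ), 3 * t ^ 2 < f q - f p :=
      h1.eventually_lt_const (by simpa using hmk)
    filter_upwards [self_mem_nhdsWithin, mem_nhdsWithin_of_mem_nhds h2] with t h3 h4
    exact ⟨h3, h4⟩
  have heq : ∀ᶠ t in 𝓝[>] (0 : ℝ),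
      chartIntegral I b μ p (Z.indicator fun y ↦
        (t ^ 2)⁻¹ * deriv smoothStep (1 * (f y - f p) / t ^ 2)) =
      chartIntegral I b μ q (Z.indicator fun y ↦
        (t ^ 2)⁻¹ * deriv smoothStep (-1 * (f y - f q) / t ^ 2)) := by
    filter_upwards [hsp, hsq, hsmall] with t htp htq ht
    have ht2 : 0 < t ^ 2 := pow_pos ht.1 2
    rw [← hloc p _ (hcont _ _ _) htp, ← hloc q _ (hcont _ _ _) htq]
    -- The derivative of k is the difference of the bumps concentrating at p and q; subtracting 1
    -- makes k vanish near both extreme values.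
    set k : ℝ → ℝ := fun s ↦ smoothStep (1 * (s - f p) / t ^ 2)
      + smoothStep (-1 * (s - f q) / t ^ 2) - 1 with hk
    have hks : ContDiff ℝ ∞ k :=
      ((contDiff_smoothStep.comp (by fun_prop)).add
        (contDiff_smoothStep.comp (by fun_prop))).sub contDiff_const
    have hkd : ∀ s, deriv k s = (t ^ 2)⁻¹ * deriv smoothStep (1 * (s - f p) / t ^ 2)
        - (t ^ 2)⁻¹ * deriv smoothStep (-1 * (s - f q) / t ^ 2) := by
      intro s
      have hlin : ∀ σ c : ℝ, HasDerivAt (fun s ↦ σ * (s - c) / t ^ 2) (σ * 1 / t ^ 2) s :=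
        fun σ c ↦ (((hasDerivAt_id s).sub_const c).const_mul σ).div_const _
      have h1 := (((hasDerivAt_smoothStep (1 * (s - f p) / t ^ 2)).comp s (hlin 1 (f p))).add
        ((hasDerivAt_smoothStep (-1 * (s - f q) / t ^ 2)).comp s (hlin (-1) (f q)))).sub_const 1
      rw [show deriv k s = _ from h1.deriv]
      ring
    have hkm : ∀ s, s - f p < t ^ 2 → k s = 0 := by
      intro s hs
      rw [hk]
      simp only
      rw [smoothStep_of_le (by rw [div_le_one ht2]; linarith),
        smoothStep_of_ge (by rw [le_div_iff₀ ht2]; linarith)]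
      norm_num
    have hkM : ∀ s, f q - s < t ^ 2 → k s = 0 := by
      intro s hs
      rw [hk]
      simp only
      rw [smoothStep_of_ge (by rw [le_div_iff₀ ht2]; linarith),
        smoothStep_of_le (by rw [div_le_one ht2]; linarith)]
      norm_num
    obtain ⟨u, hu, hueq⟩ := h.exists_solution hZ hks fun y hy hy0 ↦ by
      by_cases hyp : y = p
      · rw [hyp]
        filter_upwards [gt_mem_nhds (show f p < f p + t ^ 2 by linarith)] with s hs
        exact hkm s (by linarith)
      · have hyq : y = q := by
          by_contra hne
          exact hreg y hy (hmin y hy hyp) (hmax y hy hne) hy0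
        rw [hyq]
        filter_upwards [lt_mem_nhds (show f q - t ^ 2 < f q by linarith)] with s hs
        exact hkM s (by linarith)
    have h1 := hdiv u hu
    have h2 : (fun y ↦ fieldDeriv I (riemannianGradient I f) u y
        + 2 * solitonFactor I ρ y * u y) =
        (Z.indicator fun y ↦ (t ^ 2)⁻¹ * deriv smoothStep (1 * (f y - f p) / t ^ 2))
        + -(Z.indicator fun y ↦ (t ^ 2)⁻¹ * deriv smoothStep (-1 * (f y - f q) / t ^ 2)) := by
      funext y
      rw [hueq, Pi.add_apply, Pi.neg_apply]
      by_cases hy : y ∈ Z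
      · rw [Set.indicator_of_mem hy, Set.indicator_of_mem hy, Set.indicator_of_mem hy, hkd]
        ring
      · rw [Set.indicator_of_notMem hy, Set.indicator_of_notMem hy, Set.indicator_of_notMem hy]
        ring
    rw [h2, hadd _ _ (hcont _ _ _) (hcont _ _ _).neg, hneg] at h1
    linarith
  -- The equal integrals have limits 2K / φ(p) and -2K / φ(q).
  have hlim := tendsto_nhds_unique (hlp.congr' heq) hlq
  rw [← hKdef] at hlim
  have h1 := inv_injective (mul_right_cancel₀ hK.ne' hlim)
  linarith

/-- On a closed surface the potential of a gradient Yamabe soliton is locally constant. -/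
theorem gradNormSq_eq_zero_of_finrank_eq_two [CompactSpace M] [T2Space M]
    [LocallyPathConnectedSpace H] (h : IsGradientYamabeSoliton I f ρ)
    (hn : Module.finrank ℝ E = 2) (x₀ : M) : gradNormSq I f x₀ = 0 := by
  by_contra hw₀
  set Z := connectedComponent x₀ with hZdef
  have hZ : IsClopen Z := isClopen_connectedComponent_of_chartedSpace (H := H) x₀
  have hf := h.smoothFun_univ
  have hfc : Continuous f := IsGradientYamabeSoliton.continuous_of_smoothFun hf
  have hd : ∀ x, MDiffAt f x := fun x ↦ hf.mdiffAt (Set.mem_univ x)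
  have hx₀ : x₀ ∈ Z := mem_connectedComponent
  obtain ⟨p, hp, hpm⟩ := hZ.isClosed.isCompact.exists_isMinOn ⟨x₀, hx₀⟩ hfc.continuousOn
  obtain ⟨q, hq, hqm⟩ := hZ.isClosed.isCompact.exists_isMaxOn ⟨x₀, hx₀⟩ hfc.continuousOn
  have hmle : ∀ y ∈ Z, f p ≤ f y := fun y hy ↦ hpm hy
  have hlek : ∀ y ∈ Z, f y ≤ f q := fun y hy ↦ hqm hy
  have hcmin : ∀ y ∈ Z, f y = f p → mvfderiv I f y = 0 := fun y hy he ↦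
    mvfderiv_eq_zero_of_isLocalMin (hd y) (by
      filter_upwards [hZ.isOpen.mem_nhds hy] with z hz
      rw [he]
      exact hmle z hz)
  have hcmax : ∀ y ∈ Z, f y = f q → mvfderiv I f y = 0 := fun y hy he ↦
    mvfderiv_eq_zero_of_isLocalMax (hd y) (by
      filter_upwards [hZ.isOpen.mem_nhds hy] with z hz
      rw [he]
      exact hlek z hz)
  have hm₀ : f p < f x₀ := lt_of_le_of_ne (hmle x₀ hx₀) fun he ↦
    hw₀ (mvfderiv_eq_zero_iff.mp (hcmin x₀ hx₀ he.symm))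
  have hk₀ : f x₀ < f q := lt_of_le_of_ne (hlek x₀ hx₀) fun he ↦
    hw₀ (mvfderiv_eq_zero_iff.mp (hcmax x₀ hx₀ he))
  obtain ⟨B, C, hBC⟩ := h.exists_profile hn x₀
  have hp0 := hcmin p hp rfl
  have hq0 := hcmax q hq rfl
  have hWp := mvfderiv_eq_zero_iff.mp hp0
  have hWq := mvfderiv_eq_zero_iff.mp hq0
  have hW₀ := lt_of_le_of_ne (gradNormSq_nonneg f x₀) (Ne.symm hw₀)
  rw [(hBC p hp).2] at hWp
  rw [(hBC q hq).2] at hWq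
  rw [(hBC x₀ hx₀).2] at hW₀
  -- The profile of |∇f|² vanishes at the extreme values of f on Z and is positive at f x₀; half its
  -- slope is φ.
  obtain ⟨hC, hφp, hφq, hpos⟩ := profile_shape hm₀ hk₀ hWp hWq hW₀
  have hregw : ∀ y ∈ Z, f p < f y → f y < f q → gradNormSq I f y ≠ 0 := by
    intro y hy h1 h2
    rw [(hBC y hy).2]
    exact (hpos _ ⟨h1, h2⟩).ne'
  have hreg : ∀ y ∈ Z, f p < f y → f y < f q → mvfderiv I f y ≠ 0 := fun y hy h1 h2 h3 ↦
    hregw y hy h1 h2 (mvfderiv_eq_zero_iff.mp h3)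
  have hiso : ∀ x, mvfderiv I f x = 0 → x ∈ Z → ∀ᶠ y in 𝓝[≠] x, mvfderiv I f y ≠ 0 := by
    intro x hx0 hx
    refine h.eventually_regular hx0 ?_
    rcases (hmle x hx).lt_or_eq with h1 | h1
    · rcases (hlek x hx).lt_or_eq with h2 | h2
      · exact absurd hx0 (hreg x hx h1 h2)
      · rw [(hBC x hx).1, h2]
        exact hφq.ne
    · rw [(hBC x hx).1, ← h1]
      exact hφp.ne'
  have hE : 1 < Module.rank ℝ E := by
    rw [← Module.finrank_eq_rank, hn]
    norm_num
  have hminu : ∀ y ∈ Z, y ≠ p → f p < f y := fun y hy hne ↦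
    lt_of_le_of_ne (hmle y hy) fun he ↦
      hne (eq_of_minimum hf hE hmle hlek hreg hiso hy hp he.symm rfl)
  have hnegd : ∀ y, mvfderiv I (fun z ↦ -f z) y = 0 ↔ mvfderiv I f y = 0 := fun y ↦ by
    rw [show (fun z ↦ -f z) = -f from rfl, mvfderiv_neg, neg_eq_zero]
  -- A maximum point of f is a minimum point of -f, which has the same critical points.
  have hmaxu : ∀ y ∈ Z, y ≠ q → f y < f q := fun y hy hne ↦
    lt_of_le_of_ne (hlek y hy) fun he ↦
      hne (eq_of_minimum (f := fun z ↦ -f z) (m := -f q) (k := -f p)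
        (SmoothFun.comp (k := fun s ↦ -s) hf fun _ _ ↦ contDiffAt_id.neg) hE
        (fun z hz ↦ neg_le_neg (hlek z hz)) (fun z hz ↦ neg_le_neg (hmle z hz))
        (fun z hz h1 h2 ↦ (hnegd z).not.mpr (hreg z hz (neg_lt_neg_iff.mp h2)
          (neg_lt_neg_iff.mp h1)))
        (fun z hz0 hz ↦ (hiso z ((hnegd z).mp hz0) hz).mono fun y hy ↦ (hnegd y).not.mpr hy)
        hy hq (by rw [he]) rfl)
  -- The balance demands opposite slopes of the profile at its two zeros, which `profile_slopes_ne`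
  -- excludes.
  have hfin := h.factor_eq_neg_factor hn hZ hp hq hp0 hq0 (by rw [(hBC p hp).1]; exact hφp)
    (by rw [(hBC q hq).1]; exact hφq) hminu hmaxu hregw
  rw [(hBC p hp).1, (hBC q hq).1] at hfin
  exact profile_slopes_ne hC (hm₀.trans hk₀) hWp hWq hfin

end IsGradientYamabeSoliton

end RiemannianGeometry

end Balance

/-! ### The theorem -/

theorem proposition1p4 (n : ℕ) (hn : 1 ≤ n)
    (M : Type*) [TopologicalSpace M] [T2Space M] [CompactSpace M]
    [ChartedSpace (EuclideanSpace ℝ (Fin n)) M] [IsManifold (𝓡 n) ∞ M]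
    [RiemannianBundle (fun x : M ↦ TangentSpace (𝓡 n) x)]
    [IsContMDiffRiemannianBundle (𝓡 n) ∞ (EuclideanSpace ℝ (Fin n))
      (fun x : M ↦ TangentSpace (𝓡 n) x)]
    (f : M → ℝ) (ρ : ℝ) (hf : RiemannianGeometry.IsGradientYamabeSoliton (𝓡 n) f ρ) :
    ∀ x : M, RiemannianGeometry.scalarCurvature (𝓡 n) x = ρ := by
  intro x
  have hfin : Module.finrank ℝ (EuclideanSpace ℝ (Fin n)) = n := finrank_euclideanSpace_fin
  have : Nontrivial (EuclideanSpace ℝ (Fin n)) :=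
    Module.nontrivial_of_finrank_pos (R := ℝ) (by omega)
  refine sub_eq_zero.mp (show RiemannianGeometry.solitonFactor (𝓡 n) ρ x = 0 from ?_)
  rcases (show n = 1 ∨ n = 2 ∨ 3 ≤ n by omega) with h1 | h2 | h3
  · exact hf.factor_eq_zero_of_finrank_eq_one (hfin.trans h1) x
  · exact hf.factor_eq_zero_of_gradient
      (hf.gradNormSq_eq_zero_of_finrank_eq_two (hfin.trans h2)) x
  · exact hf.factor_eq_zero_of_three_le_finrank (by omega) x
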